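/- Conventions. Let $\mathcal L=\mathbb H/\Gamma$ be a Riemann surface orbifold of hyperbolic nature, where $\Gamma$ is a Fuchsian group (a discrete group of Möbius transformations of the hyperbolic plane, possibly with elliptic elements); its cone points are the images of the fixed points of elliptic elements. $\mathcal L$ is of finite type if it is isomorphic to a compact Riemann surface orbifold from which finitely many points were removed. A singular projective structure ${\sf P}$ on $\mathcal L$ consists of a closed discrete set $\Upsilon\subseteq\mathcal L$ containing all cone points and a holomorphic atlas on the Riemann surface $\mathcal L\setminus\Upsilon$ with values in $\mathbb{CP}^1$ whose changes of coordinates are locally restrictions of Möbius transformations. It has a monodromy representation $\mu:\pi_1(\mathcal L\setminus\Upsilon)\to \mathrm{PSL}(2,\mathbb C)$ and an equivariant developing map $D$ from the universal covering of $\mathcal L\setminus\Upsilon$ to $\mathbb{CP}^1$; $D$ descends to the monodromy-developing map $D_\mu:\mathcal L_\mu\to\mathbb{CP}^1$ on the monodromy covering $\mathcal L_\mu$, the regular covering of $\mathcal L\setminus\Upsilon$ associated with $\ker\mu$. ${\sf P}$ is *uniformizable* if $D_\mu$ is injective. ${\sf P}$ is *bounded* if its Schwarzian differential, that is, the Schwarzian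 derivative $\xi(z)\,dz^2$ of its charts lifted to $\mathbb H$, has finite hyperbolic norm $\sup_{z}|\xi(z)|(\operatorname{Im} z)^2<\infty$ (in the unit disc model, $\frac14\sup|\xi(z)|(1-|z|^2)^2<\infty$), the supremum being over the points $z$ that do not lie over $\Upsilon$. A bounded ${\sf P}$ is a *bounded covering projective structure* if $D$ is a covering of its image and the monodromy group $\mu(\pi_1(\mathcal L\setminus\Upsilon))$ acts discontinuously on the image of $D$. Lemma. Let $\mathcal L$ be a Riemann surface orbifold of finite type, of hyperbolic nature, and let ${\sf P}$ be a bounded covering projective structure on $\mathcal L$. Then there exist a Riemann surface orbifold $\mathcal L^{*}=\mathbb H/\Gamma^{*}$ of finite type, a uniformizable singular projective structure ${\sf P}_\sim$ on $\mathcal L^{*}$, and a finite ramified covering of orbifolds $q:\mathcal L\to\mathcal L^{*}$ (a proper surjective map with finite fibres, induced by an isomorphism of the orbifold universal coverings; in particular $\mathcal L^{*}$ is a quotient of $\mathcal L$ by an equivalence relation with finite classes), such that ${\sf P}$ is the pull-back of ${\sf P}_\sim$ by $q$ away from the singular points of the two structures. -/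

import Mathlib

open scoped Manifold ContDiff MatrixGroups Topology UpperHalfPlane

noncomputable section

namespace ProjOrbifold

/-! ### Riemann surface orbifolds of hyperbolic nature -/

/-- The Riemann surface orbifold `𝓛 = ℍ / Γ` with its quotient topology. For a Fuchsian group
`Γ`, given as a discrete subgroup of `SL(2, ℝ)`, the matrices `1` and `-1` act trivially on the
hyperbolic plane, which is taken in the upper half-plane model. -/
abbrev Orbifold (Γ : Subgroup SL(2, ℝ)) : Type := MulAction.orbitRel.Quotient Γ ℍ

/-- The quotient projection `ℍ → ℍ / Γ`, the orbifold universal covering of `ℍ / Γ`. -/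
def proj (Γ : Subgroup SL(2, ℝ)) (z : ℍ) : Orbifold Γ := Quotient.mk _ z

/-- The singular (orbifold, cone) points of `ℍ / Γ`: the images of the points which are fixed by
an element of `Γ` that acts non-trivially on `ℍ`. -/
def conePoints (Γ : Subgroup SL(2, ℝ)) : Set (Orbifold Γ) :=
  {x | ∃ z : ℍ, proj Γ z = x ∧ ∃ γ ∈ Γ, γ ≠ 1 ∧ γ ≠ -1 ∧ γ • z = z}

/-- The orbifold `ℍ / Γ` is of finite type: it is isomorphic to a compact Riemann surface orbifold
from which finitely many points were removed. The isomorphism of `ℍ / Γ` with the complement of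
finitely many points in the compact Riemann surface `X` is given by its composition `π` with
the projection `ℍ → ℍ / Γ`; the cone points of a compact orbifold are finite in number. -/
def IsFiniteType (Γ : Subgroup SL(2, ℝ)) : Prop :=
  (conePoints Γ).Finite ∧
  ∃ (X : Type) (_ : TopologicalSpace X) (_ : ChartedSpace ℂ X) (_ : IsManifold 𝓘(ℂ) ω X)
    (_ : T2Space X) (_ : CompactSpace X) (_ : ConnectedSpace X) (π : ℍ → X),
    MDifferentiable 𝓘(ℂ) 𝓘(ℂ) π ∧ ((Set.range π)ᶜ).Finite ∧
      ∀ z w : ℍ, π z = π w ↔ proj Γ z = proj Γ w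

/-- A finite ramified covering of Riemann surface orbifolds: a surjective proper map with finite
fibres which is a covering in the sense of orbifolds, that is, which is induced by an
isomorphism of the orbifold universal coverings. -/
structure IsFiniteRamifiedCovering {Γ Γ' : Subgroup SL(2, ℝ)} (q : Orbifold Γ → Orbifold Γ') :
    Prop where
  isProperMap : IsProperMap q
  surjective : Function.Surjective q
  finite_fibres : ∀ y, (q ⁻¹' {y}).Finite
  exists_lift : ∃ a : SL(2, ℝ), ∀ z : ℍ, q (proj Γ z) = proj Γ' (a • z)

/-! ### Singular projective structures

The Riemann sphere is `OnePoint ℂ`, on which `GL(2, ℂ)` acts by Möbius transformations. -/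

/-- The function `F` with values in `ℂ` is, near `z`, equal to a Möbius transformation followed by
the lift to `ℍ` of the chart `φ` of `ℍ / Γ`. -/
def IsLiftAt {Γ : Subgroup SL(2, ℝ)} (φ : Orbifold Γ → OnePoint ℂ) (F : ℂ → ℂ) (z : ℍ) : Prop :=
  ∃ g : GL (Fin 2) ℂ, ∀ᶠ w in 𝓝 (z : ℂ),
    (F w : OnePoint ℂ) = g • φ (proj Γ (UpperHalfPlane.ofComplex w))

/-- A singular projective structure on `𝓛 = ℍ / Γ`: a discrete (and closed) set `sing` containing
the cone points of `𝓛`, and a projective structure on the Riemann surface `𝓛 \ sing`, that is, an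
atlas of holomorphic charts with values in the Riemann sphere all of whose changes of coordinates
are locally restrictions of Möbius transformations. -/
structure SingularProjectiveStructure (Γ : Subgroup SL(2, ℝ)) where
  sing : Set (Orbifold Γ)
  isClosed_sing : IsClosed sing
  discrete_sing : DiscreteTopology sing
  conePoints_subset : conePoints Γ ⊆ sing
  atlas : Set (OpenPartialHomeomorph (Orbifold Γ) (OnePoint ℂ))
  source_subset : ∀ φ ∈ atlas, φ.source ⊆ singᶜ
  exists_chart : ∀ x ∉ sing, ∃ φ ∈ atlas, x ∈ φ.source
  holomorphic : ∀ φ ∈ atlas, ∀ z : ℍ, proj Γ z ∈ φ.source →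
    ∃ F : ℂ → ℂ, AnalyticAt ℂ F z ∧ IsLiftAt φ F z
  moebius_transition : ∀ φ ∈ atlas, ∀ ψ ∈ atlas, ∀ x, x ∈ φ.source → x ∈ ψ.source →
    ∃ g : GL (Fin 2) ℂ, ∀ᶠ y in 𝓝 x, ψ y = g • φ y

/-- The Schwarzian derivative `(F'' / F')' - (F'' / F')² / 2`. -/
def schwarzian (F : ℂ → ℂ) (z : ℂ) : ℂ :=
  deriv (fun w => deriv (deriv F) w / deriv F w) z - (deriv (deriv F) z / deriv F z) ^ 2 / 2

/-- The group of Möbius transformations of the Riemann sphere, that is `PSL(2, ℂ)`, as a group of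
permutations. -/
def moebiusGroup : Subgroup (Equiv.Perm (OnePoint ℂ)) :=
  (MulAction.toPermHom (GL (Fin 2) ℂ) (OnePoint ℂ)).range

section Coverings

variable {S E : Type} [TopologicalSpace E]

/-- The group of deck transformations (covering automorphisms) of `p : E → S`. -/
def deckGroup (p : E → S) : Subgroup (E ≃ₜ E) where
  carrier := {c | ∀ e, p (c e) = p e}
  mul_mem' := by
    intro a b ha hb e
    have h : (a * b) e = a (b e) := rfl
    rw [h, ha, hb]
  one_mem' := fun _ => rfl
  inv_mem' := by
    intro a ha e
    have h : a (a⁻¹ e) = e := a.apply_symm_apply e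
    have h2 : p (a (a⁻¹ e)) = p (a⁻¹ e) := ha (a⁻¹ e)
    rw [← h2, h]

/-- The monodromy group of a developing map `D` defined on a regular covering `p : E → S`: the
Möbius transformations `μ(c)` for which `D ∘ c = μ(c) ∘ D` with `c` a deck transformation. -/
def monodromyGroup (p : E → S) (D : E → OnePoint ℂ) : Subgroup (Equiv.Perm (OnePoint ℂ)) where
  carrier := {m | m ∈ moebiusGroup ∧ ∃ c ∈ deckGroup p, ∀ e, D (c e) = m (D e)}
  mul_mem' := by
    rintro a b ⟨ha, c, hc, hac⟩ ⟨hb, d, hd, hbd⟩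
    refine ⟨mul_mem ha hb, c * d, mul_mem hc hd, fun e => ?_⟩
    have h : (c * d) e = c (d e) := rfl
    rw [h, hac, hbd, Equiv.Perm.mul_apply]
  one_mem' := ⟨one_mem _, 1, one_mem _, fun _ => rfl⟩
  inv_mem' := by
    rintro a ⟨ha, c, hc, hac⟩
    refine ⟨inv_mem ha, c⁻¹, inv_mem hc, fun e => ?_⟩
    have h : c (c⁻¹ e) = e := c.apply_symm_apply e
    have h2 := hac (c⁻¹ e)
    rw [h] at h2
    rw [h2]
    exact (a.symm_apply_apply _).symm

end Coverings

/-- The group `M` acts discontinuously on the (invariant) set `U`. -/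
def ActsDiscontinuouslyOn (M : Subgroup (Equiv.Perm (OnePoint ℂ))) (U : Set (OnePoint ℂ)) : Prop :=
  ∀ x ∈ U, ∃ V ∈ 𝓝 x, {m ∈ (M : Set (Equiv.Perm (OnePoint ℂ))) | ((m '' V) ∩ V).Nonempty}.Finite

namespace SingularProjectiveStructure

variable {Γ : Subgroup SL(2, ℝ)} (P : SingularProjectiveStructure Γ)

/-- The Riemann surface `𝓛 \ sing`. -/
abbrev Regular : Type := ↥(P.singᶜ : Set (Orbifold Γ))

/-- `P` is bounded: its Schwarzian differential `ξ(z) dz²`, lifted to the hyperbolic plane, has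
finite hyperbolic `L^∞`-norm. In the upper half-plane the weight `(1 - |z|²)² / 4` of the unit disc
reads `(Im z)²`. By Möbius invariance `ξ(z)` is the Schwarzian derivative of any lift `F` of any
chart of `P`. -/
def IsBounded : Prop :=
  ∃ C : ℝ, ∀ φ ∈ P.atlas, ∀ z : ℍ, proj Γ z ∈ φ.source →
    ∀ F : ℂ → ℂ, IsLiftAt φ F z → ‖schwarzian F z‖ * z.im ^ 2 ≤ C

/-- `D` is a developing map of `P` defined on the covering `p : E → 𝓛 \ sing`: locally it is a
projective chart of `P` up to a Möbius transformation. -/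
def IsDevelopingMap {E : Type} [TopologicalSpace E] (p : E → P.Regular) (D : E → OnePoint ℂ) :
    Prop :=
  ∀ e : E, ∀ φ ∈ P.atlas, (p e : Orbifold Γ) ∈ φ.source →
    ∃ g : GL (Fin 2) ℂ, ∀ᶠ y in 𝓝 e, D y = g • φ (p y : Orbifold Γ)

/-- `P` is a bounded covering projective structure: it is bounded, its developing map `D` on the
universal covering of `𝓛 \ sing` is a covering of its image, and its monodromy group acts
discontinuously on the image of `D`. -/
def IsBoundedCovering : Prop :=
  P.IsBounded ∧
  ∃ (E : Type) (_ : TopologicalSpace E) (p : E → P.Regular) (D : E → OnePoint ℂ),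
    SimplyConnectedSpace E ∧ IsCoveringMap p ∧ P.IsDevelopingMap p D ∧
    IsCoveringMapOn D (Set.range D) ∧ ActsDiscontinuouslyOn (monodromyGroup p D) (Set.range D)

/-- `p : E → 𝓛 \ sing` is the monodromy covering of `P` and `D` is the monodromy-developing map:
`p` is the regular covering associated with the kernel of the monodromy representation. Thus `E`
is connected, carries a developing map `D`, the deck transformations act transitively on the
fibres, and only the trivial one has trivial monodromy. -/
structure IsMonodromyDevelopingMap {E : Type} [TopologicalSpace E] (p : E → P.Regular)
    (D : E → OnePoint ℂ) : Prop where
  connected : ConnectedSpace E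
  isCoveringMap : IsCoveringMap p
  isDevelopingMap : P.IsDevelopingMap p D
  regular : ∀ e e' : E, p e = p e' → ∃ c ∈ deckGroup p, c e = e'
  faithful : ∀ c ∈ deckGroup p, (∀ e, D (c e) = D e) → c = 1

/-- `P` is uniformizable: its monodromy-developing map is injective on the monodromy covering. -/
def IsUniformizable : Prop :=
  ∃ (E : Type) (_ : TopologicalSpace E) (p : E → P.Regular) (D : E → OnePoint ℂ),
    P.IsMonodromyDevelopingMap p D ∧ Function.Injective D

/-- `P` is the pull-back by `q` of the singular projective structure `P'`, away from the singular
points: in charts of `P` and `P'` the map `q` is locally a Möbius transformation. -/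
def IsPullback {Γ' : Subgroup SL(2, ℝ)} (P' : SingularProjectiveStructure Γ')
    (q : Orbifold Γ → Orbifold Γ') : Prop :=
  ∀ φ ∈ P.atlas, ∀ ψ ∈ P'.atlas, ∀ x, x ∈ φ.source → q x ∈ ψ.source →
    ∃ g : GL (Fin 2) ℂ, ∀ᶠ y in 𝓝 x, ψ (q y) = g • φ y

end SingularProjectiveStructure

end ProjOrbifold

end

noncomputable section

namespace ProjOrbifold

open Filter Set

section

/-! ### Möbius transformations of the Riemann sphere -/

/-- The matrix of the inversion `z ↦ 1 / z`. -/
def invMatrix : GL (Fin 2) ℂ := Matrix.GeneralLinearGroup.mkOfDetNeZero !![0, 1; 1, 0] (by simp)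

/-- The matrix of the affine map `z ↦ a z + b`. -/
def affMatrix (a b : ℂ) (ha : a ≠ 0) : GL (Fin 2) ℂ :=
  Matrix.GeneralLinearGroup.mkOfDetNeZero !![a, b; 0, 1] (by simpa using ha)

lemma affMatrix_smul_coe (a b : ℂ) (ha : a ≠ 0) (z : ℂ) :
    affMatrix a b ha • (z : OnePoint ℂ) = ((a * z + b : ℂ) : OnePoint ℂ) := by
  simp [OnePoint.smul_some_eq_ite, affMatrix, Matrix.GeneralLinearGroup.mkOfDetNeZero]

lemma affMatrix_smul_infty (a b : ℂ) (ha : a ≠ 0) :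
    affMatrix a b ha • (OnePoint.infty : OnePoint ℂ) = OnePoint.infty := by
  simp [OnePoint.smul_infty_eq_ite, affMatrix, Matrix.GeneralLinearGroup.mkOfDetNeZero]

lemma invMatrix_smul_coe (z : ℂ) (hz : z ≠ 0) :
    invMatrix • (z : OnePoint ℂ) = ((z⁻¹ : ℂ) : OnePoint ℂ) := by
  simp [OnePoint.smul_some_eq_ite, invMatrix, Matrix.GeneralLinearGroup.mkOfDetNeZero, hz]

lemma invMatrix_smul_zero :
    invMatrix • ((0 : ℂ) : OnePoint ℂ) = OnePoint.infty := by
  rw [OnePoint.smul_some_eq_ite]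
  simp [invMatrix, Matrix.GeneralLinearGroup.mkOfDetNeZero]

lemma invMatrix_smul_infty :
    invMatrix • (OnePoint.infty : OnePoint ℂ) = ((0 : ℂ) : OnePoint ℂ) := by
  simp [OnePoint.smul_infty_eq_ite, invMatrix, Matrix.GeneralLinearGroup.mkOfDetNeZero]

lemma continuous_affMatrix_smul (a b : ℂ) (ha : a ≠ 0) :
    Continuous fun x : OnePoint ℂ => affMatrix a b ha • x := by
  have h : (fun x : OnePoint ℂ => affMatrix a b ha • x) =
      ((Homeomorph.mulLeft₀ a ha).trans (Homeomorph.addRight b)).onePointCongr := by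
    funext x
    induction x using OnePoint.rec with
    | infty => rw [affMatrix_smul_infty]; rfl
    | coe z => rw [affMatrix_smul_coe]; rfl
  rw [h]
  exact Homeomorph.continuous _

lemma continuous_invMatrix_smul : Continuous fun x : OnePoint ℂ => invMatrix • x := by
  rw [continuous_iff_continuousAt]
  intro x
  induction x using OnePoint.rec with
  | infty =>
    rw [OnePoint.continuousAt_infty']
    rw [invMatrix_smul_infty]
    have h1 : Tendsto (fun z : ℂ => ((z⁻¹ : ℂ) : OnePoint ℂ)) (coclosedCompact ℂ)
        (𝓝 ((0 : ℂ) : OnePoint ℂ)) := by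
      rw [coclosedCompact_eq_cocompact, ← Metric.cobounded_eq_cocompact]
      exact (OnePoint.continuous_coe.tendsto _).comp tendsto_inv₀_cobounded
    refine h1.congr' ?_
    have : ∀ᶠ z : ℂ in coclosedCompact ℂ, z ≠ 0 := by
      rw [coclosedCompact_eq_cocompact]
      exact (isCompact_singleton (x := (0 : ℂ))).compl_mem_cocompact
    filter_upwards [this] with z hz
    exact (invMatrix_smul_coe z hz).symm
  | coe z =>
    rw [OnePoint.continuousAt_coe]
    by_cases hz : z = 0
    · subst hz
      rw [← continuousWithinAt_compl_self]
      have h1 : Tendsto (fun z : ℂ => ((z⁻¹ : ℂ) : OnePoint ℂ)) (𝓝[≠] (0 : ℂ))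
          (𝓝 (OnePoint.infty : OnePoint ℂ)) := by
        refine OnePoint.tendsto_coe_infty.comp ?_
        rw [coclosedCompact_eq_cocompact, ← Metric.cobounded_eq_cocompact]
        exact tendsto_inv₀_nhdsNE_zero
      unfold ContinuousWithinAt
      simp only [Function.comp_apply]
      rw [invMatrix_smul_zero]
      refine h1.congr' ?_
      filter_upwards [self_mem_nhdsWithin] with z hz
      exact (invMatrix_smul_coe z hz).symm
    · have h1 : ContinuousAt (fun z : ℂ => ((z⁻¹ : ℂ) : OnePoint ℂ)) z :=
        OnePoint.continuous_coe.continuousAt.comp (continuousAt_inv₀ hz)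
      refine h1.congr ?_
      filter_upwards [isOpen_ne.mem_nhds hz] with w hw
      exact (invMatrix_smul_coe w hw).symm

lemma gl_scalar_smul (g h : GL (Fin 2) ℂ) (c : ℂ) (hc : c ≠ 0)
    (hgh : ∀ i j, g i j = c * h i j) (x : OnePoint ℂ) : g • x = h • x := by
  induction x using OnePoint.rec with
  | infty =>
    rw [OnePoint.smul_infty_eq_ite, OnePoint.smul_infty_eq_ite, hgh, hgh]
    by_cases h0 : h 1 0 = 0
    · simp [h0]
    · simp only [mul_eq_zero, hc, h0, or_self, if_false]
      congr 1
      field_simp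
  | coe z =>
    rw [OnePoint.smul_some_eq_ite, OnePoint.smul_some_eq_ite, hgh, hgh, hgh, hgh]
    have e1 : c * h 1 0 * z + c * h 1 1 = c * (h 1 0 * z + h 1 1) := by ring
    have e2 : c * h 0 0 * z + c * h 0 1 = c * (h 0 0 * z + h 0 1) := by ring
    rw [e1, e2]
    by_cases h0 : h 1 0 * z + h 1 1 = 0
    · simp [h0]
    · simp only [mul_eq_zero, hc, h0, or_self, if_false]
      congr 1
      field_simp

lemma gl_det (g : GL (Fin 2) ℂ) : g 0 0 * g 1 1 - g 0 1 * g 1 0 ≠ 0 := by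
  have := g.det_ne_zero
  rwa [Matrix.det_fin_two] at this

lemma continuous_gl_smul (g : GL (Fin 2) ℂ) : Continuous fun x : OnePoint ℂ => g • x := by
  have hd := gl_det g
  by_cases hc : g 1 0 = 0
  · have hd' : g 1 1 ≠ 0 := by rintro h; simp [h, hc] at hd
    have ha' : g 0 0 ≠ 0 := by rintro h; simp [h, hc] at hd
    have := continuous_affMatrix_smul (g 0 0 / g 1 1) (g 0 1 / g 1 1) (div_ne_zero ha' hd')
    convert this using 2 with x
    refine gl_scalar_smul _ _ (g 1 1) hd' ?_ x
    intro i j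
    fin_cases i <;> fin_cases j <;>
      simp [affMatrix, Matrix.GeneralLinearGroup.mkOfDetNeZero, hc] <;> field_simp
  · set a := (g 0 1 * g 1 0 - g 0 0 * g 1 1) / (g 1 0) ^ 2
    have ha : a ≠ 0 := by
      refine div_ne_zero ?_ (pow_ne_zero _ hc)
      intro h; apply hd; linear_combination -h
    have := (continuous_affMatrix_smul a (g 0 0 / g 1 0) ha).comp
      (continuous_invMatrix_smul.comp (continuous_affMatrix_smul 1 (g 1 1 / g 1 0) one_ne_zero))
    convert this using 2 with x
    simp only [Function.comp_apply]
    rw [← mul_smul, ← mul_smul]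
    refine gl_scalar_smul _ _ (g 1 0) hc ?_ x
    intro i j
    fin_cases i <;> fin_cases j <;>
      simp [affMatrix, invMatrix, Matrix.GeneralLinearGroup.mkOfDetNeZero, Matrix.mul_apply,
        Fin.sum_univ_two, a] <;> field_simp
    ring

instance : ContinuousConstSMul (GL (Fin 2) ℂ) (OnePoint ℂ) := ⟨continuous_gl_smul⟩

lemma exists_gl_smul_eq_zero (x : OnePoint ℂ) : ∃ g : GL (Fin 2) ℂ, g • x = ((0 : ℂ) : OnePoint ℂ) := by
  induction x using OnePoint.rec with
  | infty => exact ⟨invMatrix, invMatrix_smul_infty⟩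
  | coe z => exact ⟨affMatrix 1 (-z) one_ne_zero, by rw [affMatrix_smul_coe]; simp⟩

lemma gl_smul_coe (g : GL (Fin 2) ℂ) (z w : ℂ) (h : g • (z : OnePoint ℂ) = (w : OnePoint ℂ)) :
    g 1 0 * z + g 1 1 ≠ 0 ∧ w = (g 0 0 * z + g 0 1) / (g 1 0 * z + g 1 1) := by
  rw [OnePoint.smul_some_eq_ite] at h
  split_ifs at h with h0
  · exact absurd h (OnePoint.infty_ne_coe _)
  · exact ⟨h0, (OnePoint.coe_injective h).symm⟩

lemma gl_smul_coe' (g : GL (Fin 2) ℂ) (z : ℂ) (h : g 1 0 * z + g 1 1 ≠ 0) :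
    g • (z : OnePoint ℂ) = ((g 0 0 * z + g 0 1) / (g 1 0 * z + g 1 1) : ℂ) := by
  rw [OnePoint.smul_some_eq_ite, if_neg h]

/-! ### Locally biholomorphic maps of the hyperbolic plane to the Riemann sphere -/

/-- `F` is locally biholomorphic: up to Möbius transformations it is locally a holomorphic function
with non-zero derivative. -/
def LocBihol (F : ℍ → OnePoint ℂ) : Prop :=
  ∀ z : ℍ, ∃ (g : GL (Fin 2) ℂ) (f : ℂ → ℂ), AnalyticAt ℂ f z ∧ deriv f z ≠ 0 ∧
    ∀ᶠ w in 𝓝 z, g • F w = (f (w : ℂ) : OnePoint ℂ)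

lemma LocBihol.smul {F : ℍ → OnePoint ℂ} (hF : LocBihol F) (m : GL (Fin 2) ℂ) :
    LocBihol fun z => m • F z := by
  intro z
  obtain ⟨g, f, hf, hf', h⟩ := hF z
  exact ⟨g * m⁻¹, f, hf, hf', by simpa [mul_smul] using h⟩

lemma sl_coe (a : SL(2, ℝ)) (z : ℍ) : ((a • z : ℍ) : ℂ) =
    (((a 0 0 : ℝ) : ℂ) * z + ((a 0 1 : ℝ) : ℂ)) / (((a 1 0 : ℝ) : ℂ) * z + ((a 1 1 : ℝ) : ℂ)) := by
  simpa using UpperHalfPlane.coe_specialLinearGroup_apply a z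

lemma sl_denom_ne (a : SL(2, ℝ)) (z : ℍ) : ((a 1 0 : ℝ) : ℂ) * z + ((a 1 1 : ℝ) : ℂ) ≠ 0 := by
  have := UpperHalfPlane.denom_ne_zero (Matrix.SpecialLinearGroup.mapGL ℝ a) z
  simpa [UpperHalfPlane.denom] using this

lemma sl_det (a : SL(2, ℝ)) : a 0 0 * a 1 1 - a 0 1 * a 1 0 = 1 := by
  rw [← Matrix.det_fin_two]; exact a.2

lemma LocBihol.comp_smul {F : ℍ → OnePoint ℂ} (hF : LocBihol F) (a : SL(2, ℝ)) :
    LocBihol fun z => F (a • z) := by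
  intro z
  obtain ⟨g, f, hf, hf', h⟩ := hF (a • z)
  set k : ℂ → ℂ := fun w => (((a 0 0 : ℝ) : ℂ) * w + ((a 0 1 : ℝ) : ℂ)) /
    (((a 1 0 : ℝ) : ℂ) * w + ((a 1 1 : ℝ) : ℂ)) with hk
  have hkz : k z = ((a • z : ℍ) : ℂ) := (sl_coe a z).symm
  have hkd : HasDerivAt k (1 / (((a 1 0 : ℝ) : ℂ) * z + ((a 1 1 : ℝ) : ℂ)) ^ 2) z := by
    have h1 : HasDerivAt (fun w : ℂ => ((a 0 0 : ℝ) : ℂ) * w + ((a 0 1 : ℝ) : ℂ))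
        ((a 0 0 : ℝ) : ℂ) z := by
      simpa using ((hasDerivAt_id (z : ℂ)).const_mul ((a 0 0 : ℝ) : ℂ)).add_const ((a 0 1 : ℝ) : ℂ)
    have h2 : HasDerivAt (fun w : ℂ => ((a 1 0 : ℝ) : ℂ) * w + ((a 1 1 : ℝ) : ℂ))
        ((a 1 0 : ℝ) : ℂ) z := by
      simpa using ((hasDerivAt_id (z : ℂ)).const_mul ((a 1 0 : ℝ) : ℂ)).add_const ((a 1 1 : ℝ) : ℂ)
    have h3 := h1.div h2 (sl_denom_ne a z)
    refine h3.congr_deriv ?_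
    have hd : (((a 0 0 : ℝ) : ℂ)) * ((a 1 1 : ℝ) : ℂ) - ((a 0 1 : ℝ) : ℂ) * ((a 1 0 : ℝ) : ℂ) = 1 := by
      exact_mod_cast sl_det a
    congr 1
    linear_combination hd
  have hka : AnalyticAt ℂ k z := by
    refine AnalyticAt.div ?_ ?_ (sl_denom_ne a z) <;> fun_prop
  refine ⟨g, f ∘ k, ?_, ?_, ?_⟩
  · exact AnalyticAt.comp (by rwa [hkz]) hka
  · rw [deriv_comp _ (by rw [hkz]; exact hf.differentiableAt) hkd.differentiableAt, hkz, hkd.deriv]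
    exact mul_ne_zero hf' (one_div_ne_zero (pow_ne_zero _ (sl_denom_ne a z)))
  · have := (continuous_const_smul a : Continuous fun z : ℍ => a • z).tendsto z
    filter_upwards [this.eventually h] with w hw
    rw [hw]
    simp only [Function.comp_apply]
    rw [show k w = ((a • w : ℍ) : ℂ) from (sl_coe a w).symm]

lemma nhds_coe_UHP (z : ℍ) : 𝓝 (z : ℂ) = map ((↑) : ℍ → ℂ) (𝓝 z) :=
  (UpperHalfPlane.isOpenEmbedding_coe.map_nhds_eq z).symm

lemma eventually_coe_UHP {z : ℍ} {p : ℂ → Prop} :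
    (∀ᶠ w in 𝓝 (z : ℂ), p w) ↔ ∀ᶠ w : ℍ in 𝓝 z, p w := by
  rw [nhds_coe_UHP]; rfl

lemma eventually_ofComplex {z : ℍ} {p : ℍ → Prop} :
    (∀ᶠ w in 𝓝 (z : ℂ), p (UpperHalfPlane.ofComplex w)) ↔ ∀ᶠ w : ℍ in 𝓝 z, p w := by
  rw [eventually_coe_UHP]; simp

lemma LocBihol.continuous {F : ℍ → OnePoint ℂ} (hF : LocBihol F) : Continuous F := by
  rw [continuous_iff_continuousAt]
  intro z
  obtain ⟨g, f, hf, hf', h⟩ := hF z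
  have h1 : ContinuousAt (fun w : ℍ => (f (w : ℂ) : OnePoint ℂ)) z :=
    OnePoint.continuous_coe.continuousAt.comp
      (ContinuousAt.comp (f := ((↑) : ℍ → ℂ)) hf.continuousAt
        UpperHalfPlane.continuous_coe.continuousAt)
  have h2 : ContinuousAt (fun w : ℍ => g⁻¹ • (f (w : ℂ) : OnePoint ℂ)) z := h1.const_smul g⁻¹
  refine h2.congr ?_
  filter_upwards [h] with w hw
  rw [← hw, inv_smul_smul]

lemma LocBihol.map_nhds {F : ℍ → OnePoint ℂ} (hF : LocBihol F) (z : ℍ) :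
    map F (𝓝 z) = 𝓝 (F z) := by
  obtain ⟨g, f, hf, hf', h⟩ := hF z
  have h1 : map f (𝓝 (z : ℂ)) = 𝓝 (f z) :=
    (hf.hasStrictDerivAt).map_nhds_eq hf'
  have h2 : map (fun w : ℍ => (f (w : ℂ) : OnePoint ℂ)) (𝓝 z) = 𝓝 (f z : OnePoint ℂ) := by
    rw [OnePoint.nhds_coe_eq, ← h1, nhds_coe_UHP, map_map, map_map]; rfl
  have h3 : map (fun w => g • F w) (𝓝 z) = 𝓝 (g • F z) := by
    rw [h.self_of_nhds, ← h2]
    exact map_congr h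
  have h4 : map (fun x : OnePoint ℂ => g⁻¹ • x) (𝓝 (g • F z)) = 𝓝 (F z) := by
    have := (Homeomorph.smul (g⁻¹ : GL (Fin 2) ℂ) (α := OnePoint ℂ)).map_nhds_eq (g • F z)
    rw [Homeomorph.smul_apply, inv_smul_smul] at this
    exact this
  rw [← h4, ← h3, map_map]
  congr 1
  funext w
  simp

lemma LocBihol.isOpenMap {F : ℍ → OnePoint ℂ} (hF : LocBihol F) : IsOpenMap F :=
  IsOpenMap.of_nhds_le fun z => (hF.map_nhds z).ge

lemma LocBihol.exists_injOn {F : ℍ → OnePoint ℂ} (hF : LocBihol F) (z : ℍ) :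
    ∃ N ∈ 𝓝 z, InjOn F N := by
  obtain ⟨g, f, hf, hf', h⟩ := hF z
  have hs := hf.hasStrictDerivAt
  let e := (hs.hasStrictFDerivAt_equiv hf').toOpenPartialHomeomorph f
  have he : e.source ∈ 𝓝 (z : ℂ) :=
    e.open_source.mem_nhds (hs.hasStrictFDerivAt_equiv hf').mem_toOpenPartialHomeomorph_source
  have hinj : InjOn f e.source := e.injOn
  refine ⟨_, inter_mem h (UpperHalfPlane.continuous_coe.continuousAt.preimage_mem_nhds he), ?_⟩
  rintro a ⟨ha, ha'⟩ b ⟨hb, hb'⟩ hab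
  simp only [mem_ofPred_eq] at ha hb
  have : f a = f b := OnePoint.coe_injective (by rw [← ha, ← hb, hab])
  exact UpperHalfPlane.coe_injective (hinj ha' hb' this)

/-- Lifts through a locally biholomorphic map of holomorphic functions are holomorphic. -/
lemma LocBihol.differentiableAt_lift {F : ℍ → OnePoint ℂ} (hF : LocBihol F) {G : ℂ → ℍ} {s : ℂ}
    (hG : ContinuousAt G s) (g : GL (Fin 2) ℂ) (k : ℂ → ℂ) (hk : DifferentiableAt ℂ k s)
    (h : ∀ᶠ t in 𝓝 s, F (G t) = g • (k t : OnePoint ℂ)) :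
    DifferentiableAt ℂ (fun t => (G t : ℂ)) s := by
  obtain ⟨g', f, hf, hf', hf2⟩ := hF (G s)
  have h1 : ∀ᶠ t in 𝓝 s, (g' * g) • (k t : OnePoint ℂ) = (f (G t) : OnePoint ℂ) := by
    filter_upwards [h, hG.eventually hf2] with t ht ht2
    rw [mul_smul, ← ht, ht2]
  have h2 : (g' * g) 1 0 * k s + (g' * g) 1 1 ≠ 0 := (gl_smul_coe _ _ _ h1.self_of_nhds).1
  have hs := hf.hasStrictDerivAt
  have h3 := (hs.eventually_left_inverse hf')
  have h3' : ∀ᶠ t in 𝓝 s, hs.localInverse f (deriv f (G s)) (G s) hf' (f (G t)) = G t :=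
    (UpperHalfPlane.continuous_coe.continuousAt.comp hG).eventually h3
  have h4 : DifferentiableAt ℂ (fun t => f (G t)) s := by
    have : DifferentiableAt ℂ (fun t => ((g' * g) 0 0 * k t + (g' * g) 0 1) /
        ((g' * g) 1 0 * k t + (g' * g) 1 1)) s := by
      refine DifferentiableAt.div ?_ ?_ h2 <;> fun_prop
    refine this.congr_of_eventuallyEq ?_
    filter_upwards [h1] with t ht
    exact (gl_smul_coe _ _ _ ht).2
  have h5 : DifferentiableAt ℂ (fun t => hs.localInverse f (deriv f (G s)) (G s) hf' (f (G t))) s :=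
    DifferentiableAt.comp s (hs.to_localInverse hf').hasDerivAt.differentiableAt h4
  refine h5.congr_of_eventuallyEq ?_
  filter_upwards [h3'] with t ht using ht.symm

/-- Two locally biholomorphic maps which agree on a set accumulating at `z` agree near `z`. -/
lemma LocBihol.eventuallyEq_of_frequently {F F' : ℍ → OnePoint ℂ} (hF : LocBihol F)
    (hF' : LocBihol F') {z : ℍ} (h : ∃ᶠ w in 𝓝[≠] z, F w = F' w) : ∀ᶠ w in 𝓝 z, F w = F' w := by
  have hz : F z = F' z := by
    by_contra hne
    have h1 : ∀ᶠ w in 𝓝 z, F w ≠ F' w :=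
      (isOpen_ne_fun hF.continuous hF'.continuous).mem_nhds hne
    exact h (h1.filter_mono nhdsWithin_le_nhds)
  obtain ⟨g, f, hf, -, hf2⟩ := hF z
  obtain ⟨g', f', hf', -, hf2'⟩ := hF' z
  have e1 : ∀ᶠ w in 𝓝 z, g • F' w = (g * g'⁻¹) • (f' (w : ℂ) : OnePoint ℂ) := by
    filter_upwards [hf2'] with w hw
    rw [← hw, ← mul_smul]; simp
  have hfin : (g * g'⁻¹) • (f' (z : ℂ) : OnePoint ℂ) = (f z : OnePoint ℂ) := by
    rw [← e1.self_of_nhds, ← hz, hf2.self_of_nhds]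
  have hd := (gl_smul_coe _ _ _ hfin).1
  set k : ℂ → ℂ := fun w => ((g * g'⁻¹) 0 0 * f' w + (g * g'⁻¹) 0 1) /
    ((g * g'⁻¹) 1 0 * f' w + (g * g'⁻¹) 1 1) with hk
  have hka : AnalyticAt ℂ k z := by
    refine AnalyticAt.div ?_ ?_ hd <;> fun_prop
  have hne : ∀ᶠ w in 𝓝 (z : ℂ), (g * g'⁻¹) 1 0 * f' w + (g * g'⁻¹) 1 1 ≠ 0 := by
    have : ContinuousAt (fun w => (g * g'⁻¹) 1 0 * f' w + (g * g'⁻¹) 1 1) z := by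
      have := hf'.continuousAt
      fun_prop
    exact this.eventually_ne hd
  have e2 : ∀ᶠ w in 𝓝 z, g • F' w = (k (w : ℂ) : OnePoint ℂ) := by
    filter_upwards [e1, eventually_coe_UHP.1 hne] with w hw hw2
    rw [hw, gl_smul_coe' _ _ hw2]
  have h3 : ∃ᶠ w in 𝓝[≠] (z : ℂ), f w = k w := by
    have ht : Tendsto ((↑) : ℍ → ℂ) (𝓝[≠] z) (𝓝[≠] (z : ℂ)) := by
      refine tendsto_nhdsWithin_of_tendsto_nhds_of_eventually_within _
        (UpperHalfPlane.continuous_coe.continuousAt.tendsto.mono_left nhdsWithin_le_nhds) ?_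
      filter_upwards [self_mem_nhdsWithin] with w hw hw2
      exact hw (UpperHalfPlane.coe_injective hw2)
    refine ht.frequently ?_
    refine (h.and_eventually ((hf2.and e2).filter_mono nhdsWithin_le_nhds)).mono ?_
    rintro w ⟨hw, hw1, hw2⟩
    exact OnePoint.coe_injective (by rw [← hw1, ← hw2, hw])
  have h4 := (hf.frequently_eq_iff_eventually_eq hka).1 h3
  filter_upwards [eventually_coe_UHP.1 h4, hf2, e2] with w hw hw1 hw2
  have : g • F w = g • F' w := by rw [hw1, hw2, hw]
  exact smul_left_cancel g this

instance (z : ℍ) : (𝓝[≠] z).NeBot := by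
  by_contra hbot
  rw [not_neBot] at hbot
  have h2 : ∀ᶠ w in 𝓝[≠] z, False := by rw [hbot]; exact eventually_bot
  have h3 : ∀ᶠ w : ℂ in 𝓝 (z : ℂ), w = (z : ℂ) := by
    rw [eventually_coe_UHP]
    filter_upwards [eventually_nhdsWithin_iff.1 h2] with w hw
    by_contra hne
    exact hw fun h => hne (by rw [show w = z from h])
  have h4 : ∀ᶠ w in 𝓝[≠] (z : ℂ), False := by
    rw [eventually_nhdsWithin_iff]
    filter_upwards [h3] with w hw hw2 using hw2 hw
  exact h4.exists.elim fun _ h => h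

lemma LocBihol.eq_of_eventuallyEq {F F' : ℍ → OnePoint ℂ} (hF : LocBihol F)
    (hF' : LocBihol F') {z : ℍ} (h : ∀ᶠ w in 𝓝 z, F w = F' w) : F = F' := by
  have hcl : IsClopen {z : ℍ | ∀ᶠ w in 𝓝 z, F w = F' w} := by
    refine ⟨?_, isOpen_setOfPred_eventually_nhds⟩
    rw [isClosed_iff_frequently]
    intro x hx
    refine hF.eventuallyEq_of_frequently hF' ?_
    have h1 : ∃ᶠ y in 𝓝 x, F y = F' y := hx.mono fun y hy => hy.self_of_nhds
    intro hcon
    have h2 : ∀ᶠ y in 𝓝 x, y ≠ x → F y ≠ F' y := eventually_nhdsWithin_iff.1 hcon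
    obtain ⟨y, hy1, hy2⟩ := (hx.and_eventually (eventually_eventually_nhds.2 h2)).exists
    have h3 : ∀ᶠ w in 𝓝 y, w = x := by
      filter_upwards [hy1, hy2] with w hw1 hw2
      by_contra hne
      exact hw2 hne hw1
    have h4 : ∀ᶠ w in 𝓝[≠] y, False := by
      rw [eventually_nhdsWithin_iff]
      filter_upwards [h3] with w hw hw2
      exact hw2 (by rw [show w = x from hw]; exact h3.self_of_nhds.symm)
    exact h4.exists.elim fun _ h => h
  have huniv := hcl.eq_univ ⟨z, h⟩
  funext w
  have : w ∈ {z : ℍ | ∀ᶠ w in 𝓝 z, F w = F' w} := by rw [huniv]; trivial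
  exact this.self_of_nhds

end

section

/-! ### Covering maps from local sections -/

lemma exists_section_of_injOn {X Y : Type*} [TopologicalSpace X] [TopologicalSpace Y] [Nonempty X]
    {f : X → Y} (hf : IsOpenMap f) {B : Set X} (hB : IsOpen B) (hinj : InjOn f B) :
    ∃ σ : Y → X, ContinuousOn σ (f '' B) ∧ ∀ b ∈ B, σ (f b) = b := by
  refine ⟨Function.invFunOn f B, ?_, fun b hb => hinj.leftInvOn_invFunOn hb⟩
  rintro _ ⟨b, hb, rfl⟩
  refine ContinuousAt.continuousWithinAt ?_
  intro W hW
  rw [hinj.leftInvOn_invFunOn hb] at hW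
  rw [mem_map]
  have : f '' (B ∩ interior W) ∈ 𝓝 (f b) :=
    (hf _ (hB.inter isOpen_interior)).mem_nhds ⟨b, ⟨hb, mem_interior_iff_mem_nhds.2 hW⟩, rfl⟩
  filter_upwards [this]
  rintro _ ⟨c, ⟨hc, hcW⟩, rfl⟩
  simp only [mem_preimage]
  rw [hinj.leftInvOn_invFunOn hc]
  exact interior_subset hcW

lemma isOpen_image_section {X Y : Type*} [TopologicalSpace X] [TopologicalSpace Y]
    {f : X → Y} (hf : Continuous f) {V : Set Y} (hV : IsOpen V)
    (hinj : ∀ x, f x ∈ V → ∃ N ∈ 𝓝 x, InjOn f N)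
    {σ : Y → X} (hσ : ContinuousOn σ V) (hσ2 : ∀ v ∈ V, f (σ v) = v) : IsOpen (σ '' V) := by
  rw [isOpen_iff_mem_nhds]
  rintro _ ⟨v, hv, rfl⟩
  obtain ⟨N, hN, hNi⟩ := hinj (σ v) (by rwa [hσ2 v hv])
  have h1 : ∀ᶠ u in 𝓝 v, σ u ∈ N := (hσ.continuousAt (hV.mem_nhds hv)).eventually hN
  have h2 : ∀ᶠ x in 𝓝 (σ v), σ (f x) ∈ N ∧ f x ∈ V := by
    have : ContinuousAt f (σ v) := hf.continuousAt
    refine this.eventually (p := fun y => σ y ∈ N ∧ y ∈ V) ?_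
    rw [hσ2 v hv]
    exact h1.and (hV.mem_nhds hv)
  filter_upwards [h2, hN] with x hx hxN
  exact ⟨f x, hx.2, hNi hx.1 hxN (hσ2 _ hx.2)⟩

/-- A locally injective map with sections through all points, over connected open sets, is a
covering map. -/
lemma isCoveringMapOn_of_sections {X Y : Type*} [TopologicalSpace X] [TopologicalSpace Y]
    [T2Space X] {f : X → Y} (hf : Continuous f) {s : Set Y}
    (h : ∀ y ∈ s, ∃ V, IsOpen V ∧ y ∈ V ∧ IsPreconnected V ∧
      (∀ x, f x ∈ V → ∃ N ∈ 𝓝 x, InjOn f N) ∧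
      ∀ x, f x ∈ V → ∃ σ : Y → X, ContinuousOn σ V ∧ (∀ v ∈ V, f (σ v) = v) ∧ σ (f x) = x) :
    IsCoveringMapOn f s := by
  rcases isEmpty_or_nonempty X with hX | hX
  · exact IsCoveringMapOn.of_isEmpty _ _
  intro y hy
  obtain ⟨V, hV, hyV, hVc, hinj, hsec⟩ := h y hy
  choose! σ hσc hσs hσx using hsec
  have hop : ∀ x, f x ∈ V → IsOpen (σ x '' V) := fun x hx =>
    isOpen_image_section hf hV hinj (hσc x hx) (hσs x hx)
  have huniq : ∀ x x', f x ∈ V → f x' ∈ V → ∀ v ∈ V, σ x v = σ x' v → EqOn (σ x) (σ x') V := by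
    intro x x' hx hx' v hv hvv
    have key : IsOpen {u | u ∈ V ∧ σ x u = σ x' u} := by
      rw [isOpen_iff_mem_nhds]
      rintro u ⟨hu, huu⟩
      have h1 : ∀ᶠ t in 𝓝 u, σ x' t ∈ σ x '' V :=
        ((hσc x' hx').continuousAt (hV.mem_nhds hu)).eventually
          ((hop x hx).mem_nhds (huu ▸ mem_image_of_mem _ hu))
      filter_upwards [h1, hV.mem_nhds hu] with t ht htV
      obtain ⟨t', ht', htt⟩ := ht
      refine ⟨htV, ?_⟩
      have : t' = t := by rw [← hσs x hx t' ht', htt, hσs x' hx' t htV]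
      rw [← htt, this]
    have key2 : IsOpen {u | u ∈ V ∧ σ x u ≠ σ x' u} := by
      rw [isOpen_iff_mem_nhds]
      rintro u ⟨hu, huu⟩
      have hc : ContinuousAt (fun t => (σ x t, σ x' t)) u :=
        ((hσc x hx).continuousAt (hV.mem_nhds hu)).prodMk
          ((hσc x' hx').continuousAt (hV.mem_nhds hu))
      have ho : IsOpen {p : X × X | p.1 ≠ p.2} := isOpen_ne_fun continuous_fst continuous_snd
      filter_upwards [hc.eventually (ho.mem_nhds huu), hV.mem_nhds hu] with t ht htV
      exact ⟨htV, ht⟩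
    intro u hu
    by_contra hne
    obtain ⟨t, ht, ht1, ht2⟩ := hVc _ _ key key2 (fun t ht => by
      by_cases h : σ x t = σ x' t
      · exact Or.inl ⟨ht, h⟩
      · exact Or.inr ⟨ht, h⟩) ⟨v, hv, hv, hvv⟩ ⟨u, hu, hu, hne⟩
    exact ht2.2 ht1.2
  let I := f ⁻¹' {y}
  let _ : TopologicalSpace I := ⊥
  have hI : ∀ i : I, f i.1 ∈ V := fun i => by rw [show f i.1 = y from i.2]; exact hyV
  have hσV : ∀ x, f x ∈ V → f (σ x y) = y := fun x hx => hσs x hx y hyV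
  have heq : ∀ x, f x ∈ V → ∀ i : I, (i : X) = σ x y → EqOn (σ x) (σ i) V := by
    intro x hx i hi
    refine huniq x i hx (hI i) y hyV ?_
    have := hσx i (hI i)
    rw [show f i.1 = y from i.2] at this
    rw [this, hi]
  have hev : IsEvenlyCovered f y I := by
    refine ⟨⟨rfl⟩, V, hyV, hV, hV.preimage hf, ?_⟩
    refine ⟨⟨⟨fun e => (⟨f e, e.2⟩, ⟨σ e y, hσV e e.2⟩), fun vi => ⟨σ vi.2 vi.1, ?_⟩, ?_, ?_⟩, ?_, ?_⟩, ?_⟩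
    · rw [mem_preimage, hσs _ (hI vi.2) _ vi.1.2]; exact vi.1.2
    · rintro ⟨e, he⟩
      apply Subtype.ext
      simp only
      rw [← heq e he ⟨σ e y, hσV e he⟩ rfl he]
      exact hσx e he
    · rintro ⟨⟨v, hv⟩, i⟩
      have h1 : f (σ i v) = v := hσs _ (hI i) v hv
      have h2 : f (σ i v) ∈ V := by rw [h1]; exact hv
      ext
      · exact h1
      · have h3 := huniq (σ i v) i h2 (hI i) v hv (by
          have := hσx _ h2; rwa [h1] at this) hyV
        simp only
        rw [h3]
        have := hσx i (hI i)
        rwa [show f i.1 = y from i.2] at this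
    · refine Continuous.prodMk ?_ ?_
      · exact Continuous.subtype_mk (hf.comp continuous_subtype_val) _
      · rw [continuous_iff_continuousAt]
        rintro ⟨e, he⟩
        refine continuousAt_const.congr (f := fun _ => (⟨σ e y, hσV e he⟩ : I)) ?_
        have : ∀ᶠ e' : f ⁻¹' V in 𝓝 ⟨e, he⟩, (e' : X) ∈ σ e '' V :=
          continuous_subtype_val.continuousAt.eventually
            ((hop e he).mem_nhds ⟨f e, he, hσx e he⟩)
        filter_upwards [this] with e' he'
        obtain ⟨v, hv, hve⟩ := he'
        have hfv : f e' = v := by rw [← hve]; exact hσs e he v hv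
        apply Subtype.ext
        refine huniq e e' he e'.2 v hv ?_ hyV
        rw [hve]
        conv_lhs => rw [← hσx e' e'.2, hfv]
    · refine Continuous.subtype_mk ?_ _
      rw [continuous_iff_continuousAt]
      rintro ⟨⟨v, hv⟩, i⟩
      have h1 : ∀ᶠ p : V × I in 𝓝 (⟨v, hv⟩, i), p.2 = i := by
        rw [nhds_prod_eq]
        have : ∀ᶠ j in 𝓝 i, j = i := by
          have : DiscreteTopology I := ⟨rfl⟩
          rw [nhds_discrete]; exact eventually_pure.2 rfl
        exact this.prod_inr _
      have h2 : ContinuousAt (fun p : V × I => σ i p.1) (⟨v, hv⟩, i) := by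
        have h3 : ContinuousAt (σ i) v := (hσc i (hI i)).continuousAt (hV.mem_nhds hv)
        exact ContinuousAt.comp (f := fun p : V × I => (p.1 : Y)) h3
          (continuous_subtype_val.comp continuous_fst).continuousAt
      refine h2.congr ?_
      filter_upwards [h1] with p hp
      rw [hp]
    · intro x; rfl
  exact hev.to_isEvenlyCovered_preimage

/-! ### The quotient projection -/

section Proj

variable (Γ : Subgroup SL(2, ℝ))

lemma proj_eq_iff {z w : ℍ} : proj Γ z = proj Γ w ↔ ∃ γ ∈ Γ, γ • w = z := by
  unfold proj
  rw [Quotient.eq, MulAction.orbitRel_apply, MulAction.mem_orbit_iff]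
  constructor
  · rintro ⟨γ, h⟩; exact ⟨γ.1, γ.2, h⟩
  · rintro ⟨γ, hγ, h⟩; exact ⟨⟨γ, hγ⟩, h⟩

lemma proj_smul {γ : SL(2, ℝ)} (hγ : γ ∈ Γ) (z : ℍ) : proj Γ (γ • z) = proj Γ z :=
  (proj_eq_iff Γ).2 ⟨γ, hγ, rfl⟩

lemma isOpenQuotientMap_proj : IsOpenQuotientMap (proj Γ) :=
  MulAction.isOpenQuotientMap_quotientMk

lemma continuous_proj : Continuous (proj Γ) := (isOpenQuotientMap_proj Γ).continuous

lemma proj_surjective : Function.Surjective (proj Γ) := (isOpenQuotientMap_proj Γ).surjective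

lemma map_proj_nhds (z : ℍ) : map (proj Γ) (𝓝 z) = 𝓝 (proj Γ z) :=
  (isOpenQuotientMap_proj Γ).map_nhds_eq z

lemma smul_eq_self_of_notMem_conePoints {z : ℍ} (hz : proj Γ z ∉ conePoints Γ) {γ : SL(2, ℝ)}
    (hγ : γ ∈ Γ) (h : γ • z = z) : γ = 1 ∨ γ = -1 := by
  by_contra hne
  rw [not_or] at hne
  exact hz ⟨z, rfl, γ, hγ, hne.1, hne.2, h⟩

lemma sl_neg_one_smul (z : ℍ) : (-1 : SL(2, ℝ)) • z = z := by
  apply UpperHalfPlane.coe_injective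
  rw [sl_coe]; simp

variable [DiscreteTopology Γ]

lemma exists_nhds_smul_eq_self (z : ℍ) :
    ∃ U ∈ 𝓝 z, ∀ γ ∈ Γ, ∀ w ∈ U, γ • w ∈ U → γ • z = z := by
  obtain ⟨U, hU, h⟩ := ProperlyDiscontinuousSMul.exists_nhds_image_smul_eq_self Γ z
  exact ⟨U, hU, fun γ hγ w hw hw2 => h ⟨γ, hγ⟩ ⟨_, ⟨w, hw, rfl⟩, hw2⟩⟩

lemma finite_smul_mem_compact {K L : Set ℍ} (hK : IsCompact K) (hL : IsCompact L) :
    {γ : SL(2, ℝ) | γ ∈ Γ ∧ ∃ z ∈ K, γ • z ∈ L}.Finite := by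
  have := ProperlyDiscontinuousSMul.finite_disjoint_inter_image (Γ := Γ) hK hL
  refine (this.image Subtype.val).subset ?_
  rintro γ ⟨hγ, z, hz, hzL⟩
  exact ⟨⟨γ, hγ⟩, ⟨_, ⟨z, hz, rfl⟩, hzL⟩, rfl⟩

lemma exists_injOn_proj {z : ℍ} (hz : proj Γ z ∉ conePoints Γ) : ∃ N ∈ 𝓝 z, InjOn (proj Γ) N := by
  obtain ⟨U, hU, h⟩ := exists_nhds_smul_eq_self Γ z
  refine ⟨U, hU, fun a ha b hb hab => ?_⟩
  obtain ⟨γ, hγ, hγ2⟩ := (proj_eq_iff Γ).1 hab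
  have h1 := h γ hγ b hb (by rwa [hγ2])
  rcases smul_eq_self_of_notMem_conePoints Γ hz hγ h1 with rfl | rfl
  · rw [← hγ2, one_smul]
  · rw [← hγ2, sl_neg_one_smul]

lemma isCoveringMapOn_proj {A : Set (Orbifold Γ)} (hAc : IsClosed A) (hA : conePoints Γ ⊆ A) :
    IsCoveringMapOn (proj Γ) Aᶜ := by
  refine isCoveringMapOn_of_sections (continuous_proj Γ) ?_
  intro y hy
  obtain ⟨z, rfl⟩ := proj_surjective Γ y
  obtain ⟨N, hN, hinj⟩ := exists_injOn_proj Γ (fun h => hy (hA h))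
  have hN2 : N ∩ proj Γ ⁻¹' Aᶜ ∈ 𝓝 z :=
    inter_mem hN ((continuous_proj Γ).continuousAt.preimage_mem_nhds (hAc.isOpen_compl.mem_nhds hy))
  obtain ⟨B, hBN, hBo, hzB, hBc⟩ :=
    (locallyConnectedSpace_iff_subsets_isOpen_isConnected.1 inferInstance) z _ hN2
  have hBi : InjOn (proj Γ) B := hinj.mono fun x hx => (hBN hx).1
  obtain ⟨σ, hσ, hσ2⟩ := exists_section_of_injOn (isOpenQuotientMap_proj Γ).isOpenMap hBo hBi
  have hBA : ∀ x, proj Γ x ∈ proj Γ '' B → proj Γ x ∉ A := by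
    rintro x ⟨b, hb, hbx⟩
    rw [← hbx]; exact (hBN hb).2
  refine ⟨proj Γ '' B, (isOpenQuotientMap_proj Γ).isOpenMap _ hBo, ⟨z, hzB, rfl⟩,
    (hBc.isPreconnected.image _ (continuous_proj Γ).continuousOn), ?_, ?_⟩
  · intro x hx
    exact exists_injOn_proj Γ (fun h => hBA x hx (hA h))
  · rintro x ⟨b, hb, hbx⟩
    obtain ⟨γ, hγ, rfl⟩ := (proj_eq_iff Γ).1 hbx.symm
    refine ⟨fun v => γ • σ v, hσ.const_smul γ, ?_, ?_⟩
    · rintro _ ⟨c, hc, rfl⟩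
      rw [proj_smul Γ hγ, hσ2 c hc]
    · simp only
      rw [proj_smul Γ hγ, hσ2 b hb]

/-- The preimage in `ℍ` of a closed discrete set has no accumulation points. -/
lemma eventually_proj_notMem {A : Set (Orbifold Γ)} (hAc : IsClosed A) (hAd : DiscreteTopology A)
    (z : ℍ) : ∀ᶠ w in 𝓝[≠] z, proj Γ w ∉ A := by
  by_cases hz : proj Γ z ∈ A
  · obtain ⟨U, hU, hUA⟩ : ∃ U ∈ 𝓝 (proj Γ z), U ∩ A = {proj Γ z} := by
      have := (isDiscrete_iff_nhdsNE.1 ⟨hAd⟩ (proj Γ z) hz)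
      have h2 : {proj Γ z} ∈ 𝓝[A] (proj Γ z) := by
        have h3 := (isDiscrete_iff_discreteTopology.2 hAd)
        rw [mem_nhdsWithin_iff_eventually]
        have h4 : ∀ᶠ x in 𝓝[≠] (proj Γ z), x ∉ A := by
          have := disjoint_principal_right.1 (disjoint_iff.2 this)
          exact this
        have h5 := eventually_nhdsWithin_iff.1 h4
        filter_upwards [h5] with x hx hxA
        by_contra hne
        exact hx hne hxA
      obtain ⟨U, hU, h⟩ := mem_nhdsWithin_iff_exists_mem_nhds_inter.1 h2
      exact ⟨U, hU, subset_antisymm h (by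
        rintro x rfl; exact ⟨mem_of_mem_nhds hU, hz⟩)⟩
    obtain ⟨W, hW, h⟩ := exists_nhds_smul_eq_self Γ z
    rw [eventually_nhdsWithin_iff]
    filter_upwards [hW, (continuous_proj Γ).continuousAt.preimage_mem_nhds hU] with w hw hwU hne hwA
    have : proj Γ w ∈ U ∩ A := ⟨hwU, hwA⟩
    rw [hUA] at this
    obtain ⟨γ, hγ, hγ2⟩ := (proj_eq_iff Γ).1 (show proj Γ w = proj Γ z from this)
    exact hne (by
      have := h γ hγ z (mem_of_mem_nhds hW) (by rwa [hγ2])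
      rw [← hγ2]; exact this)
  · have : ∀ᶠ w in 𝓝 z, proj Γ w ∉ A :=
      (continuous_proj Γ).continuousAt.eventually (hAc.isOpen_compl.mem_nhds hz)
    exact this.filter_mono nhdsWithin_le_nhds

end Proj

/-- The hyperbolic plane is homeomorphic to `ℂ`. -/
def uhpHomeomorph : ℍ ≃ₜ ℂ where
  toFun z := ⟨z.re, Real.log z.im⟩
  invFun w := ⟨⟨w.re, Real.exp w.im⟩, Real.exp_pos _⟩
  left_inv z := by
    apply UpperHalfPlane.coe_injective
    apply Complex.ext
    · rfl
    · exact Real.exp_log z.im_pos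
  right_inv w := by
    apply Complex.ext
    · rfl
    · exact Real.log_exp _
  continuous_toFun := by
    have h : Continuous fun z : ℍ => Complex.equivRealProdCLM.symm (z.re, Real.log z.im) := by
      refine Complex.equivRealProdCLM.symm.continuous.comp ?_
      exact UpperHalfPlane.continuous_re.prodMk
        (UpperHalfPlane.continuous_im.log fun z => z.im_pos.ne')
    exact h
  continuous_invFun := by
    refine Continuous.upperHalfPlaneMk (f := fun w : ℂ => (⟨w.re, Real.exp w.im⟩ : ℂ)) ?_ _
    have h : Continuous fun w : ℂ => Complex.equivRealProdCLM.symm (w.re, Real.exp w.im) := by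
      refine Complex.equivRealProdCLM.symm.continuous.comp ?_
      fun_prop
    exact h

lemma isPathConnected_compl_of_discrete {S : Set ℍ} (hS : ∀ z, ∀ᶠ w in 𝓝[≠] z, w ∉ S) :
    IsPathConnected Sᶜ := by
  have hcount : S.Countable := by
    have : DiscreteTopology S := by
      rw [discreteTopology_subtype_iff]
      intro x hx
      rw [← disjoint_iff]
      exact disjoint_principal_right.2 (hS x)
    exact countable_of_Lindelof_of_discrete.to_set
  have h := (hcount.image uhpHomeomorph).isPathConnected_compl_of_one_lt_rank
    (by rw [Complex.rank_real_complex]; exact Nat.one_lt_ofNat)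
  have h2 := h.image (f := uhpHomeomorph.symm) uhpHomeomorph.symm.continuous
  convert h2 using 1
  rw [← image_compl_eq uhpHomeomorph.bijective, ← image_comp]
  simp

lemma locallyPathConnectedSpace_of_isLocalHomeomorph {E X : Type*} [TopologicalSpace E]
    [TopologicalSpace X] [LocallyPathConnectedSpace X] {p : E → X} (hp : IsLocalHomeomorph p) :
    LocallyPathConnectedSpace E := by
  choose c hc hcp using hp
  let _ : ChartedSpace X E :=
    { atlas := range c
      chartAt := c
      mem_chart_source := hc
      chart_mem_atlas := fun x => mem_range_self x }
  exact ChartedSpace.locallyPathConnectedSpace X E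

end

section

/-! ### Linear differential equations of second order -/

/-- The coefficients are those of a power series which converges in the unit disc. -/
def DiscBound (a : ℕ → ℂ) : Prop := ∀ s : ℝ, 0 < s → s < 1 → ∃ A : ℝ, ∀ n, ‖a n‖ * s ^ n ≤ A

/-- The sum of a power series. -/
def psum (a : ℕ → ℂ) (z : ℂ) : ℂ := ∑' n, a n * z ^ n

lemma DiscBound.exists_le {a : ℕ → ℂ} (ha : DiscBound a) {r : ℝ} (hr0 : 0 ≤ r) (hr : r < 1) :
    ∃ A t : ℝ, 0 ≤ A ∧ 0 < t ∧ r / t < 1 ∧ 0 ≤ r / t ∧ ∀ n, ‖a n‖ * t ^ n ≤ A := by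
  obtain ⟨A, hA⟩ := ha ((1 + r) / 2) (by linarith) (by linarith)
  refine ⟨A, (1 + r) / 2, le_trans (by positivity) (hA 0), by linarith, ?_, by positivity, hA⟩
  rw [div_lt_one (by linarith)]; linarith

lemma DiscBound.summable_norm {a : ℕ → ℂ} (ha : DiscBound a) {z : ℂ} (hz : ‖z‖ < 1) :
    Summable fun n => ‖a n * z ^ n‖ := by
  obtain ⟨A, t, hA0, ht, h1, h2, hA⟩ := ha.exists_le (norm_nonneg z) hz
  refine Summable.of_nonneg_of_le (fun n => norm_nonneg _) (fun n => ?_)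
    ((summable_geometric_of_lt_one h2 h1).mul_left A)
  rw [norm_mul, norm_pow, div_pow]
  have h3 := hA n
  have h4 : (0 : ℝ) < t ^ n := pow_pos ht n
  calc ‖a n‖ * ‖z‖ ^ n = (‖a n‖ * t ^ n) * (‖z‖ ^ n / t ^ n) := by field_simp
    _ ≤ A * (‖z‖ ^ n / t ^ n) := by gcongr

lemma DiscBound.deriv {a : ℕ → ℂ} (ha : DiscBound a) :
    DiscBound fun n => (n + 1 : ℂ) * a (n + 1) := by
  intro s hs0 hs1
  obtain ⟨A, t, hA0, ht, h1, h2, hA⟩ := ha.exists_le hs0.le hs1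
  have hs := summable_pow_mul_geometric_of_norm_lt_one (R := ℝ) 1
    (r := s / t) (by rw [Real.norm_of_nonneg h2]; exact h1)
  have hb : ∀ n : ℕ, (n : ℝ) * (s / t) ^ n ≤ ∑' n : ℕ, (n : ℝ) ^ 1 * (s / t) ^ n := by
    intro n
    have := hs.le_tsum n (fun j _ => by positivity)
    simpa using this
  refine ⟨A / s * ∑' n : ℕ, (n : ℝ) ^ 1 * (s / t) ^ n, fun n => ?_⟩
  have h5 : ‖(n + 1 : ℂ) * a (n + 1)‖ = ((n + 1 : ℕ) : ℝ) * ‖a (n + 1)‖ := by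
    rw [norm_mul]; congr 1
    exact_mod_cast Complex.norm_natCast (n + 1)
  rw [h5]
  have h4 : (0 : ℝ) < t ^ (n + 1) := pow_pos ht _
  calc ((n + 1 : ℕ) : ℝ) * ‖a (n + 1)‖ * s ^ n
      = (‖a (n + 1)‖ * t ^ (n + 1)) / s * (((n + 1 : ℕ) : ℝ) * (s / t) ^ (n + 1)) := by
        rw [div_pow]; field_simp; ring
    _ ≤ A / s * (((n + 1 : ℕ) : ℝ) * (s / t) ^ (n + 1)) := by gcongr; exact hA _
    _ ≤ _ := by gcongr; exact hb _

lemma DiscBound.hasDerivAt {a : ℕ → ℂ} (ha : DiscBound a) {z : ℂ} (hz : ‖z‖ < 1) :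
    HasDerivAt (psum a) (psum (fun n => (n + 1 : ℂ) * a (n + 1)) z) z := by
  obtain ⟨r, hzr, hr⟩ := exists_between hz
  have hr0 : 0 ≤ r := (norm_nonneg z).trans hzr.le
  have hd := ha.deriv.summable_norm (z := (r : ℂ)) (by simpa [abs_of_nonneg hr0] using hr)
  have hu : Summable fun n : ℕ => ‖(n : ℂ) * a n‖ * r ^ (n - 1) := by
    rw [← summable_nat_add_iff 1]
    refine hd.congr fun n => ?_
    simp [abs_of_nonneg hr0]
  have h := hasDerivAt_tsum_of_isPreconnected (g := fun n z => a n * z ^ n)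
    (g' := fun n z => a n * (n * z ^ (n - 1))) hu (Metric.isOpen_ball (x := (0 : ℂ)) (ε := r))
    (convex_ball _ _).isPreconnected (y₀ := 0) (y := z)
    (fun n y _ => (hasDerivAt_pow n y).const_mul (a n))
    (fun n y hy => by
      have hy' : ‖y‖ ≤ r := by simpa using (Metric.mem_ball.1 hy).le
      rw [norm_mul, norm_mul, norm_mul, norm_pow]
      have : ‖y‖ ^ (n - 1) ≤ r ^ (n - 1) := by gcongr
      calc ‖a n‖ * (‖(n : ℂ)‖ * ‖y‖ ^ (n - 1)) = ‖(n : ℂ)‖ * ‖a n‖ * ‖y‖ ^ (n - 1) := by ring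
        _ ≤ _ := by gcongr)
    (by rw [Metric.mem_ball, dist_self]; exact (norm_nonneg z).trans_lt hzr)
    ((ha.summable_norm (z := 0) (by simp)).of_norm) (by simpa using hzr)
  refine h.congr_deriv ?_
  have hs : Summable fun n : ℕ => a n * (n * z ^ (n - 1)) := by
    rw [← summable_nat_add_iff 1]
    refine (ha.deriv.summable_norm hz).of_norm.congr fun n => ?_
    push_cast
    ring
  rw [hs.tsum_eq_zero_add]
  simp only [CharP.cast_eq_zero, zero_mul, mul_zero, zero_add, psum]
  refine tsum_congr fun n => ?_
  push_cast
  ring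

/-- The coefficients of the power series solution of `y'' = b y`. -/
def odeCoeff (b : ℕ → ℂ) (a₀ a₁ : ℂ) : ℕ → ℂ
  | 0 => a₀
  | 1 => a₁
  | n + 2 => (∑ k : Fin (n + 1), odeCoeff b a₀ a₁ k * b (n - k)) / ((n + 1) * (n + 2))

lemma odeCoeff_discBound {b : ℕ → ℂ} (hb : DiscBound b) (a₀ a₁ : ℂ) :
    DiscBound (odeCoeff b a₀ a₁) := by
  intro s hs0 hs1
  obtain ⟨K, hK⟩ := hb s hs0 hs1
  obtain ⟨n₀, hn₀⟩ := exists_nat_ge K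
  set a := odeCoeff b a₀ a₁ with ha
  set A : ℝ := ∑ k ∈ Finset.range (n₀ + 2), ‖a k‖ * s ^ k with hA
  have hA0 : 0 ≤ A := Finset.sum_nonneg fun k _ => by positivity
  have hK0 : 0 ≤ K := le_trans (by positivity) (hK 0)
  refine ⟨A, fun n => ?_⟩
  induction n using Nat.strong_induction_on with
  | _ n ih =>
  by_cases hn : n < n₀ + 2
  · exact Finset.single_le_sum (f := fun k => ‖a k‖ * s ^ k) (fun k _ => by positivity)
      (Finset.mem_range.2 hn)
  · obtain ⟨m, rfl⟩ : ∃ m, n = m + 2 := ⟨n - 2, by omega⟩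
    have h1 : ‖a (m + 2)‖ = ‖∑ k : Fin (m + 1), a k * b (m - k)‖ / ((m + 1) * (m + 2)) := by
      rw [ha, odeCoeff, norm_div]
      congr 1
      rw [norm_mul]
      congr 1
      · exact_mod_cast Complex.norm_natCast (m + 1)
      · exact_mod_cast Complex.norm_natCast (m + 2)
    have h2 : ‖∑ k : Fin (m + 1), a k * b (m - k)‖ * s ^ m ≤ (m + 1) * (A * K) := by
      calc ‖∑ k : Fin (m + 1), a k * b (m - k)‖ * s ^ m
          ≤ (∑ k : Fin (m + 1), ‖a k * b (m - k)‖) * s ^ m := by gcongr; exact norm_sum_le _ _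
        _ = ∑ k : Fin (m + 1), ‖a k * b (m - k)‖ * s ^ m := Finset.sum_mul _ _ _
        _ ≤ ∑ k : Fin (m + 1), A * K := by
            refine Finset.sum_le_sum fun k _ => ?_
            have hk : (k : ℕ) ≤ m := by omega
            have : s ^ m = s ^ (k : ℕ) * s ^ (m - k) := by rw [← pow_add]; congr 1; omega
            rw [norm_mul, this]
            calc ‖a k‖ * ‖b (m - k)‖ * (s ^ (k : ℕ) * s ^ (m - k))
                = (‖a k‖ * s ^ (k : ℕ)) * (‖b (m - k)‖ * s ^ (m - k)) := by ring
              _ ≤ A * K := by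
                  gcongr
                  · exact ih k (by omega)
                  · exact hK _
        _ = _ := by simp
    have h3 : s ^ 2 ≤ 1 := pow_le_one₀ hs0.le hs1.le
    have h4 : K ≤ m + 2 := by
      have : (n₀ : ℝ) ≤ m := by exact_mod_cast (show n₀ ≤ m by omega)
      linarith
    rw [h1, pow_add, div_mul_eq_mul_div, div_le_iff₀ (by positivity)]
    calc ‖∑ k : Fin (m + 1), a k * b (m - k)‖ * (s ^ m * s ^ 2)
        = ‖∑ k : Fin (m + 1), a k * b (m - k)‖ * s ^ m * s ^ 2 := by ring
      _ ≤ (m + 1) * (A * K) * 1 := by gcongr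
      _ ≤ (m + 1) * (A * (m + 2)) := by rw [mul_one]; gcongr
      _ = A * ((m + 1) * (m + 2)) := by ring

lemma odeCoeff_hasDerivAt {b : ℕ → ℂ} (hb : DiscBound b) (a₀ a₁ : ℂ) {z : ℂ} (hz : ‖z‖ < 1) :
    HasDerivAt (psum fun n => (n + 1 : ℂ) * odeCoeff b a₀ a₁ (n + 1))
      (psum b z * psum (odeCoeff b a₀ a₁) z) z := by
  have ha := odeCoeff_discBound hb a₀ a₁
  refine (ha.deriv.hasDerivAt hz).congr_deriv ?_
  unfold psum
  rw [mul_comm, tsum_mul_tsum_eq_tsum_sum_antidiagonal_of_summable_norm (ha.summable_norm hz)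
    (hb.summable_norm hz)]
  refine tsum_congr fun n => ?_
  rw [Finset.Nat.sum_antidiagonal_eq_sum_range_succ
    (fun i j => odeCoeff b a₀ a₁ i * z ^ i * (b j * z ^ j)), Finset.sum_range]
  have h1 : (n + 1 : ℂ) ≠ 0 := by exact_mod_cast Nat.succ_ne_zero n
  have h2 : (n + 2 : ℂ) ≠ 0 := by exact_mod_cast Nat.succ_ne_zero (n + 1)
  have h3 : (n + 1 : ℂ) * (((n + 1 : ℕ) : ℂ) + 1) * odeCoeff b a₀ a₁ (n + 1 + 1) =
      ∑ k : Fin (n + 1), odeCoeff b a₀ a₁ k * b (n - k) := by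
    rw [odeCoeff]; push_cast
    field_simp
    ring
  simp only
  rw [← mul_assoc, h3, Finset.sum_mul]
  refine Finset.sum_congr rfl fun k _ => ?_
  have : z ^ n = z ^ (k : ℕ) * z ^ (n - k) := by rw [← pow_add]; congr 1; omega
  rw [this]; ring

/-- `y` solves the equation `y'' = q y` on `U`, and `y'` is its derivative. -/
def IsSol (q : ℂ → ℂ) (U : Set ℂ) (y y' : ℂ → ℂ) : Prop :=
  ∀ z ∈ U, HasDerivAt y (y' z) z ∧ HasDerivAt y' (q z * y z) z

lemma IsSol.mono {q : ℂ → ℂ} {U V : Set ℂ} {y y' : ℂ → ℂ} (h : IsSol q U y y') (hV : V ⊆ U) :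
    IsSol q V y y' := fun z hz => h z (hV hz)

lemma IsSol.linear {q : ℂ → ℂ} {U : Set ℂ} {y y' u u' : ℂ → ℂ} (h : IsSol q U y y')
    (h2 : IsSol q U u u') (a b : ℂ) :
    IsSol q U (fun z => a * y z + b * u z) (fun z => a * y' z + b * u' z) := fun z hz => by
  refine ⟨((h z hz).1.const_mul a).add ((h2 z hz).1.const_mul b), ?_⟩
  refine (((h z hz).2.const_mul a).add ((h2 z hz).2.const_mul b)).congr_deriv ?_
  ring

lemma IsSol.wronskian_const {q : ℂ → ℂ} {U : Set ℂ} (hU : IsOpen U) (hUc : IsPreconnected U)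
    {y y' u u' : ℂ → ℂ} (h : IsSol q U y y') (h2 : IsSol q U u u') {z w : ℂ} (hz : z ∈ U)
    (hw : w ∈ U) : y z * u' z - y' z * u z = y w * u' w - y' w * u w := by
  have key : ∀ z ∈ U, HasDerivAt (fun z => y z * u' z - y' z * u z) 0 z := by
    intro z hz
    refine (((h z hz).1.mul (h2 z hz).2).sub ((h z hz).2.mul (h2 z hz).1)).congr_deriv ?_
    ring
  exact hU.is_const_of_deriv_eq_zero hUc
    (fun z hz => (key z hz).differentiableAt.differentiableWithinAt)
    (fun z hz => (key z hz).deriv) hz hw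

lemma IsSol.eq_linear {q : ℂ → ℂ} {U : Set ℂ} (hU : IsOpen U) (hUc : IsPreconnected U)
    {y₁ y₁' y₂ y₂' u u' : ℂ → ℂ} (h₁ : IsSol q U y₁ y₁') (h₂ : IsSol q U y₂ y₂')
    (hW : ∀ z ∈ U, y₁ z * y₂' z - y₁' z * y₂ z = 1) (h : IsSol q U u u') {z : ℂ} (hz : z ∈ U) :
    ∃ a b : ℂ, ∀ w ∈ U, u w = a * y₁ w + b * y₂ w ∧ u' w = a * y₁' w + b * y₂' w := by
  refine ⟨u z * y₂' z - u' z * y₂ z, y₁ z * u' z - y₁' z * u z, fun w hw => ?_⟩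
  rw [h.wronskian_const hU hUc h₂ hz hw, h₁.wronskian_const hU hUc h hz hw]
  constructor
  · linear_combination -(u w) * hW w hw
  · linear_combination -(u' w) * hW w hw

lemma exists_isSol_ball {q : ℂ → ℂ} (hq : DifferentiableOn ℂ q (Metric.ball 0 1)) (a₀ a₁ : ℂ) :
    ∃ y y' : ℂ → ℂ, IsSol q (Metric.ball 0 1) y y' ∧ y 0 = a₀ ∧ y' 0 = a₁ := by
  set b : ℕ → ℂ := fun n => (n.factorial : ℂ)⁻¹ * iteratedDeriv n q 0
  have hs : ∀ z ∈ Metric.ball (0 : ℂ) 1, HasSum (fun n => b n * z ^ n) (q z) := by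
    intro z hz
    have := Complex.hasSum_taylorSeries_on_ball hq hz
    refine this.congr_fun ?_ |> id
    intro n
    simp [b]; ring
  have hb : DiscBound b := by
    intro s hs0 hs1
    have h1 := (hs s (by simpa [abs_of_pos hs0] using hs1)).summable.tendsto_atTop_zero
    obtain ⟨A, hA⟩ := h1.norm.bddAbove_range
    refine ⟨A, fun n => ?_⟩
    have := hA (mem_range_self n)
    simpa [abs_of_pos hs0] using this
  refine ⟨psum (odeCoeff b a₀ a₁), psum fun n => (n + 1 : ℂ) * odeCoeff b a₀ a₁ (n + 1),
    fun z hz => ?_, ?_, ?_⟩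
  · have hz' : ‖z‖ < 1 := by simpa using hz
    refine ⟨(odeCoeff_discBound hb a₀ a₁).hasDerivAt hz', ?_⟩
    have := odeCoeff_hasDerivAt hb a₀ a₁ hz'
    rwa [show psum b z = q z from (hs z hz).tsum_eq] at this
  · unfold psum
    rw [tsum_eq_single 0 (fun n hn => by simp [hn])]
    simp [odeCoeff]
  · unfold psum
    rw [tsum_eq_single 0 (fun n hn => by simp [hn])]
    simp [odeCoeff]

lemma cayley_norm_lt {z : ℂ} (hz : 0 < z.im) : ‖(z - Complex.I) / (z + Complex.I)‖ < 1 := by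
  have hne : z + Complex.I ≠ 0 := by
    intro h
    have := congrArg Complex.im h
    simp at this; linarith
  rw [norm_div, div_lt_one (norm_pos_iff.2 hne)]
  rw [← sq_lt_sq₀ (norm_nonneg _) (norm_nonneg _), ← Complex.normSq_eq_norm_sq,
    ← Complex.normSq_eq_norm_sq, Complex.normSq_apply, Complex.normSq_apply]
  simp
  nlinarith

/-- The upper half-plane. -/
def uhp : Set ℂ := {z | 0 < z.im}

lemma isOpen_uhp : IsOpen uhp := isOpen_lt continuous_const Complex.continuous_im

/-- The equation `y'' = q y` has a fundamental system of solutions in the upper half-plane. -/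
lemma exists_isSol_uhp {q : ℂ → ℂ} (hq : DifferentiableOn ℂ q uhp) :
    ∃ y₁ y₁' y₂ y₂' : ℂ → ℂ, IsSol q uhp y₁ y₁' ∧ IsSol q uhp y₂ y₂' ∧
      ∀ z ∈ uhp, y₁ z * y₂' z - y₁' z * y₂ z = 1 := by
  set I := Complex.I
  have hI2 : I * I = -1 := Complex.I_mul_I
  set qD : ℂ → ℂ := fun w => q (I * (1 + w) / (1 - w)) * (-4 / (1 - w) ^ 4) with hqD
  have hw1 : ∀ w : ℂ, w ∈ Metric.ball (0 : ℂ) 1 → 1 - w ≠ 0 := by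
    intro w hw h
    have : w = 1 := by linear_combination -h
    simp [this] at hw
  have him : ∀ w : ℂ, w ∈ Metric.ball (0 : ℂ) 1 → I * (1 + w) / (1 - w) ∈ uhp := by
    intro w hw
    have h1 := hw1 w hw
    have h2 : ‖w‖ < 1 := by simpa using hw
    have h3 : Complex.normSq w < 1 := by
      rw [Complex.normSq_eq_norm_sq]; nlinarith [norm_nonneg w]
    have h4 : 0 < Complex.normSq (1 - w) := Complex.normSq_pos.2 h1
    change 0 < (I * (1 + w) / (1 - w)).im
    rw [Complex.div_im, ← sub_div]
    · refine div_pos ?_ h4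
      simp [I]
      rw [Complex.normSq_apply] at h3
      nlinarith
  have hqDd : DifferentiableOn ℂ qD (Metric.ball 0 1) := by
    intro w hw
    have h1 := hw1 w hw
    refine DifferentiableAt.differentiableWithinAt ?_
    refine DifferentiableAt.mul ?_ ?_
    · refine DifferentiableAt.comp (g := q) w ((hq _ (him w hw)).differentiableAt
        (isOpen_uhp.mem_nhds (him w hw))) ?_
      refine DifferentiableAt.div ?_ ?_ h1 <;> fun_prop
    · refine DifferentiableAt.div ?_ ?_ (pow_ne_zero _ h1) <;> fun_prop
  obtain ⟨Y₁, Y₁', hY₁, hY₁0, hY₁0'⟩ := exists_isSol_ball hqDd 1 0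
  obtain ⟨Y₂, Y₂', hY₂, hY₂0, hY₂0'⟩ := exists_isSol_ball hqDd 0 1
  have hzI : ∀ z ∈ uhp, z + I ≠ 0 := by
    intro z hz h
    have := congrArg Complex.im h
    have hz' : 0 < z.im := hz
    simp [I] at this; linarith
  set c : ℂ → ℂ := fun z => (z - I) / (z + I) with hc
  have hcb : ∀ z ∈ uhp, c z ∈ Metric.ball (0 : ℂ) 1 := fun z hz => by
    rw [mem_ball_zero_iff]; exact cayley_norm_lt hz
  have hcd : ∀ z ∈ uhp, HasDerivAt c (2 * I / (z + I) ^ 2) z := by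
    intro z hz
    refine (((hasDerivAt_id z).sub_const I).div ((hasDerivAt_id z).add_const I)
      (hzI z hz)).congr_deriv ?_
    simp only [id]
    congr 1
    ring
  have hcq : ∀ z ∈ uhp, qD (c z) = q z * (-(z + I) ^ 4 / 4) := by
    intro z hz
    have h0 := hzI z hz
    have h1 : 1 - c z = 2 * I / (z + I) := by
      simp only [hc]; field_simp; ring
    have h2 : 1 + c z = 2 * z / (z + I) := by
      simp only [hc]; field_simp; ring
    have hI : I ≠ 0 := Complex.I_ne_zero
    have h3 : I * (1 + c z) / (1 - c z) = z := by
      rw [h1, h2]; field_simp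
    simp only [hqD]
    rw [h3, h1, div_pow, mul_pow]
    have : I ^ 4 = 1 := Complex.I_pow_four
    rw [this]
    field_simp
    ring
  have trans : ∀ Y Y' : ℂ → ℂ, IsSol qD (Metric.ball 0 1) Y Y' →
      IsSol q uhp (fun z => (z + I) * Y (c z)) (fun z => Y (c z) + 2 * I * Y' (c z) / (z + I)) := by
    intro Y Y' hY z hz
    have h0 := hzI z hz
    have hd1 : HasDerivAt (fun z => Y (c z)) (Y' (c z) * (2 * I / (z + I) ^ 2)) z :=
      HasDerivAt.comp z (hY _ (hcb z hz)).1 (hcd z hz)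
    have hd2 : HasDerivAt (fun z => Y' (c z)) (qD (c z) * Y (c z) * (2 * I / (z + I) ^ 2)) z :=
      HasDerivAt.comp z (hY _ (hcb z hz)).2 (hcd z hz)
    constructor
    · refine (((hasDerivAt_id z).add_const I).mul hd1).congr_deriv ?_
      simp only [id]
      field_simp
    · refine (hd1.add ((hd2.const_mul (2 * I)).div ((hasDerivAt_id z).add_const I) h0)).congr_deriv ?_
      rw [hcq z hz]
      simp only [id]
      generalize z + I = Z at h0
      generalize Y (c z) = A
      generalize Y' (c z) = B
      field_simp
      linear_combination (-4 * q z * A * Z ^ 3) * hI2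
  have h₁ := trans _ _ hY₁
  have h₂ := trans _ _ hY₂
  have h2I : (2 * I)⁻¹ * (2 * I) = 1 := inv_mul_cancel₀ (by simp [I])
  refine ⟨_, _, fun z => (2 * I)⁻¹ * ((z + I) * Y₂ (c z)) + 0 * ((z + I) * Y₁ (c z)), _, h₁,
    h₂.linear h₁ (2 * I)⁻¹ 0, fun z hz => ?_⟩
  have h0 := hzI z hz
  have hW := hY₁.wronskian_const Metric.isOpen_ball (convex_ball _ _).isPreconnected hY₂ (hcb z hz)
    (Metric.mem_ball_self one_pos)
  rw [hY₁0, hY₁0', hY₂0, hY₂0'] at hW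
  have e : ∀ A B C D : ℂ, (z + I) * A * ((2 * I)⁻¹ * (B + 2 * I * C / (z + I)) + 0 * (A + 2 * I * D / (z + I))) -
      (A + 2 * I * D / (z + I)) * ((2 * I)⁻¹ * ((z + I) * B) + 0 * ((z + I) * A)) =
      (2 * I)⁻¹ * (2 * I) * (A * C - D * B) := by
    intro A B C D
    field_simp
    ring
  rw [e, h2I, hW]; ring

/-- A solution with two zeros which are close to each other vanishes. -/
lemma IsSol.deriv_eq_zero {q : ℂ → ℂ} {U : Set ℂ} {y y' : ℂ → ℂ} (h : IsSol q U y y') {a b : ℂ}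
    (hU : ∀ t ∈ Icc (0 : ℝ) 1, a + t * (b - a) ∈ U) {K : ℝ}
    (hK : ∀ t ∈ Icc (0 : ℝ) 1, ‖q (a + t * (b - a))‖ ≤ K) (hKb : 2 * K * ‖b - a‖ ^ 2 < 1)
    (ha : y a = 0) (hb : y b = 0) (hab : a ≠ b) : y' a = 0 := by
  set L := ‖b - a‖ with hL
  have hL0 : 0 ≤ L := norm_nonneg _
  have hK0 : 0 ≤ K := (norm_nonneg _).trans (hK 0 (by simp))
  have hl : ∀ t : ℝ, HasDerivAt (fun t : ℝ => a + (t : ℂ) * (b - a)) (b - a) t := by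
    intro t
    simpa using ((Complex.ofRealCLM.hasDerivAt (x := t)).mul_const (b - a)).const_add a
  set f : ℝ → ℂ := fun t => y (a + t * (b - a)) with hf
  set f' : ℝ → ℂ := fun t => y' (a + t * (b - a)) * (b - a) with hf'
  have hfd : ∀ t ∈ Icc (0 : ℝ) 1, HasDerivAt f (f' t) t := fun t ht =>
    HasDerivAt.comp t (h _ (hU t ht)).1 (hl t)
  have hfd' : ∀ t ∈ Icc (0 : ℝ) 1,
      HasDerivAt f' (q (a + t * (b - a)) * f t * (b - a) * (b - a)) t := fun t ht =>
    (HasDerivAt.comp t (h _ (hU t ht)).2 (hl t)).mul_const (b - a)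
  have hfc : ContinuousOn f (Icc 0 1) := fun t ht => (hfd t ht).continuousAt.continuousWithinAt
  obtain ⟨t₀, ht₀, hmax⟩ := isCompact_Icc.exists_isMaxOn ⟨0, by simp⟩ hfc.norm
  set M := ‖f t₀‖ with hM
  have hM0 : 0 ≤ M := norm_nonneg _
  have hfM : ∀ t ∈ Icc (0 : ℝ) 1, ‖f t‖ ≤ M := fun t ht => hmax ht
  have h0 : (0 : ℝ) ∈ Icc (0 : ℝ) 1 := by simp
  have h1 : (1 : ℝ) ∈ Icc (0 : ℝ) 1 := by simp
  have b1 : ∀ t ∈ Icc (0 : ℝ) 1, ‖f' t - f' 0‖ ≤ K * L ^ 2 * M := by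
    intro t ht
    have := (convex_Icc (0 : ℝ) 1).norm_image_sub_le_of_norm_hasDerivWithin_le (C := K * L ^ 2 * M)
      (fun x hx => (hfd' x hx).hasDerivWithinAt) (fun x hx => by
        rw [norm_mul, norm_mul, norm_mul]
        calc ‖q (a + x * (b - a))‖ * ‖f x‖ * L * L ≤ K * M * L * L := by
              gcongr
              · exact hK x hx
              · exact hfM x hx
          _ = _ := by ring) h0 ht
    refine this.trans ?_
    have ht1 : ‖t - 0‖ ≤ 1 := by rw [sub_zero, Real.norm_of_nonneg ht.1]; exact ht.2
    exact mul_le_of_le_one_right (by positivity) ht1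
  have f0 : f 0 = 0 := by simp [hf, ha]
  have f1 : f 1 = 0 := by simp [hf, hb]
  have b2 : ‖f' 0‖ ≤ K * L ^ 2 * M := by
    have := (convex_Icc (0 : ℝ) 1).norm_image_sub_le_of_norm_hasDerivWithin_le
      (f := fun t => f t - (t : ℂ) * f' 0) (f' := fun t => f' t - f' 0) (C := K * L ^ 2 * M)
      (fun x hx => by
        refine HasDerivAt.hasDerivWithinAt ((hfd x hx).sub ?_)
        simpa using (Complex.ofRealCLM.hasDerivAt (x := x)).mul_const (f' 0))
      (fun x hx => b1 x hx) h0 h1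
    simpa [f0, f1] using this
  have b3 : ∀ t ∈ Icc (0 : ℝ) 1, ‖f' t‖ ≤ 2 * K * L ^ 2 * M := by
    intro t ht
    calc ‖f' t‖ = ‖(f' t - f' 0) + f' 0‖ := by ring_nf
      _ ≤ K * L ^ 2 * M + K * L ^ 2 * M := (norm_add_le _ _).trans (add_le_add (b1 t ht) b2)
      _ = _ := by ring
  have b4 : M ≤ 2 * K * L ^ 2 * M := by
    have := (convex_Icc (0 : ℝ) 1).norm_image_sub_le_of_norm_hasDerivWithin_le
      (fun x hx => (hfd x hx).hasDerivWithinAt) b3 h0 ht₀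
    rw [f0, sub_zero] at this
    refine this.trans ?_
    have ht1 : ‖t₀ - 0‖ ≤ 1 := by rw [sub_zero, Real.norm_of_nonneg ht₀.1]; exact ht₀.2
    exact mul_le_of_le_one_right (by positivity) ht1
  have hMz : M = 0 := by
    by_contra hne
    have : 0 < M := lt_of_le_of_ne hM0 (Ne.symm hne)
    nlinarith
  rw [hMz, mul_zero] at b2
  have h3 : f' 0 = 0 := norm_le_zero_iff.1 b2
  have hba : b - a ≠ 0 := sub_ne_zero.2 hab.symm
  simpa [hf', hba] using h3

end

section

/-! ### The Schwarzian derivative -/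

lemma deriv_ne_zero_of_injOn {f : ℂ → ℂ} {z : ℂ} (hf : AnalyticAt ℂ f z) {N : Set ℂ}
    (hN : N ∈ 𝓝 z) (hinj : InjOn f N) : deriv f z ≠ 0 := by
  intro hd
  have hh : AnalyticAt ℂ (fun w => f w - f z) z := by fun_prop
  have hne : ¬ ∀ᶠ w in 𝓝 z, f w - f z = 0 := by
    intro h
    have h1 : ∀ᶠ w in 𝓝[≠] z, False := by
      rw [eventually_nhdsWithin_iff]
      filter_upwards [h, hN] with w hw hwN hwz
      exact hwz (hinj hwN (mem_of_mem_nhds hN) (sub_eq_zero.1 hw))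
    exact h1.exists.elim fun _ h => h
  obtain ⟨n, g, hg, hgz, hfg⟩ := hh.exists_eventuallyEq_pow_smul_nonzero_iff.2 hne
  have hn0 : n ≠ 0 := by
    rintro rfl
    have := hfg.self_of_nhds
    simp at this
    exact hgz this.symm
  have hn1 : n ≠ 1 := by
    rintro rfl
    have h1 : HasDerivAt (fun w => (w - z) ^ 1 • g w) (g z) z := by
      have : HasDerivAt (fun w => (w - z) * g w) _ z :=
        ((hasDerivAt_id z).sub_const z).mul hg.differentiableAt.hasDerivAt
      simpa using this
    have h2 : HasDerivAt (fun w => f w - f z) (g z) z := h1.congr_of_eventuallyEq hfg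
    have h3 : HasDerivAt (fun w => f w - f z) (deriv f z) z :=
      hf.differentiableAt.hasDerivAt.sub_const _
    exact hgz (by rw [← h2.unique h3 |>.symm, hd])
  have hnC : (n : ℂ) ≠ 0 := by exact_mod_cast hn0
  set r : ℂ → ℂ := fun w => Complex.exp (Complex.log (g w / g z) / n) with hr
  have hra : AnalyticAt ℂ r z := by
    refine AnalyticAt.cexp ?_
    refine AnalyticAt.div ?_ analyticAt_const hnC
    refine AnalyticAt.clog (hg.div analyticAt_const hgz) ?_
    rw [div_self hgz]; exact Complex.one_mem_slitPlane
  have hrz : r z = 1 := by simp [hr, hgz]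
  have hrn : ∀ᶠ w in 𝓝 z, r w ^ n = g w / g z := by
    filter_upwards [hg.continuousAt.eventually_ne hgz] with w hw
    rw [hr, ← Complex.exp_nat_mul, mul_div_cancel₀ _ hnC, Complex.exp_log (div_ne_zero hw hgz)]
  set k : ℂ → ℂ := fun w => (w - z) * r w with hk
  have hka : AnalyticAt ℂ k z := by fun_prop
  have hkd : HasDerivAt k 1 z := by
    have : HasDerivAt k _ z := ((hasDerivAt_id z).sub_const z).mul hra.differentiableAt.hasDerivAt
    simpa [hrz] using this
  have hkz : k z = 0 := by simp [hk]
  have hmap : map k (𝓝 z) = 𝓝 0 := by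
    rw [← hkz]
    exact hka.hasStrictDerivAt.map_nhds_eq (by rw [hkd.deriv]; exact one_ne_zero)
  set N' := {w | w ∈ N ∧ f w - f z = (w - z) ^ n • g w ∧ r w ^ n = g w / g z} with hN'
  have hN'n : N' ∈ 𝓝 z := by filter_upwards [hN, hfg, hrn] with w h1 h2 h3 using ⟨h1, h2, h3⟩
  have hk0 : k '' N' ∈ 𝓝 (0 : ℂ) := by rw [← hmap]; exact image_mem_map hN'n
  have hkn : ∀ w ∈ N', f w = f z + g z * k w ^ n := by
    rintro w ⟨h1, h2, h3⟩
    have : f w - f z = g z * k w ^ n := by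
      rw [h2, hk, mul_pow, h3, smul_eq_mul]; field_simp
    linear_combination this
  obtain ⟨ε, hε, hball⟩ := Metric.mem_nhds_iff.1 hk0
  set ζ := Complex.exp (2 * Real.pi * Complex.I / n) with hζ
  have hprim := Complex.isPrimitiveRoot_exp n hn0
  have hζ1 : ζ ≠ 1 := hprim.ne_one (by omega)
  have hζn : ζ ^ n = 1 := hprim.pow_eq_one
  have hζnorm : ‖ζ‖ = 1 := Complex.norm_eq_one_of_pow_eq_one hζn hn0
  obtain ⟨w₁, hw₁, hk₁⟩ := hball (show ((ε / 2 : ℝ) : ℂ) ∈ Metric.ball 0 ε by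
    rw [mem_ball_zero_iff, Complex.norm_real, Real.norm_of_nonneg (by positivity)]; linarith)
  obtain ⟨w₂, hw₂, hk₂⟩ := hball (show ζ * ((ε / 2 : ℝ) : ℂ) ∈ Metric.ball 0 ε by
    rw [mem_ball_zero_iff, norm_mul, hζnorm, Complex.norm_real,
      Real.norm_of_nonneg (by positivity)]; linarith)
  have h12 : w₁ = w₂ := hinj hw₁.1 hw₂.1 (by
    rw [hkn _ hw₁, hkn _ hw₂, hk₁, hk₂, mul_pow, hζn, one_mul])
  rw [h12, hk₂] at hk₁
  have hε0 : ((ε / 2 : ℝ) : ℂ) ≠ 0 := by exact_mod_cast (by positivity : ε / 2 ≠ 0)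
  exact hζ1 (mul_right_cancel₀ hε0 (by rw [hk₁, one_mul]))

lemma schwarzian_gl_smul {F G : ℂ → ℂ} {z : ℂ} (hF : AnalyticAt ℂ F z) (hF' : deriv F z ≠ 0)
    (g : GL (Fin 2) ℂ) (h : ∀ᶠ w in 𝓝 z, (G w : OnePoint ℂ) = g • (F w : OnePoint ℂ)) :
    schwarzian G z = schwarzian F z := by
  have hdet := gl_det g
  set a := g 0 0
  set b := g 0 1
  set c := g 1 0
  set d := g 1 1
  have hD : ∀ᶠ w in 𝓝 z, c * F w + d ≠ 0 := h.mono fun w hw => (gl_smul_coe _ _ _ hw.symm).1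
  have hG : ∀ᶠ w in 𝓝 z, G w = (a * F w + b) / (c * F w + d) :=
    h.mono fun w hw => (gl_smul_coe _ _ _ hw.symm).2
  have hFa := hF.eventually_analyticAt
  have hF0 : ∀ᶠ w in 𝓝 z, deriv F w ≠ 0 := hF.deriv.continuousAt.eventually_ne hF'
  have hG' : ∀ᶠ w in 𝓝 z, deriv G w = (a * d - b * c) * deriv F w / (c * F w + d) ^ 2 := by
    filter_upwards [hG.eventually_nhds, hD, hFa] with w hw hDw hFw
    have hd := hFw.differentiableAt.hasDerivAt
    rw [EventuallyEq.deriv_eq hw]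
    refine (HasDerivAt.deriv ((((hd.const_mul a).add_const b).div
      ((hd.const_mul c).add_const d) hDw).congr_deriv ?_))
    congr 1; ring
  have hG'' : ∀ᶠ w in 𝓝 z, deriv (deriv G) w =
      (a * d - b * c) * (deriv (deriv F) w / (c * F w + d) ^ 2 -
        2 * c * deriv F w ^ 2 / (c * F w + d) ^ 3) := by
    filter_upwards [hG'.eventually_nhds, hD, hFa] with w hw hDw hFw
    have hd := hFw.differentiableAt.hasDerivAt
    have hd2 := hFw.deriv.differentiableAt.hasDerivAt
    rw [EventuallyEq.deriv_eq hw]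
    refine (HasDerivAt.deriv (((hd2.const_mul (a * d - b * c)).div
      (((hd.const_mul c).add_const d).pow 2) (pow_ne_zero 2 hDw)).congr_deriv ?_))
    simp only [Pi.pow_apply]
    field_simp
    ring
  have hN : ∀ᶠ w in 𝓝 z, deriv (deriv G) w / deriv G w =
      deriv (deriv F) w / deriv F w - 2 * c * deriv F w / (c * F w + d) := by
    filter_upwards [hG', hG'', hD, hF0] with w h1 h2 h3 h4
    rw [h1, h2]
    field_simp
  have hNF : DifferentiableAt ℂ (fun w => deriv (deriv F) w / deriv F w) z :=
    hF.deriv.deriv.differentiableAt.div hF.deriv.differentiableAt hF'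
  have hDz := hD.self_of_nhds
  have hd := hF.differentiableAt.hasDerivAt
  have hd2 := hF.deriv.differentiableAt.hasDerivAt
  unfold schwarzian
  rw [EventuallyEq.deriv_eq hN, hN.self_of_nhds]
  have key : HasDerivAt (fun w => deriv (deriv F) w / deriv F w - 2 * c * deriv F w / (c * F w + d))
      (deriv (fun w => deriv (deriv F) w / deriv F w) z -
        (2 * c * deriv (deriv F) z / (c * F z + d) -
          2 * c ^ 2 * deriv F z ^ 2 / (c * F z + d) ^ 2)) z := by
    refine hNF.hasDerivAt.sub (((hd2.const_mul (2 * c)).div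
      ((hd.const_mul c).add_const d) hDz).congr_deriv ?_)
    field_simp
  rw [key.deriv]
  field_simp
  ring

/-- The map to the Riemann sphere with homogeneous coordinates `y₁` and `y₂`. -/
def ratioMap (y₁ y₂ : ℂ → ℂ) (z : ℍ) : OnePoint ℂ :=
  if y₂ z = 0 then OnePoint.infty else ((y₁ z / y₂ z : ℂ) : OnePoint ℂ)

/-- A fundamental system of solutions of `y'' = q y` in the upper half-plane. -/
structure IsFundSys (q y₁ y₁' y₂ y₂' : ℂ → ℂ) : Prop where
  sol₁ : IsSol q uhp y₁ y₁'
  sol₂ : IsSol q uhp y₂ y₂'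
  wronskian : ∀ z ∈ uhp, y₁ z * y₂' z - y₁' z * y₂ z = 1

lemma analyticAt_of_hasDerivAt_uhp {y y' : ℂ → ℂ} (h : ∀ z ∈ uhp, HasDerivAt y (y' z) z) {z : ℂ}
    (hz : z ∈ uhp) : AnalyticAt ℂ y z :=
  DifferentiableOn.analyticAt (s := uhp)
    (fun w hw => (h w hw).differentiableAt.differentiableWithinAt) (isOpen_uhp.mem_nhds hz)

section FundSys

variable {q y₁ y₁' y₂ y₂' : ℂ → ℂ} (h : IsFundSys q y₁ y₁' y₂ y₂')
include h

lemma IsFundSys.locBihol : LocBihol (ratioMap y₁ y₂) := by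
  intro z
  have hz : (z : ℂ) ∈ uhp := z.im_pos
  have a1 := analyticAt_of_hasDerivAt_uhp (fun w hw => (h.sol₁ w hw).1) hz
  have a2 := analyticAt_of_hasDerivAt_uhp (fun w hw => (h.sol₂ w hw).1) hz
  have hW := h.wronskian z hz
  by_cases h2 : y₂ z = 0
  · have h1 : y₁ z ≠ 0 := by rintro h1; simp [h1, h2] at hW
    refine ⟨invMatrix, fun w => y₂ w / y₁ w, a2.div a1 h1, ?_, ?_⟩
    · have hd : HasDerivAt (fun w => y₂ w / y₁ w) _ (z : ℂ) :=
        (h.sol₂ z hz).1.div (h.sol₁ z hz).1 h1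
      rw [hd.deriv]
      refine div_ne_zero ?_ (pow_ne_zero _ h1)
      rw [show y₂' z * y₁ z - y₂ z * y₁' z = 1 by linear_combination hW]
      exact one_ne_zero
    · filter_upwards [eventually_coe_UHP.1 (a1.continuousAt.eventually_ne h1)] with w hw
      unfold ratioMap
      split_ifs with h0
      · rw [invMatrix_smul_infty, h0, zero_div]
      · rw [invMatrix_smul_coe _ (div_ne_zero hw h0), inv_div]
  · refine ⟨1, fun w => y₁ w / y₂ w, a1.div a2 h2, ?_, ?_⟩
    · have hd : HasDerivAt (fun w => y₁ w / y₂ w) _ (z : ℂ) :=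
        (h.sol₁ z hz).1.div (h.sol₂ z hz).1 h2
      rw [hd.deriv]
      refine div_ne_zero ?_ (pow_ne_zero _ h2)
      rw [show y₁' z * y₂ z - y₁ z * y₂' z = -1 by linear_combination -hW]
      exact neg_ne_zero.2 one_ne_zero
    · filter_upwards [eventually_coe_UHP.1 (a2.continuousAt.eventually_ne h2)] with w hw
      rw [one_smul]
      unfold ratioMap
      rw [if_neg hw]

/-- A locally injective function with Schwarzian derivative `-2 q` is a quotient of solutions. -/
lemma IsFundSys.exists_gl_eq {F : ℂ → ℂ} {z : ℍ} (hF : AnalyticAt ℂ F z) (hF' : deriv F z ≠ 0)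
    (hS : ∀ᶠ w in 𝓝 (z : ℂ), q w = -(schwarzian F w) / 2) :
    ∃ m : GL (Fin 2) ℂ, ∀ᶠ w : ℍ in 𝓝 z, (F (w : ℂ) : OnePoint ℂ) = m • ratioMap y₁ y₂ w := by
  have hz : (z : ℂ) ∈ uhp := z.im_pos
  have hev : ∀ᶠ w in 𝓝 (z : ℂ), AnalyticAt ℂ F w ∧ deriv F w ≠ 0 ∧
      q w = -(schwarzian F w) / 2 ∧ w ∈ uhp :=
    hF.eventually_analyticAt.and ((hF.deriv.continuousAt.eventually_ne hF').and
      (hS.and (isOpen_uhp.mem_nhds hz)))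
  obtain ⟨r, hr, hB⟩ := Metric.mem_nhds_iff.1 hev
  set B := Metric.ball (z : ℂ) r with hBdef
  have hzB : (z : ℂ) ∈ B := Metric.mem_ball_self hr
  have hBo : IsOpen B := Metric.isOpen_ball
  have hBc : IsPreconnected B := (convex_ball _ _).isPreconnected
  have hNd : ∀ w ∈ B, DifferentiableAt ℂ (fun w => deriv (deriv F) w / deriv F w) w := fun w hw =>
    ((hB hw).1.deriv.deriv.differentiableAt).div (hB hw).1.deriv.differentiableAt (hB hw).2.1
  obtain ⟨L, hL⟩ := DifferentiableOn.isExactOn_ball (c := (z : ℂ)) (r := r)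
    (fun w hw => (hNd w hw).differentiableWithinAt)
  set N : ℂ → ℂ := fun w => deriv (deriv F) w / deriv F w with hN
  set u : ℂ → ℂ := fun w => Complex.exp (-(L w) / 2) with hu
  have hu0 : ∀ w, u w ≠ 0 := fun w => Complex.exp_ne_zero _
  have hud : ∀ w ∈ B, HasDerivAt u (-(N w) / 2 * u w) w := by
    intro w hw
    have := (((hL w hw).neg).div_const 2).cexp
    refine this.congr_deriv ?_
    simp only [hu, Pi.neg_apply]; ring
  have hud2 : ∀ w ∈ B, HasDerivAt (fun w => -(N w) / 2 * u w) (q w * u w) w := by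
    intro w hw
    refine ((((hNd w hw).hasDerivAt.neg).div_const 2).mul (hud w hw)).congr_deriv ?_
    rw [(hB hw).2.2.1]
    unfold schwarzian
    simp only [hN, Pi.neg_apply]
    ring
  have hsolu : IsSol q B u (fun w => -(N w) / 2 * u w) := fun w hw => ⟨hud w hw, hud2 w hw⟩
  have hsolv : IsSol q B (fun w => F w * u w)
      (fun w => deriv F w * u w + F w * (-(N w) / 2 * u w)) := by
    intro w hw
    have hd := (hB hw).1.differentiableAt.hasDerivAt
    have hd2 := (hB hw).1.deriv.differentiableAt.hasDerivAt
    refine ⟨hd.mul (hud w hw), ?_⟩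
    refine ((hd2.mul (hud w hw)).add (hd.mul (hud2 w hw))).congr_deriv ?_
    have h0 := (hB hw).2.1
    have : deriv F w * N w = deriv (deriv F) w := by simp only [hN]; field_simp
    linear_combination (-(u w)) * this
  have hBU : B ⊆ uhp := fun w hw => (hB hw).2.2.2
  have hWB : ∀ w ∈ B, y₁ w * y₂' w - y₁' w * y₂ w = 1 := fun w hw => h.wronskian w (hBU hw)
  obtain ⟨c, d, hcd⟩ := IsSol.eq_linear hBo hBc (h.sol₁.mono hBU) (h.sol₂.mono hBU) hWB hsolu hzB
  obtain ⟨a, b, hab⟩ := IsSol.eq_linear hBo hBc (h.sol₁.mono hBU) (h.sol₂.mono hBU) hWB hsolv hzB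
  have hdet : a * d - b * c ≠ 0 := by
    have e : a * d - b * c = -(deriv F z) * u z ^ 2 := by
      have h1 := hcd z hzB
      have h2 := hab z hzB
      have h3 := hWB z hzB
      have e1 : (F z * u z) * (-(N z) / 2 * u z) -
          (deriv F z * u z + F z * (-(N z) / 2 * u z)) * u z = -(deriv F z) * u z ^ 2 := by ring
      rw [← e1, h2.1, h2.2, h1.2, h1.1]
      linear_combination (-(a * d - b * c)) * h3
    rw [e]
    exact mul_ne_zero (neg_ne_zero.2 hF') (pow_ne_zero _ (hu0 _))
  refine ⟨Matrix.GeneralLinearGroup.mkOfDetNeZero !![a, b; c, d]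
    (by rw [Matrix.det_fin_two]; simpa using hdet), ?_⟩
  have hBz : ∀ᶠ w : ℂ in 𝓝 (z : ℂ), w ∈ B := hBo.mem_nhds hzB
  filter_upwards [eventually_coe_UHP.1 hBz] with w hw
  have h1 := (hcd w hw).1
  have h2 := (hab w hw).1
  have hFw : F w = (a * y₁ w + b * y₂ w) / (c * y₁ w + d * y₂ w) := by
    rw [← h1, ← h2]; field_simp [hu0 w]
  have hden : c * y₁ w + d * y₂ w ≠ 0 := by rw [← h1]; exact hu0 _
  unfold ratioMap
  split_ifs with h0
  · have hc0 : c ≠ 0 := by rintro rfl; simp [h0] at hden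
    have hy0 : y₁ w ≠ 0 := by intro h; simp [h0, h] at hden
    rw [OnePoint.smul_infty_eq_ite, hFw, h0]
    simp [Matrix.GeneralLinearGroup.mkOfDetNeZero, hc0]
    field_simp
  · have hden2 : c * (y₁ w / y₂ w) + d ≠ 0 := by
      intro h
      apply hden
      field_simp at h
      linear_combination h
    rw [gl_smul_coe']
    · simp [Matrix.GeneralLinearGroup.mkOfDetNeZero]
      rw [hFw]
      field_simp
    · simpa [Matrix.GeneralLinearGroup.mkOfDetNeZero] using hden2

/-- A bounded Schwarzian derivative forces uniform local injectivity. -/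
lemma IsFundSys.uniformly_injective {C : ℝ} (hC : ∀ z : ℍ, ‖q z‖ * z.im ^ 2 ≤ C) :
    ∃ ρ > 0, ∀ z w : ℍ, dist (z : ℂ) w < ρ * z.im → ratioMap y₁ y₂ z = ratioMap y₁ y₂ w → z = w := by
  have hC0 : 0 ≤ C := le_trans (by positivity) (hC UpperHalfPlane.I)
  obtain ⟨ρ, hρ0, hρ1, hρ2⟩ : ∃ ρ : ℝ, 0 < ρ ∧ ρ ≤ 1 / 2 ∧ 8 * C * ρ ^ 2 < 1 := by
    refine ⟨1 / (8 * C + 2), by positivity, ?_, ?_⟩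
    · rw [div_le_div_iff₀ (by positivity) (by norm_num)]; linarith
    · rw [div_pow, one_pow, mul_one_div, div_lt_one (by positivity)]; nlinarith
  refine ⟨ρ, hρ0, fun z w hd hzw => ?_⟩
  by_contra hne
  have hne' : (z : ℂ) ≠ w := fun h => hne (UpperHalfPlane.coe_injective h)
  have hzy : 0 < z.im := z.im_pos
  have hzwn : ‖(w : ℂ) - z‖ < ρ * z.im := by rwa [← dist_eq_norm, dist_comm]
  have hseg : ∀ t ∈ Icc (0 : ℝ) 1, z.im / 2 ≤ ((z : ℂ) + t * ((w : ℂ) - z)).im := by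
    intro t ht
    have h1 : |((w : ℂ) - z).im| ≤ ρ * z.im := (Complex.abs_im_le_norm _).trans hzwn.le
    have h2 : ((z : ℂ) + t * ((w : ℂ) - z)).im = z.im + t * ((w : ℂ) - z).im := by
      simp
    rw [h2]
    have h3 := abs_le.1 h1
    have h4 : ρ * z.im ≤ z.im / 2 := by nlinarith
    have h5 : -(z.im / 2) ≤ ((w : ℂ) - z).im := by linarith
    nlinarith [ht.1, ht.2]
  have hsegU : ∀ t ∈ Icc (0 : ℝ) 1, (z : ℂ) + t * ((w : ℂ) - z) ∈ uhp := fun t ht =>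
    lt_of_lt_of_le (by positivity) (hseg t ht)
  have hqK : ∀ t ∈ Icc (0 : ℝ) 1, ‖q ((z : ℂ) + t * ((w : ℂ) - z))‖ ≤ 4 * C / z.im ^ 2 := by
    intro t ht
    have h1 := hC ⟨_, hsegU t ht⟩
    have h2 := hseg t ht
    set p := (z : ℂ) + t * ((w : ℂ) - z)
    have h3 : ‖q p‖ * p.im ^ 2 ≤ C := h1
    rw [le_div_iff₀ (by positivity)]
    have h4 : (z.im / 2) ^ 2 ≤ p.im ^ 2 := by gcongr
    nlinarith [norm_nonneg (q p)]
  have hKb : 2 * (4 * C / z.im ^ 2) * ‖(w : ℂ) - z‖ ^ 2 < 1 := by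
    have h1 : ‖(w : ℂ) - z‖ ^ 2 ≤ (ρ * z.im) ^ 2 := by gcongr
    calc 2 * (4 * C / z.im ^ 2) * ‖(w : ℂ) - z‖ ^ 2 ≤ 2 * (4 * C / z.im ^ 2) * (ρ * z.im) ^ 2 := by
          gcongr
      _ = 8 * C * ρ ^ 2 := by field_simp; ring
      _ < 1 := hρ2
  have hsol := h.sol₁.linear h.sol₂ (y₂ w) (-(y₁ w))
  have e : y₂ w * y₁ z + -(y₁ w) * y₂ z = 0 := by
    unfold ratioMap at hzw
    split_ifs at hzw with h1 h2 h2
    · rw [h1, h2]; ring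
    · exact absurd hzw (OnePoint.infty_ne_coe _)
    · exact absurd hzw (OnePoint.coe_ne_infty _)
    · have := OnePoint.coe_injective hzw
      field_simp at this
      linear_combination this
  have hd0 := hsol.deriv_eq_zero hsegU hqK hKb e (by ring) hne'
  have hW := h.wronskian z z.im_pos
  have hWw := h.wronskian w w.im_pos
  have h1 : y₂ w = 0 := by
    linear_combination (y₂' z) * e - (y₂ z) * hd0 - (y₂ w) * hW
  have h2 : y₁ w = 0 := by
    linear_combination (y₁' z) * e - (y₁ z) * hd0 - (y₁ w) * hW
  simp [h1, h2] at hWw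

end FundSys

end

section

/-! ### The developing map on the hyperbolic plane -/

lemma analyticAt_schwarzian {F : ℂ → ℂ} {z : ℂ} (hF : AnalyticAt ℂ F z) (hF' : deriv F z ≠ 0) :
    AnalyticAt ℂ (schwarzian F) z := by
  have h1 : AnalyticAt ℂ (fun w => deriv (deriv F) w / deriv F w) z :=
    hF.deriv.deriv.div hF.deriv hF'
  have h2 : AnalyticAt ℂ (fun w => deriv (fun w => deriv (deriv F) w / deriv F w) w -
      (deriv (deriv F) w / deriv F w) ^ 2 / 2) z :=
    h1.deriv.sub ((h1.pow 2).div analyticAt_const two_ne_zero)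
  exact h2

lemma isLiftAt_iff {Γ : Subgroup SL(2, ℝ)} {φ : Orbifold Γ → OnePoint ℂ} {F : ℂ → ℂ} {z : ℍ} :
    IsLiftAt φ F z ↔ ∃ g : GL (Fin 2) ℂ, ∀ᶠ w : ℍ in 𝓝 z,
      (F (w : ℂ) : OnePoint ℂ) = g • φ (proj Γ w) := by
  unfold IsLiftAt
  simp only [eventually_coe_UHP, UpperHalfPlane.ofComplex_apply]

lemma IsLiftAt.eventually {Γ : Subgroup SL(2, ℝ)} {φ : Orbifold Γ → OnePoint ℂ} {F : ℂ → ℂ} {z : ℍ}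
    (h : IsLiftAt φ F z) : ∀ᶠ w : ℍ in 𝓝 z, IsLiftAt φ F w := by
  obtain ⟨g, hg⟩ := isLiftAt_iff.1 h
  filter_upwards [hg.eventually_nhds] with w hw using isLiftAt_iff.2 ⟨g, hw⟩

lemma exists_removable_extension {f : ℂ → ℂ} {S : Set ℂ} {C : ℝ}
    (hS : ∀ z ∈ uhp, ∀ᶠ w in 𝓝[≠] z, w ∉ S) (hf : ∀ z ∈ uhp, z ∉ S → DifferentiableAt ℂ f z)
    (hC : ∀ z ∈ uhp, z ∉ S → ‖f z‖ * z.im ^ 2 ≤ C) :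
    ∃ X : ℂ → ℂ, DifferentiableOn ℂ X uhp ∧ (∀ z ∈ uhp, z ∉ S → X z = f z) ∧
      ∀ z ∈ uhp, ‖X z‖ * z.im ^ 2 ≤ C := by
  set X : ℂ → ℂ := fun z => limUnder (𝓝[≠] z) f with hX
  have hXf : ∀ z ∈ uhp, z ∉ S → X z = f z := fun z hz hzS =>
    ((hf z hz hzS).continuousAt.tendsto.mono_left nhdsWithin_le_nhds).limUnder_eq
  have hd : ∀ z ∈ uhp, DifferentiableAt ℂ X z := by
    intro z hz
    have hz' : 0 < z.im := hz
    have h1 : ∀ᶠ w in 𝓝 z, w ∈ uhp ∧ z.im / 2 < w.im ∧ (w ≠ z → w ∉ S) := by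
      refine Eventually.and (isOpen_uhp.mem_nhds hz)
        (Eventually.and ?_ (eventually_nhdsWithin_iff.1 (hS z hz)))
      exact (isOpen_lt continuous_const Complex.continuous_im).mem_nhds
        (show z.im / 2 < z.im by linarith)
    have h2 := Complex.differentiableOn_update_limUnder_of_bddAbove (f := f) h1
      (fun w hw => (hf w hw.1.1 (hw.1.2.2 hw.2)).differentiableWithinAt) (by
        refine ⟨C / (z.im / 2) ^ 2, ?_⟩
        rintro _ ⟨w, hw, rfl⟩
        have h3 := hC w hw.1.1 (hw.1.2.2 hw.2)
        rw [le_div_iff₀ (by positivity)]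
        refine le_trans ?_ h3
        have h4 := hw.1.2.1.le
        simp only [Function.comp_apply]
        gcongr)
    have h3 := (h2 z (mem_of_mem_nhds h1)).differentiableAt h1
    refine h3.congr_of_eventuallyEq ?_
    filter_upwards [h1] with w hw
    by_cases hwz : w = z
    · subst hwz; simp [hX]
    · rw [Function.update_of_ne hwz]
      exact hXf w hw.1 (hw.2.2 hwz)
  refine ⟨X, fun z hz => (hd z hz).differentiableWithinAt, hXf, fun z hz => ?_⟩
  have hc : Tendsto (fun w => ‖X w‖ * w.im ^ 2) (𝓝[≠] z) (𝓝 (‖X z‖ * z.im ^ 2)) := by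
    refine Tendsto.mono_left ?_ nhdsWithin_le_nhds
    exact ((hd z hz).continuousAt.norm.mul (Complex.continuous_im.continuousAt.pow 2)).tendsto
  refine le_of_tendsto hc ?_
  filter_upwards [hS z hz, nhdsWithin_le_nhds (isOpen_uhp.mem_nhds hz)] with w hw hwU
  rw [hXf w hwU hw]
  exact hC w hwU hw

section

variable {Γ : Subgroup SL(2, ℝ)} (P : SingularProjectiveStructure Γ)

lemma SingularProjectiveStructure.deriv_lift_ne_zero [DiscreteTopology Γ]
    {φ : OpenPartialHomeomorph (Orbifold Γ) (OnePoint ℂ)} (hφ : φ ∈ P.atlas) {z : ℍ}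
    (hz : proj Γ z ∈ φ.source) {F : ℂ → ℂ} (hF : AnalyticAt ℂ F z) (hl : IsLiftAt φ F z) :
    deriv F z ≠ 0 := by
  obtain ⟨g, hg⟩ := isLiftAt_iff.1 hl
  obtain ⟨N, hN, hinj⟩ := exists_injOn_proj Γ
    (fun h => P.source_subset φ hφ hz (P.conePoints_subset h))
  have hM : ∀ᶠ w : ℍ in 𝓝 z, w ∈ N ∧ proj Γ w ∈ φ.source ∧
      (F (w : ℂ) : OnePoint ℂ) = g • φ (proj Γ w) :=
    Eventually.and hN ((((continuous_proj Γ).continuousAt).eventually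
      (φ.open_source.mem_nhds hz)).and hg)
  refine deriv_ne_zero_of_injOn (N := ((↑) : ℍ → ℂ) '' {w | w ∈ N ∧ proj Γ w ∈ φ.source ∧
      (F (w : ℂ) : OnePoint ℂ) = g • φ (proj Γ w)}) hF ?_ ?_
  · rw [nhds_coe_UHP]; exact image_mem_map hM
  · rintro _ ⟨a, ⟨ha1, ha2, ha3⟩, rfl⟩ _ ⟨b, ⟨hb1, hb2, hb3⟩, rfl⟩ hab
    have h1 : φ (proj Γ a) = φ (proj Γ b) := smul_left_cancel g (by rw [← ha3, ← hb3, hab])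
    rw [hinj ha1 hb1 (φ.injOn ha2 hb2 h1)]

lemma SingularProjectiveStructure.lift_transition
    {φ ψ : OpenPartialHomeomorph (Orbifold Γ) (OnePoint ℂ)} (hφ : φ ∈ P.atlas) (hψ : ψ ∈ P.atlas)
    {z : ℍ} (hz : proj Γ z ∈ φ.source) (hz' : proj Γ z ∈ ψ.source) {F G : ℂ → ℂ}
    (hF : IsLiftAt φ F z) (hG : IsLiftAt ψ G z) :
    ∃ g : GL (Fin 2) ℂ, ∀ᶠ w in 𝓝 (z : ℂ), (G w : OnePoint ℂ) = g • (F w : OnePoint ℂ) := by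
  obtain ⟨g₁, hg₁⟩ := isLiftAt_iff.1 hF
  obtain ⟨g₂, hg₂⟩ := isLiftAt_iff.1 hG
  obtain ⟨g, hg⟩ := P.moebius_transition φ hφ ψ hψ _ hz hz'
  refine ⟨g₂ * g * g₁⁻¹, ?_⟩
  rw [eventually_coe_UHP]
  filter_upwards [hg₁, hg₂, (continuous_proj Γ).continuousAt.eventually hg] with w h1 h2 h3
  rw [h1, h2, h3, ← mul_smul, ← mul_smul]
  simp

/-- A bounded singular projective structure has a developing map on the whole hyperbolic plane. -/
theorem SingularProjectiveStructure.exists_locBihol [DiscreteTopology Γ] (hP : P.IsBounded) :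
    ∃ F : ℍ → OnePoint ℂ, LocBihol F ∧
      (∃ ρ > 0, ∀ z w : ℍ, dist (z : ℂ) w < ρ * z.im → F z = F w → z = w) ∧
      ∀ φ ∈ P.atlas, ∀ z : ℍ, proj Γ z ∈ φ.source →
        ∃ g : GL (Fin 2) ℂ, ∀ᶠ w in 𝓝 z, F w = g • φ (proj Γ w) := by
  classical
  obtain ⟨C, hC⟩ := hP
  have hex : ∀ z : ℍ, proj Γ z ∉ P.sing → ∃ φ ∈ P.atlas, proj Γ z ∈ φ.source ∧
      ∃ F : ℂ → ℂ, AnalyticAt ℂ F z ∧ IsLiftAt φ F z := by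
    intro z hz
    obtain ⟨φ, hφ, hzφ⟩ := P.exists_chart _ hz
    exact ⟨φ, hφ, hzφ, P.holomorphic φ hφ z hzφ⟩
  choose! φ₀ hφ₀ hzφ₀ F₀ hF₀ hl₀ using hex
  set xi : ℂ → ℂ := fun w => schwarzian (F₀ (UpperHalfPlane.ofComplex w)) w with hxi
  have hxi_eq : ∀ φ ∈ P.atlas, ∀ z : ℍ, proj Γ z ∈ φ.source → ∀ F : ℂ → ℂ, AnalyticAt ℂ F z →
      IsLiftAt φ F z → ∀ᶠ w in 𝓝 (z : ℂ), xi w = schwarzian F w := by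
    intro φ hφ z hz F hF hl
    have hd := P.deriv_lift_ne_zero hφ hz hF hl
    rw [eventually_coe_UHP]
    filter_upwards [eventually_coe_UHP.1 hF.eventually_analyticAt, hl.eventually,
      eventually_coe_UHP.1 (hF.deriv.continuousAt.eventually_ne hd),
      (continuous_proj Γ).continuousAt.eventually (φ.open_source.mem_nhds hz)] with w h1 h2 h3 h4
    have hw := P.source_subset φ hφ h4
    simp only [hxi, UpperHalfPlane.ofComplex_apply]
    obtain ⟨g, hg⟩ := P.lift_transition hφ (hφ₀ w hw) h4 (hzφ₀ w hw) h2 (hl₀ w hw)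
    exact schwarzian_gl_smul h1 h3 g hg
  have hxid : ∀ z : ℍ, proj Γ z ∉ P.sing → DifferentiableAt ℂ xi z := by
    intro z hz
    have h1 := hxi_eq _ (hφ₀ z hz) z (hzφ₀ z hz) _ (hF₀ z hz) (hl₀ z hz)
    refine DifferentiableAt.congr_of_eventuallyEq ?_ h1
    exact (analyticAt_schwarzian (hF₀ z hz)
      (P.deriv_lift_ne_zero (hφ₀ z hz) (hzφ₀ z hz) (hF₀ z hz) (hl₀ z hz))).differentiableAt
  set S : Set ℂ := ((↑) : ℍ → ℂ) '' (proj Γ ⁻¹' P.sing) with hS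
  have hmem : ∀ z : ℍ, (z : ℂ) ∈ S ↔ proj Γ z ∈ P.sing := fun z =>
    ⟨fun ⟨w, hw, hwz⟩ => UpperHalfPlane.coe_injective hwz ▸ hw, fun h => ⟨z, h, rfl⟩⟩
  obtain ⟨X, hXd, hXf, hXC⟩ := exists_removable_extension (f := xi) (S := S) (C := C)
    (fun z hz => by
      lift z to ℍ using hz
      rw [eventually_nhdsWithin_iff, eventually_coe_UHP]
      filter_upwards [eventually_nhdsWithin_iff.1
        (eventually_proj_notMem Γ P.isClosed_sing P.discrete_sing z)] with w hw hne
      rw [hmem]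
      exact hw fun h => hne (by rw [show w = z from h]; rfl))
    (fun z hz hzS => by
      lift z to ℍ using hz
      exact hxid z (fun h => hzS ((hmem z).2 h)))
    (fun z hz hzS => by
      lift z to ℍ using hz
      have hz' : proj Γ z ∉ P.sing := fun h => hzS ((hmem z).2 h)
      have := hC _ (hφ₀ z hz') z (hzφ₀ z hz') _ (hl₀ z hz')
      simpa [hxi] using this)
  obtain ⟨y₁, y₁', y₂, y₂', h1, h2, h3⟩ := exists_isSol_uhp (q := fun z => -(X z) / 2)
    (hXd.neg.div_const 2)
  have hsys : IsFundSys (fun z => -(X z) / 2) y₁ y₁' y₂ y₂' := ⟨h1, h2, h3⟩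
  refine ⟨ratioMap y₁ y₂, hsys.locBihol, ?_, ?_⟩
  · refine hsys.uniformly_injective (C := C) fun z => ?_
    have h4 := hXC z z.im_pos
    have h5 : ‖-(X z) / 2‖ ≤ ‖X z‖ := by
      rw [norm_div, norm_neg]
      simp only [Complex.norm_ofNat]
      linarith [norm_nonneg (X z)]
    refine le_trans ?_ h4
    have : (z : ℂ).im = z.im := rfl
    rw [this]
    gcongr
  · intro φ hφ z hz
    obtain ⟨G, hG, hl⟩ := P.holomorphic φ hφ z hz
    have hd := P.deriv_lift_ne_zero hφ hz hG hl
    have hsrc : ∀ᶠ w : ℍ in 𝓝 z, proj Γ w ∈ φ.source :=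
      (continuous_proj Γ).continuousAt.eventually (φ.open_source.mem_nhds hz)
    obtain ⟨m, hm⟩ := hsys.exists_gl_eq hG hd (by
      have h4 := hxi_eq φ hφ z hz G hG hl
      rw [eventually_coe_UHP] at h4 ⊢
      filter_upwards [h4, hsrc] with w hw hw2
      rw [hXf w w.im_pos (fun h => P.source_subset φ hφ hw2 ((hmem w).1 h)), hw])
    obtain ⟨g, hg⟩ := isLiftAt_iff.1 hl
    refine ⟨m⁻¹ * g, ?_⟩
    filter_upwards [hm, hg] with w h4 h5
    rw [mul_smul, ← h5, h4, inv_smul_smul]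

end

end

section

/-! ### The developing map on the hyperbolic plane -/

lemma isPreconnected_punctured_ball (z : ℂ) (r : ℝ) :
    IsPreconnected {w : ℂ | w ≠ z ∧ dist w z < r} := by
  rcases le_or_gt r 0 with hr | hr
  · convert isPreconnected_empty
    ext w
    simp only [mem_ofPred_eq, mem_empty_iff_false, iff_false, not_and, not_lt]
    exact fun _ => hr.trans dist_nonneg
  have h : {w : ℂ | w ≠ z ∧ dist w z < r} =
      (fun s => z + Complex.exp s) '' {s : ℂ | s.re < Real.log r} := by
    ext w
    constructor
    · rintro ⟨hw, hd⟩
      have hw' : w - z ≠ 0 := sub_ne_zero.2 hw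
      refine ⟨Complex.log (w - z), ?_, by simp [Complex.exp_log hw']⟩
      rw [mem_ofPred_eq, Complex.log_re]
      exact Real.log_lt_log (norm_pos_iff.2 hw') (by rwa [dist_eq_norm] at hd)
    · rintro ⟨s, hs, rfl⟩
      refine ⟨by simp [Complex.exp_ne_zero], ?_⟩
      rw [dist_eq_norm, add_sub_cancel_left, Complex.norm_exp]
      exact (Real.lt_log_iff_exp_lt hr).1 hs
  rw [h]
  refine ((convex_halfSpace_re_lt _).isPreconnected).image _ (by fun_prop)

lemma exists_punctured_nhds {z : ℍ} {U : Set ℍ} (hU : U ∈ 𝓝 z) :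
    ∃ N ∈ 𝓝 z, N ⊆ U ∧ IsPreconnected (N \ {z}) ∧ (N \ {z}).Nonempty := by
  have h1 : ((↑) : ℍ → ℂ) '' U ∈ 𝓝 (z : ℂ) := by
    rw [nhds_coe_UHP]; exact image_mem_map hU
  obtain ⟨r, hr, hrU⟩ := Metric.mem_nhds_iff.1 h1
  have hN : ((↑) : ℍ → ℂ) ⁻¹' Metric.ball (z : ℂ) r ∈ 𝓝 z :=
    UpperHalfPlane.continuous_coe.continuousAt.preimage_mem_nhds (Metric.ball_mem_nhds _ hr)
  refine ⟨_, hN, ?_, ?_, ?_⟩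
  · intro w hw
    obtain ⟨u, hu, huw⟩ := hrU hw
    rwa [← UpperHalfPlane.coe_injective huw]
  · have h2 : ((↑) : ℍ → ℂ) ⁻¹' Metric.ball (z : ℂ) r \ {z} =
        ((↑) : ℍ → ℂ) ⁻¹' {w : ℂ | w ≠ z ∧ dist w z < r} := by
      ext w
      rw [Set.mem_sdiff, mem_preimage, mem_preimage, Metric.mem_ball, mem_singleton_iff, and_comm,
        ← UpperHalfPlane.coe_inj]
      rfl
    rw [h2]
    refine (isPreconnected_punctured_ball (z : ℂ) r).preimage_of_isOpenMap
      UpperHalfPlane.coe_injective UpperHalfPlane.isOpenEmbedding_coe.isOpenMap ?_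
    rintro w ⟨-, hw⟩
    obtain ⟨u, -, hu⟩ := hrU hw
    exact ⟨u, hu⟩
  · obtain ⟨w, hw, hwz⟩ := ((eventually_nhdsWithin_of_eventually_nhds hN).and
      (self_mem_nhdsWithin (s := ({z}ᶜ : Set ℍ)))).exists
    exact ⟨w, hw, hwz⟩

lemma LocBihol.isLocallyInjective {F : ℍ → OnePoint ℂ} (hF : LocBihol F) :
    IsLocallyInjective F := by
  rw [isLocallyInjective_iff_nhds]
  exact hF.exists_injOn

lemma LocBihol.eqOn_of_comp_eqOn {F : ℍ → OnePoint ℂ} (hF : LocBihol F) {A : Type*}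
    [TopologicalSpace A] {s : Set A} {g₁ g₂ : A → ℍ}
    (hs : IsPreconnected s) (h₁ : ContinuousOn g₁ s) (h₂ : ContinuousOn g₂ s)
    (he : ∀ a ∈ s, F (g₁ a) = F (g₂ a)) {a : A} (ha : a ∈ s) (h : g₁ a = g₂ a) :
    EqOn g₁ g₂ s :=
  (T2Space.isSeparatedMap F).eqOn_of_comp_eqOn hF.isLocallyInjective hs h₁ h₂ he ha h

lemma IsCoveringMapOn.exists_section {E X : Type*} [TopologicalSpace E] [TopologicalSpace X]
    [LocallyConnectedSpace X] {f : E → X} {s : Set X} (hf : IsCoveringMapOn f s) {y : X}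
    (hy : y ∈ s) {U : Set X} (hU : U ∈ 𝓝 y) :
    ∃ V, V ⊆ U ∧ IsOpen V ∧ y ∈ V ∧ IsPreconnected V ∧ ∀ e, f e ∈ V →
      ∃ σ : X → E, ContinuousOn σ V ∧ (∀ v ∈ V, f (σ v) = v) ∧ σ (f e) = e := by
  have hev := hf y hy
  by_cases hI : Nonempty (f ⁻¹' {y})
  · let t := hev.toTrivialization
    have hb : y ∈ t.baseSet := hev.mem_toTrivialization_baseSet
    obtain ⟨V, hVU, hVo, hyV, hVc⟩ := locallyConnectedSpace_iff_subsets_isOpen_isConnected.1 ‹_›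
      y (U ∩ t.baseSet) (inter_mem hU (t.open_baseSet.mem_nhds hb))
    refine ⟨V, hVU.trans inter_subset_left, hVo, hyV, hVc.isPreconnected, fun e he => ?_⟩
    have het : f e ∈ t.baseSet := (hVU he).2
    have htt : ∀ v ∈ V, (v, (t e).2) ∈ t.target := fun v hv => t.mem_target.2 (hVU hv).2
    refine ⟨fun v => t.toOpenPartialHomeomorph.symm (v, (t e).2), ?_, ?_, ?_⟩
    · exact t.toOpenPartialHomeomorph.continuousOn_symm.comp (by fun_prop) htt
    · intro v hv
      exact t.proj_symm_apply (htt v hv)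
    · have h1 : t e = (f e, (t e).2) := Prod.ext (t.coe_fst' het) rfl
      change t.toOpenPartialHomeomorph.symm (f e, (t e).2) = e
      rw [← h1]
      exact t.toOpenPartialHomeomorph.left_inv (t.mem_source.2 het)
  · obtain ⟨-, W, hyW, hWo, -, H, hH⟩ := hev
    have hemp : ∀ e, f e ∉ W := fun e he => hI ⟨(H ⟨e, he⟩).2⟩
    obtain ⟨V, hVU, hVo, hyV, hVc⟩ := locallyConnectedSpace_iff_subsets_isOpen_isConnected.1 ‹_›
      y (U ∩ W) (inter_mem hU (hWo.mem_nhds hyW))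
    exact ⟨V, hVU.trans inter_subset_left, hVo, hyV, hVc.isPreconnected,
      fun e he => absurd (hVU he).2 (hemp e)⟩

instance : LocallyPathConnectedSpace (OnePoint ℂ) := by
  let f : ℂ ⊕ ℂ → OnePoint ℂ := Sum.elim (fun z => (z : OnePoint ℂ)) fun z => invMatrix • (z : OnePoint ℂ)
  have ho : IsOpenMap f := by
    refine isOpenMap_sum.2 ⟨OnePoint.isOpenEmbedding_coe.isOpenMap, ?_⟩
    exact (isOpenMap_smul invMatrix).comp OnePoint.isOpenEmbedding_coe.isOpenMap
  have hc : Continuous f := by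
    refine continuous_sum_dom.2 ⟨OnePoint.continuous_coe, ?_⟩
    exact (continuous_gl_smul invMatrix).comp OnePoint.continuous_coe
  refine (IsOpenQuotientMap.isQuotientMap ⟨?_, hc, ho⟩).locallyPathConnectedSpace
  intro x
  induction x using OnePoint.rec with
  | infty => exact ⟨Sum.inr 0, invMatrix_smul_zero⟩
  | coe z => exact ⟨Sum.inl z, rfl⟩

instance : SimplyConnectedSpace unitInterval :=
  have : ContractibleSpace unitInterval := (convex_Icc (0:ℝ) 1).contractibleSpace ⟨0, by simp⟩
  inferInstance

instance : LocallyPathConnectedSpace unitInterval :=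
  (convex_Icc (0:ℝ) 1).locallyPathConnectedSpace

variable {Γ : Subgroup SL(2, ℝ)} 

lemma exists_gl_smul_of_mem [DiscreteTopology Γ] (P : SingularProjectiveStructure Γ)
    {F : ℍ → OnePoint ℂ} (hF : LocBihol F)
    (hFP : ∀ φ ∈ P.atlas, ∀ z : ℍ, proj Γ z ∈ φ.source →
        ∃ g : GL (Fin 2) ℂ, ∀ᶠ w in 𝓝 z, F w = g • φ (proj Γ w)) {γ : SL(2, ℝ)} (hγ : γ ∈ Γ) :
    ∃ m : GL (Fin 2) ℂ, ∀ z, F (γ • z) = m • F z := by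
  obtain ⟨z, hz⟩ := (isPathConnected_compl_of_discrete
    (eventually_proj_notMem Γ P.isClosed_sing P.discrete_sing)).nonempty
  obtain ⟨φ, hφ, hzφ⟩ := P.exists_chart _ hz
  obtain ⟨g, hg⟩ := hFP φ hφ z hzφ
  obtain ⟨g', hg'⟩ := hFP φ hφ (γ • z) (by rwa [proj_smul Γ hγ])
  refine ⟨g' * g⁻¹, congrFun ((hF.comp_smul γ).eq_of_eventuallyEq (hF.smul (g' * g⁻¹)) (z := z) ?_)⟩
  have hc : Continuous fun w : ℍ => γ • w := continuous_const_smul γ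
  filter_upwards [hg, hc.continuousAt.eventually hg'] with w hw hw'
  rw [hw', proj_smul Γ hγ, hw, mul_smul, inv_smul_smul]

/-- The lift of a covering of the regular part of `ℍ / Γ` to `ℍ`. -/
lemma exists_lift_to_uhp [DiscreteTopology Γ] {A : Set (Orbifold Γ)} (hAc : IsClosed A)
    (hAd : DiscreteTopology A) (hA : conePoints Γ ⊆ A) {E : Type} [TopologicalSpace E]
    [SimplyConnectedSpace E] [LocallyPathConnectedSpace E] {p : E → (Aᶜ : Set (Orbifold Γ))}
    (hp : IsCoveringMap p) :
    ∃ h : C(E, ℍ), (∀ e, proj Γ (h e) = p e) ∧ (∀ e, map h (𝓝 e) = 𝓝 (h e)) ∧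
      ∀ z, proj Γ z ∉ A → z ∈ range h := by
  have hcov := isCoveringMapOn_proj Γ hAc hA
  obtain ⟨e₀⟩ : Nonempty E := inferInstance
  obtain ⟨z₀, hz₀⟩ := proj_surjective Γ (p e₀ : Orbifold Γ)
  obtain ⟨h, ⟨hh₀, hh⟩, -⟩ := hcov.existsUnique_continuousMap_lifts
    (f := ⟨fun e => (p e : Orbifold Γ), continuous_subtype_val.comp hp.continuous⟩)
    (a₀ := e₀) (e₀ := z₀) hz₀ (fun e => (p e).2)
  have hh : ∀ e, proj Γ (h e) = p e := congrFun hh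
  refine ⟨h, hh, ?_, ?_⟩
  · intro e
    have h1 : map (fun e => (p e : Orbifold Γ)) (𝓝 e) = 𝓝 (p e : Orbifold Γ) := by
      rw [← hAc.isOpen_compl.isOpenEmbedding_subtypeVal.map_nhds_eq,
        ← hp.isLocalHomeomorph.map_nhds_eq, map_map]
      rfl
    refine le_antisymm h.continuous.continuousAt ?_
    obtain ⟨N, hN, hinj⟩ := exists_injOn_proj Γ (z := h e) (fun hc => (p e).2 (hA (hh e ▸ hc)))
    intro U hU
    have h2 : U ∈ map h (𝓝 e) := hU
    have h3 : proj Γ '' (h '' (h ⁻¹' (U ∩ N))) ∈ 𝓝 (p e : Orbifold Γ) := by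
      rw [← h1, image_image]
      simp only [hh]
      refine image_mem_map ?_
      exact inter_mem hU (h.continuous.continuousAt.preimage_mem_nhds hN)
    have h4 : proj Γ ⁻¹' (proj Γ '' (h '' (h ⁻¹' (U ∩ N)))) ∈ 𝓝 (h e) :=
      (continuous_proj Γ).continuousAt.preimage_mem_nhds (by rwa [hh])
    filter_upwards [h4, hN] with w hw hwN
    obtain ⟨_, ⟨e', he', rfl⟩, hw2⟩ := hw
    rw [← hinj he'.2 hwN hw2]
    exact he'.1
  · intro z hz
    obtain ⟨γ, hγ⟩ := (isPathConnected_compl_of_discrete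
      (eventually_proj_notMem Γ hAc hAd)).joinedIn z₀ (by
        change proj Γ z₀ ∉ A
        rw [hz₀]; exact (p e₀).2) z hz
    let c : C(unitInterval, (Aᶜ : Set (Orbifold Γ))) :=
      ⟨fun t => ⟨proj Γ (γ t), hγ t⟩, Continuous.subtype_mk ((continuous_proj Γ).comp γ.continuous) _⟩
    obtain ⟨l, hl, hl0⟩ := hp.exists_path_lifts c e₀ (Subtype.ext (by
      change proj Γ (γ 0) = _
      rw [γ.source, hz₀]))
    obtain ⟨l', -, hl'⟩ := hcov.existsUnique_continuousMap_lifts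
      (f := ⟨fun t => proj Γ (γ t), (continuous_proj Γ).comp γ.continuous⟩)
      (a₀ := 0) (e₀ := z₀) (by simp) hγ
    have h1 : h.comp l = l' := hl' _ ⟨by simp [hl0, hh₀], by
      funext t
      have := congrArg Subtype.val (congrFun hl t)
      exact (hh (l t)).trans this⟩
    have h2 : γ.toContinuousMap = l' := hl' _ ⟨by simp, rfl⟩
    refine ⟨l 1, ?_⟩
    have h3 := congrArg (fun k : C(unitInterval, ℍ) => k 1) (h1.trans h2.symm)
    simpa using h3

end

section

/-- `F` is the developing map on `ℍ` of a bounded covering projective structure on `ℍ / Γ` with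
singular set `A`. -/
structure IsDeveloping (Γ : Subgroup SL(2, ℝ)) (A : Set (Orbifold Γ)) (F : ℍ → OnePoint ℂ) :
    Prop where
  locBihol : LocBihol F
  uniformly_injective : ∃ ρ > 0, ∀ z w : ℍ, dist (z : ℂ) w < ρ * z.im → F z = F w → z = w
  equivariant : ∀ γ ∈ Γ, ∃ g : GL (Fin 2) ℂ, ∀ z, F (γ • z) = g • F z
  covering : IsCoveringMapOn F (F '' {z | proj Γ z ∉ A})
  discontinuous : ∀ z, proj Γ z ∉ A → ∃ V ∈ 𝓝 (F z), {m : Equiv.Perm (OnePoint ℂ) |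
    (∃ γ ∈ Γ, ∃ g : GL (Fin 2) ℂ, m = MulAction.toPermHom (GL (Fin 2) ℂ) (OnePoint ℂ) g ∧
      ∀ z, F (γ • z) = g • F z) ∧ ((m '' V) ∩ V).Nonempty}.Finite

variable {Γ : Subgroup SL(2, ℝ)}

lemma exists_deck_lift {E X : Type} [TopologicalSpace E] [TopologicalSpace X]
    [SimplyConnectedSpace E] [LocallyPathConnectedSpace E] {p : E → X} (hp : IsCoveringMap p)
    {e e' : E} (h : p e = p e') : ∃ c ∈ deckGroup p, c e = e' := by
  have key : ∀ a b : E, p a = p b → ∃ c : C(E, E), c a = b ∧ ∀ x, p (c x) = p x := by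
    intro a b hab
    obtain ⟨c, ⟨hc, hc'⟩, -⟩ := hp.existsUnique_continuousMap_lifts
      (f := ⟨p, hp.continuous⟩) (a₀ := a) (e₀ := b) hab.symm
    exact ⟨c, hc, congrFun hc'⟩
  obtain ⟨c, hc, hcp⟩ := key e e' h
  obtain ⟨d, hd, hdp⟩ := key e' e h.symm
  have h1 : d ∘ c = id := hp.eq_of_comp_eq (d.continuous.comp c.continuous) continuous_id
    (by funext x; simp [hcp, hdp]) e (by simp [hc, hd])
  have h2 : c ∘ d = id := hp.eq_of_comp_eq (c.continuous.comp d.continuous) continuous_id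
    (by funext x; simp [hcp, hdp]) e' (by simp [hc, hd])
  exact ⟨⟨⟨c, d, congrFun h1, congrFun h2⟩, c.continuous, d.continuous⟩, hcp, hc⟩

lemma LocBihol.eq_smul_comp {E : Type} [TopologicalSpace E] [PreconnectedSpace E] [Nonempty E]
    {F : ℍ → OnePoint ℂ} (hF : LocBihol F) {h : E → ℍ} (hh : ∀ e, map h (𝓝 e) = 𝓝 (h e))
    {D : E → OnePoint ℂ}
    (hD : ∀ e, ∃ g : GL (Fin 2) ℂ, ∀ᶠ y in 𝓝 e, D y = g • F (h y)) :
    ∃ m : GL (Fin 2) ℂ, ∀ e, D e = m • F (h e) := by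
  obtain ⟨e₀⟩ : Nonempty E := inferInstance
  obtain ⟨m, hm⟩ := hD e₀
  have hcl : IsClopen {e : E | ∀ᶠ y in 𝓝 e, D y = m • F (h y)} := by
    refine ⟨?_, isOpen_setOfPred_eventually_nhds⟩
    rw [isClosed_iff_frequently]
    intro e he
    obtain ⟨g, hg⟩ := hD e
    obtain ⟨e', he', hge'⟩ := (he.and_eventually hg.eventually_nhds).exists
    have h1 : ∀ᶠ z in 𝓝 (h e'), m • F z = g • F z := by
      rw [← hh e', eventually_map]
      filter_upwards [he', hge'] with y hy hy'
      rw [← hy, hy']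
    have h2 := (hF.smul m).eq_of_eventuallyEq (hF.smul g) h1
    filter_upwards [hg] with y hy
    rw [hy]
    exact (congrFun h2 (h y)).symm
  refine ⟨m, fun e => ?_⟩
  have : e ∈ {e : E | ∀ᶠ y in 𝓝 e, D y = m • F (h y)} := by
    rw [hcl.eq_univ ⟨e₀, hm⟩]; trivial
  exact (show ∀ᶠ y in 𝓝 e, D y = m • F (h y) from this).self_of_nhds

lemma LocBihol.section_eq_of_eventually {F : ℍ → OnePoint ℂ} (hF : LocBihol F)
    {V : Set (OnePoint ℂ)} (hV : IsOpen V) {z : ℍ} (hz : F z ∈ V) :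
    ∀ᶠ w in 𝓝[≠] z, F w ∈ V ∧ ∀ σ : OnePoint ℂ → ℍ, ContinuousOn σ V → (∀ v ∈ V, F (σ v) = v) →
      σ (F w) = w → σ (F z) = z := by
  have h1 : {w | F w ∈ V} ∈ 𝓝 z := hF.continuous.continuousAt.eventually (hV.mem_nhds hz)
  obtain ⟨N, hN, hNR, hNc, -⟩ := exists_punctured_nhds h1
  filter_upwards [mem_nhdsWithin_of_mem_nhds hN, self_mem_nhdsWithin] with w hw hwz
  refine ⟨hNR hw, fun σ hσ hσF hσw => ?_⟩
  have h2 : EqOn (fun v => σ (F v)) id (N \ {z}) :=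
    hF.eqOn_of_comp_eqOn hNc (hσ.comp hF.continuous.continuousOn fun v hv => hNR hv.1)
      continuousOn_id (fun v hv => hσF _ (hNR hv.1)) ⟨hw, hwz⟩ hσw
  have h3 : Tendsto (fun v => σ (F v)) (𝓝[≠] z) (𝓝 (σ (F z))) :=
    (((hσ.continuousAt (hV.mem_nhds hz)).comp hF.continuous.continuousAt).tendsto).mono_left
      nhdsWithin_le_nhds
  have h4 : Tendsto (fun v => σ (F v)) (𝓝[≠] z) (𝓝 z) := by
    refine (tendsto_id.mono_left nhdsWithin_le_nhds).congr' ?_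
    filter_upwards [mem_nhdsWithin_of_mem_nhds hN, self_mem_nhdsWithin] with v hv hvz
    exact (h2 ⟨hv, hvz⟩).symm
  exact tendsto_nhds_unique h3 h4

lemma LocBihol.regular_of_section {F : ℍ → OnePoint ℂ} (hF : LocBihol F) {R : Set ℍ}
    (hR : ∀ z, ∀ᶠ w in 𝓝[≠] z, w ∈ R) {V : Set (OnePoint ℂ)} (hV : IsOpen V)
    (hsec : ∀ z ∈ R, F z ∈ V → ∃ σ : OnePoint ℂ → ℍ, ContinuousOn σ V ∧ (∀ v ∈ V, σ v ∈ R) ∧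
      (∀ v ∈ V, F (σ v) = v) ∧ σ (F z) = z) {z : ℍ} (hz : F z ∈ V) : z ∈ R := by
  obtain ⟨w, hw, hwV, hwσ⟩ := ((hR z).and (hF.section_eq_of_eventually hV hz)).exists
  obtain ⟨σ, hσ, hσR, hσF, hσw⟩ := hsec w hw hwV
  rw [← hwσ σ hσ hσF hσw]
  exact hσR _ hz

theorem SingularProjectiveStructure.IsBoundedCovering.exists_isDeveloping [DiscreteTopology Γ]
    {P : SingularProjectiveStructure Γ} (hP : P.IsBoundedCovering) :
    ∃ F : ℍ → OnePoint ℂ, IsDeveloping Γ P.sing F ∧ ∀ φ ∈ P.atlas, ∀ z : ℍ,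
      proj Γ z ∈ φ.source → ∃ g : GL (Fin 2) ℂ, ∀ᶠ w in 𝓝 z, F w = g • φ (proj Γ w) := by
  obtain ⟨hb, E, _, p, D, _, hp, hD, hcov, hdis⟩ := hP
  obtain ⟨F₀, hF₀, ⟨ρ, hρ, hρF⟩, hF₀P⟩ := P.exists_locBihol hb
  have : LocallyPathConnectedSpace P.Regular :=
    P.isClosed_sing.isOpen_compl.locallyPathConnectedSpace
  have : LocallyPathConnectedSpace E :=
    locallyPathConnectedSpace_of_isLocalHomeomorph hp.isLocalHomeomorph
  obtain ⟨h, hh, hhn, hhs⟩ := exists_lift_to_uhp P.isClosed_sing P.discrete_sing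
    P.conePoints_subset hp
  obtain ⟨m, hm⟩ := hF₀.eq_smul_comp hhn (D := D) (by
    intro e
    obtain ⟨φ, hφ, heφ⟩ := P.exists_chart _ (p e).2
    obtain ⟨g, hg⟩ := hD e φ hφ heφ
    obtain ⟨g', hg'⟩ := hF₀P φ hφ (h e) (by rwa [hh])
    refine ⟨g * g'⁻¹, ?_⟩
    filter_upwards [hg, h.continuous.continuousAt.eventually hg'] with y hy hy'
    rw [hy', hh, mul_smul, inv_smul_smul, hy])
  set F : ℍ → OnePoint ℂ := fun z => m • F₀ z with hFdef
  have hF : LocBihol F := hF₀.smul m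
  have hFP : ∀ φ ∈ P.atlas, ∀ z : ℍ,
      proj Γ z ∈ φ.source → ∃ g : GL (Fin 2) ℂ, ∀ᶠ w in 𝓝 z, F w = g • φ (proj Γ w) := by
    intro φ hφ z hz
    obtain ⟨g, hg⟩ := hF₀P φ hφ z hz
    refine ⟨m * g, ?_⟩
    filter_upwards [hg] with w hw
    simp only [hFdef]
    rw [hw, mul_smul]
  have hDF : ∀ e, D e = F (h e) := hm
  have hrange : range D = F '' {z | proj Γ z ∉ P.sing} := by
    ext y
    constructor
    · rintro ⟨e, rfl⟩
      exact ⟨h e, by rw [mem_ofPred_eq, hh]; exact (p e).2, (hDF e).symm⟩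
    · rintro ⟨z, hz, rfl⟩
      obtain ⟨e, rfl⟩ := hhs z hz
      exact ⟨e, hDF e⟩
  have hRo : IsOpen {z : ℍ | proj Γ z ∉ P.sing} :=
    P.isClosed_sing.isOpen_compl.preimage (continuous_proj Γ)
  have hΩo : IsOpen (range D) := by
    rw [hrange]; exact hF.isOpenMap _ hRo
  have hsec : ∀ y ∈ range D, ∃ V, IsOpen V ∧ y ∈ V ∧ IsPreconnected V ∧
      ∀ z ∈ {z | proj Γ z ∉ P.sing}, F z ∈ V → ∃ σ : OnePoint ℂ → ℍ, ContinuousOn σ V ∧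
        (∀ v ∈ V, σ v ∈ {z | proj Γ z ∉ P.sing}) ∧ (∀ v ∈ V, F (σ v) = v) ∧ σ (F z) = z := by
    intro y hy
    obtain ⟨V, -, hVo, hyV, hVc, hVs⟩ := IsCoveringMapOn.exists_section hcov hy univ_mem
    refine ⟨V, hVo, hyV, hVc, fun z hz hzV => ?_⟩
    obtain ⟨e, rfl⟩ := hhs z hz
    obtain ⟨σ, hσ, hσ1, hσ2⟩ := hVs e (by rwa [hDF])
    refine ⟨fun v => h (σ v), h.continuous.comp_continuousOn hσ, fun v _ => ?_, fun v hv => ?_, ?_⟩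
    · rw [mem_ofPred_eq, hh]; exact (p _).2
    · rw [← hDF, hσ1 v hv]
    · simp only [← hDF, hσ2]
  refine ⟨F, ⟨hF, ⟨ρ, hρ, fun z w hzw hFzw => hρF z w hzw (smul_left_cancel m hFzw)⟩,
    fun γ hγ => exists_gl_smul_of_mem P hF hFP hγ, ?_, ?_⟩, hFP⟩
  · rw [← hrange]
    refine isCoveringMapOn_of_sections hF.continuous fun y hy => ?_
    obtain ⟨V, hVo, hyV, hVc, hVs⟩ := hsec y hy
    refine ⟨V, hVo, hyV, hVc, fun x _ => hF.exists_injOn x, fun x hx => ?_⟩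
    obtain ⟨σ, h1, -, h2, h3⟩ := hVs x (hF.regular_of_section (R := {z | proj Γ z ∉ P.sing})
      (eventually_proj_notMem Γ P.isClosed_sing P.discrete_sing) hVo hVs hx) hx
    exact ⟨σ, h1, h2, h3⟩
  · intro z hz
    obtain ⟨V, hV, hfin⟩ := hdis (F z) (by rw [hrange]; exact ⟨z, hz, rfl⟩)
    refine ⟨V, hV, hfin.subset ?_⟩
    rintro _ ⟨⟨γ, hγ, g, rfl, hg⟩, hne⟩
    refine ⟨⟨⟨g, rfl⟩, ?_⟩, hne⟩
    obtain ⟨e, rfl⟩ := hhs z hz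
    obtain ⟨e', he'⟩ := hhs (γ • h e) (by rwa [proj_smul Γ hγ])
    have hpe : p e = p e' := Subtype.ext (by rw [← hh, ← hh, he', proj_smul Γ hγ])
    obtain ⟨c, hc, hce⟩ := exists_deck_lift hp hpe
    refine ⟨c, hc, fun x => ?_⟩
    have h1 : (fun x => h (c x)) = fun x => γ • h x := by
      obtain ⟨l, -, hl⟩ := (isCoveringMapOn_proj Γ P.isClosed_sing
        P.conePoints_subset).existsUnique_continuousMap_lifts
        (f := ⟨fun e => (p e : Orbifold Γ), continuous_subtype_val.comp hp.continuous⟩)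
        (a₀ := e) (e₀ := γ • h e) (by rw [proj_smul Γ hγ]; exact hh e) (fun e => (p e).2)
      have e1 := hl ⟨fun x => h (c x), h.continuous.comp c.continuous⟩
        ⟨by simp [hce, he'], by funext x; simp [hh, show p (c x) = p x from hc x]⟩
      have e2 := hl ⟨fun x => γ • h x, (continuous_const_smul γ).comp h.continuous⟩
        ⟨by simp, by funext x; simp [hh, proj_smul Γ hγ]⟩
      exact congrArg DFunLike.coe (e1.trans e2.symm)
    rw [hDF, hDF, congrFun h1 x, hg]
    rfl

end

section

/-! ### Lifts over punctures -/

lemma exists_lift_halfPlane {E X : Type*} [TopologicalSpace E] [TopologicalSpace X] {f : E → X}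
    {A : Set X} (hf : IsCoveringMapOn f A) {R : ℝ} {c : ℂ → X}
    (hc : ContinuousOn c {s | s.re < R}) (hcA : ∀ s : ℂ, s.re < R → c s ∈ A) {s₀ : ℂ}
    (hs₀ : s₀.re < R) {e : E} (he : f e = c s₀) :
    ∃ G : ℂ → E, ContinuousOn G {s | s.re < R} ∧ G s₀ = e ∧ ∀ s : ℂ, s.re < R → f (G s) = c s := by
  classical
  have hconv : Convex ℝ {s : ℂ | s.re < R} := convex_halfSpace_re_lt R
  have : ContractibleSpace {s : ℂ | s.re < R} := hconv.contractibleSpace ⟨s₀, hs₀⟩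
  have : LocallyPathConnectedSpace {s : ℂ | s.re < R} := hconv.locallyPathConnectedSpace
  obtain ⟨G, ⟨hG₀, hG⟩, -⟩ := hf.existsUnique_continuousMap_lifts
    (f := ⟨fun s : {s : ℂ | s.re < R} => c s, continuousOn_iff_continuous_domRestrict.1 hc⟩)
    (a₀ := ⟨s₀, hs₀⟩) (e₀ := e) he (fun s => hcA s s.2)
  refine ⟨fun s => if h : s.re < R then G ⟨s, h⟩ else e, ?_, ?_, ?_⟩
  · rw [continuousOn_iff_continuous_domRestrict]
    convert G.continuous using 1
    funext s
    simp [show (s : ℂ).re < R from s.2]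
  · simp [hs₀, hG₀]
  · intro s hs
    simp only [hs, dif_pos]
    exact congrFun hG ⟨s, hs⟩

/-- A holomorphic map of a half-plane to `ℍ` moves points by little along short translations, far
inside the half-plane. -/
lemma displacement_small {G : ℂ → ℍ} {R : ℝ}
    (hG : ∀ s : ℂ, s.re < R → DifferentiableAt ℂ (fun s => (G s : ℂ)) s) (d : ℂ) {ρ : ℝ}
    (hρ : 0 < ρ) : ∃ R' ≤ R, ∀ s : ℂ, s.re < R' → dist (G s : ℂ) (G (s + d)) < ρ * (G s).im := by
  obtain ⟨ε, hε, hε1, hε2⟩ : ∃ ε : ℝ, 0 < ε ∧ ε ≤ 1 / 2 ∧ 4 * ε < ρ :=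
    ⟨min (1 / 2) (ρ / 8), by positivity, min_le_left _ _, by
      have := min_le_right (1 / 2) (ρ / 8); linarith⟩
  refine ⟨R - (‖d‖ + 1) / ε, by have : 0 ≤ (‖d‖ + 1) / ε := by positivity
                                linarith, fun s hs => ?_⟩
  set r := R - s.re with hr
  have hr1 : (‖d‖ + 1) / ε < r := by linarith
  have hr2 : ‖d‖ + 1 < ε * r := by rwa [div_lt_iff₀' hε] at hr1
  have hr0 : 0 < r := lt_trans (by positivity) hr1
  have hdr : ‖d‖ < r := by nlinarith [norm_nonneg d]
  have hball : ∀ t ∈ Metric.ball s r, t.re < R := by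
    intro t ht
    have h1 : (t - s).re ≤ ‖t - s‖ := Complex.re_le_norm _
    rw [Metric.mem_ball, dist_eq_norm] at ht
    rw [Complex.sub_re] at h1
    linarith
  have him : ∀ z w : ℍ, (z : ℂ) - (starRingEnd ℂ) (w : ℂ) ≠ 0 := by
    intro z w h
    have h1 := congrArg Complex.im h
    simp at h1
    have h2 := z.im_pos
    have h3 := w.im_pos
    linarith
  have hnorm : ∀ z w : ℍ, ‖((z : ℂ) - w) / ((z : ℂ) - (starRingEnd ℂ) (w : ℂ))‖ < 1 := by
    intro z w
    rw [norm_div, div_lt_one (norm_pos_iff.2 (him z w))]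
    rw [← sq_lt_sq₀ (norm_nonneg _) (norm_nonneg _), ← Complex.normSq_eq_norm_sq,
      ← Complex.normSq_eq_norm_sq, Complex.normSq_apply, Complex.normSq_apply]
    simp
    have h2 := z.im_pos
    have h3 := w.im_pos
    nlinarith [mul_pos h2 h3]
  set f : ℂ → ℂ := fun t => ((G t : ℂ) - G s) / ((G t : ℂ) - (starRingEnd ℂ) (G s : ℂ)) with hf
  have hfd : DifferentiableOn ℂ f (Metric.ball s r) := by
    intro t ht
    have := hG t (hball t ht)
    exact ((this.sub_const _).div (this.sub_const _) (him _ _)).differentiableWithinAt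
  have hfm : MapsTo f (Metric.ball s r) (Metric.closedBall (f s) 1) := by
    intro t _
    have : f s = 0 := by simp [hf]
    rw [Metric.mem_closedBall, this, dist_zero_right]
    exact (hnorm _ _).le
  have h1 := Complex.dist_le_div_mul_dist_of_mapsTo_ball hfd hfm (z := s + d) (by simpa using hdr)
  have hfs : f s = 0 := by simp [hf]
  rw [hfs, dist_zero_right] at h1
  simp only [dist_self_add_left] at h1
  have h2 : ‖f (s + d)‖ ≤ ε := by
    refine h1.trans ?_
    rw [div_mul_eq_mul_div, one_mul, div_le_iff₀ hr0]
    linarith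
  rw [hf] at h2
  simp only at h2
  rw [norm_div, div_le_iff₀ (norm_pos_iff.2 (him _ _))] at h2
  have h3 : ‖(G (s + d) : ℂ) - (starRingEnd ℂ) (G s : ℂ)‖ ≤ ‖(G (s + d) : ℂ) - G s‖ + 2 * (G s).im := by
    have : (G (s + d) : ℂ) - (starRingEnd ℂ) (G s : ℂ) =
      ((G (s + d) : ℂ) - G s) + ((2 * (G s).im : ℝ) : ℂ) * Complex.I := by
      apply Complex.ext
      · simp
      · simp; ring
    rw [this]
    refine (norm_add_le _ _).trans ?_
    have h5 := (G s).im_pos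
    rw [norm_mul, Complex.norm_I, mul_one, Complex.norm_real, Real.norm_eq_abs, abs_of_pos]
    positivity
  rw [dist_comm, dist_eq_norm]
  have h5 := (G s).im_pos
  nlinarith [norm_nonneg ((G (s + d) : ℂ) - G s)]

lemma cayley_inv_im_pos {g : ℂ} (hg : ‖g‖ < 1) : 0 < (Complex.I * (1 + g) / (1 - g)).im := by
  have h0 : (1 - g) ≠ 0 := by
    intro h
    rw [sub_eq_zero] at h
    rw [← h] at hg; simp at hg
  have h1 : Complex.normSq g < 1 := by
    rw [Complex.normSq_eq_norm_sq]; nlinarith [norm_nonneg g]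
  rw [Complex.div_im, ← sub_pos] 
  have h2 : 0 < Complex.normSq (1 - g) := Complex.normSq_pos.2 h0
  rw [sub_zero, ← sub_div]
  refine div_pos ?_ h2
  rw [Complex.normSq_apply] at h1
  simp
  nlinarith

/-- A periodic holomorphic map of a half-plane to `ℍ` extends over the puncture. -/
lemma exists_extension_of_periodic {G : ℂ → ℍ} {R : ℝ}
    (hG : ∀ s : ℂ, s.re < R → DifferentiableAt ℂ (fun s => (G s : ℂ)) s)
    (hper : ∀ s : ℂ, s.re < R → G (s + 2 * Real.pi * Complex.I) = G s) :
    ∃ H : ℂ → ℍ, ContinuousOn H (Metric.ball 0 (Real.exp R)) ∧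
      DifferentiableOn ℂ (fun w => (H w : ℂ)) (Metric.ball 0 (Real.exp R)) ∧
      ∀ s : ℂ, s.re < R → H (Complex.exp s) = G s := by
  have hlog : ∀ w : ℂ, w ≠ 0 → w ∈ Metric.ball (0 : ℂ) (Real.exp R) → (Complex.log w).re < R := by
    intro w hw hwb
    rw [Complex.log_re, Real.log_lt_iff_lt_exp (norm_pos_iff.2 hw)]
    simpa using hwb
  have hpern : ∀ (n : ℕ) (s : ℂ), s.re < R → G (s + n * (2 * Real.pi * Complex.I)) = G s := by
    intro n
    induction n with
    | zero => intro s _; simp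
    | succ n ih =>
      intro s hs
      have := hper (s + n * (2 * Real.pi * Complex.I)) (by simpa using hs)
      rw [← ih s hs, ← this]
      congr 1
      push_cast
      ring
  have hexp : ∀ s t : ℂ, s.re < R → Complex.exp s = Complex.exp t → G s = G t := by
    intro s t hs hst
    obtain ⟨n, hn⟩ := Complex.exp_eq_exp_iff_exists_int.1 hst
    have hre : t.re = s.re := by rw [hn]; simp
    rcases Int.eq_nat_or_neg n with ⟨k, rfl | rfl⟩
    · rw [hn]; exact_mod_cast hpern k t (by rwa [hre])
    · rw [← hpern k s hs, hn]
      congr 1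
      push_cast
      ring
  set c : ℂ → ℂ := fun w => ((G (Complex.log w) : ℂ) - Complex.I) / (G (Complex.log w) + Complex.I)
    with hc
  have hI : ∀ z : ℍ, (z : ℂ) + Complex.I ≠ 0 := by
    intro z h
    have h1 := congrArg Complex.im h
    have h2 := z.im_pos
    simp at h1
    linarith
  have hcn : ∀ w, ‖c w‖ < 1 := fun w => cayley_norm_lt (G (Complex.log w)).im_pos
  have hcd : ∀ w : ℂ, w ≠ 0 → w ∈ Metric.ball (0 : ℂ) (Real.exp R) → DifferentiableAt ℂ c w := by
    intro w hw hwb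
    set L : ℂ → ℂ := fun v => Complex.log (v / w) + Complex.log w
    have hL : DifferentiableAt ℂ L w := by
      refine DifferentiableAt.add_const _ (DifferentiableAt.clog (by fun_prop) ?_)
      rw [div_self hw]; simp
    have hLw : L w = Complex.log w := by simp [L, div_self hw]
    have hg : DifferentiableAt ℂ (fun v => (G (L v) : ℂ)) w :=
      DifferentiableAt.comp (g := fun s => (G s : ℂ)) w (by rw [hLw]; exact hG _ (hlog w hw hwb)) hL
    have hg2 : DifferentiableAt ℂ (fun v => ((G (L v) : ℂ) - Complex.I) / (G (L v) + Complex.I)) w :=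
      (hg.sub_const _).div (hg.add_const _) (hI _)
    refine hg2.congr_of_eventuallyEq ?_
    filter_upwards [isOpen_ne.mem_nhds hw, Metric.isOpen_ball.mem_nhds hwb] with v hv hvb
    have : G (Complex.log v) = G (L v) := by
      refine hexp _ _ (hlog v hv hvb) ?_
      simp only [L]
      rw [Complex.exp_log hv, Complex.exp_add, Complex.exp_log (div_ne_zero hv hw),
        Complex.exp_log hw, div_mul_cancel₀ _ hw]
    simp only [hc, this]
  have h0b : (0 : ℂ) ∈ Metric.ball (0 : ℂ) (Real.exp R) := by simp [Real.exp_pos]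
  have hbn : Metric.ball (0 : ℂ) (Real.exp R) ∈ 𝓝 (0 : ℂ) := Metric.isOpen_ball.mem_nhds h0b
  have hext := Complex.differentiableOn_update_limUnder_of_bddAbove (f := c) hbn
    (fun w hw => (hcd w hw.2 hw.1).differentiableWithinAt)
    ⟨1, by rintro _ ⟨w, -, rfl⟩; exact (hcn w).le⟩
  set g := Function.update c 0 (limUnder (𝓝[≠] 0) c) with hg
  have hgc : ∀ w, w ≠ 0 → g w = c w := fun w hw => Function.update_of_ne hw _ _
  have hg0 : ‖g 0‖ ≤ 1 := by
    have h1 : Tendsto (fun w => ‖g w‖) (𝓝[≠] 0) (𝓝 ‖g 0‖) :=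
      ((hext.continuousOn.continuousAt hbn).norm).tendsto.mono_left nhdsWithin_le_nhds
    refine le_of_tendsto h1 ?_
    filter_upwards [self_mem_nhdsWithin] with w hw
    rw [hgc w hw]; exact (hcn w).le
  have hgn : ∀ w, ‖g w‖ < 1 := by
    intro w
    by_cases hw : w = 0
    · subst hw
      refine lt_of_le_of_ne hg0 fun heq => ?_
      have hmax : IsMaxOn (norm ∘ g) (Metric.ball 0 (Real.exp R)) 0 := by
        intro v _
        simp only [Function.comp_apply, mem_ofPred_eq, heq]
        by_cases hv : v = 0
        · rw [hv, heq]
        · rw [hgc v hv]; exact (hcn v).le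
      have h1 := Complex.norm_eqOn_of_isPreconnected_of_isMaxOn
        (convex_ball (0 : ℂ) (Real.exp R)).isPreconnected Metric.isOpen_ball hext h0b hmax
      have h2 : (Complex.exp ((R - 1 : ℝ) : ℂ)) ∈ Metric.ball (0 : ℂ) (Real.exp R) := by
        rw [mem_ball_zero_iff, Complex.norm_exp]; simp
      have h3 := h1 h2
      simp only [Function.comp_apply, Function.const_apply, heq] at h3
      rw [hgc _ (Complex.exp_ne_zero _)] at h3
      exact absurd h3 (hcn _).ne
    · rw [hgc w hw]; exact hcn w
  have hg1 : ∀ w, 1 - g w ≠ 0 := by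
    intro w h
    have := hgn w
    rw [← sub_eq_zero.1 h] at this
    simp at this
  have hHd : DifferentiableOn ℂ (fun w => Complex.I * (1 + g w) / (1 - g w))
      (Metric.ball 0 (Real.exp R)) := by
    intro w hw
    have := hext w hw
    exact ((this.const_add _).const_mul _).div (this.const_sub _) (hg1 w)
  refine ⟨fun w => ⟨Complex.I * (1 + g w) / (1 - g w), cayley_inv_im_pos (hgn w)⟩, ?_, hHd, ?_⟩
  · rw [UpperHalfPlane.isOpenEmbedding_coe.isInducing.continuousOn_iff]
    exact hHd.continuousOn
  · intro s hs
    apply UpperHalfPlane.coe_injective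
    simp only
    rw [hgc _ (Complex.exp_ne_zero _)]
    have h1 : G (Complex.log (Complex.exp s)) = G s :=
      (hexp _ _ hs (by rw [Complex.exp_log (Complex.exp_ne_zero _)])).symm
    have h2 := hg1 (Complex.exp s)
    rw [hgc _ (Complex.exp_ne_zero _)] at h2
    rw [div_eq_iff h2]
    simp only [hc, h1]
    field_simp [hI (G s)]
    ring

end

section

/-! ### The developing map is a covering of its image -/

variable {Γ : Subgroup SL(2, ℝ)} {A : Set (Orbifold Γ)} {F : ℍ → OnePoint ℂ}

/-- The inverse of the inclusion of `ℂ` in the Riemann sphere. -/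
def sphereCoord : OnePoint ℂ → ℂ := Function.invFun (↑)

@[simp] lemma sphereCoord_coe (z : ℂ) : sphereCoord (z : OnePoint ℂ) = z :=
  Function.leftInverse_invFun OnePoint.coe_injective z

lemma continuousOn_sphereCoord : ContinuousOn sphereCoord (range ((↑) : ℂ → OnePoint ℂ)) := by
  rintro _ ⟨z, rfl⟩
  refine ContinuousAt.continuousWithinAt ?_
  rw [OnePoint.continuousAt_coe]
  exact continuousAt_id.congr (Eventually.of_forall fun w => (sphereCoord_coe w).symm)

/-- The disc about `0` of radius `r` in the coordinate `k` on the sphere. -/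
def sphereDisc (k : GL (Fin 2) ℂ) (r : ℝ) : Set (OnePoint ℂ) :=
  (fun w : ℂ => k⁻¹ • (w : OnePoint ℂ)) '' Metric.ball 0 r

lemma isOpenMap_sphere_chart (k : GL (Fin 2) ℂ) : IsOpenMap fun w : ℂ => k⁻¹ • (w : OnePoint ℂ) :=
  (isOpenMap_smul k⁻¹).comp OnePoint.isOpenEmbedding_coe.isOpenMap

lemma continuous_sphere_chart (k : GL (Fin 2) ℂ) :
    Continuous fun w : ℂ => k⁻¹ • (w : OnePoint ℂ) :=
  (continuous_gl_smul k⁻¹).comp OnePoint.continuous_coe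

lemma exists_sphereDisc_subset {k : GL (Fin 2) ℂ} {p : OnePoint ℂ}
    (hk : k • p = ((0 : ℂ) : OnePoint ℂ)) {U : Set (OnePoint ℂ)} (hU : U ∈ 𝓝 p) :
    ∃ r > 0, sphereDisc k r ⊆ U := by
  have h1 : (fun w : ℂ => k⁻¹ • (w : OnePoint ℂ)) ⁻¹' U ∈ 𝓝 (0 : ℂ) :=
    (continuous_sphere_chart k).continuousAt.preimage_mem_nhds (by
      rwa [← hk, inv_smul_smul])
  obtain ⟨r, hr, hrU⟩ := Metric.mem_nhds_iff.1 h1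
  exact ⟨r, hr, image_subset_iff.2 hrU⟩

lemma exists_section_of_puncture (hF : LocBihol F) {Ω : Set (OnePoint ℂ)}
    (hcov : IsCoveringMapOn F Ω)
    (hinj : ∃ ρ > 0, ∀ z w : ℍ, dist (z : ℂ) w < ρ * z.im → F z = F w → z = w)
    {k : GL (Fin 2) ℂ} {r : ℝ} (hr : 0 < r)
    (hΩ : ∀ w : ℂ, w ≠ 0 → w ∈ Metric.ball (0 : ℂ) r → k⁻¹ • (w : OnePoint ℂ) ∈ Ω)
    {x : ℍ} {w₀ : ℂ} (hw₀ : w₀ ≠ 0) (hw₀r : w₀ ∈ Metric.ball (0 : ℂ) r)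
    (hx : F x = k⁻¹ • (w₀ : OnePoint ℂ)) :
    ∃ σ : OnePoint ℂ → ℍ, ContinuousOn σ (sphereDisc k r) ∧
      (∀ v ∈ sphereDisc k r, F (σ v) = v) ∧ σ (F x) = x := by
  obtain ⟨R, rfl⟩ : ∃ R, r = Real.exp R := ⟨Real.log r, (Real.exp_log hr).symm⟩
  have hball : ∀ s : ℂ, s.re < R → Complex.exp s ∈ Metric.ball (0 : ℂ) (Real.exp R) := by
    intro s hs
    rw [mem_ball_zero_iff, Complex.norm_exp]
    exact Real.exp_lt_exp.2 hs
  have hs₀ : (Complex.log w₀).re < R := by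
    rw [Complex.log_re, Real.log_lt_iff_lt_exp (norm_pos_iff.2 hw₀)]
    simpa using hw₀r
  obtain ⟨G, hGc, hG₀, hG⟩ := exists_lift_halfPlane hcov (R := R)
    (c := fun s => k⁻¹ • (Complex.exp s : OnePoint ℂ))
    ((continuous_sphere_chart k).comp Complex.continuous_exp).continuousOn
    (fun s hs => hΩ _ (Complex.exp_ne_zero s) (hball s hs)) hs₀ (e := x)
    (by rw [hx, Complex.exp_log hw₀])
  have hopen : IsOpen {s : ℂ | s.re < R} := isOpen_lt Complex.continuous_re continuous_const
  have hGd : ∀ s : ℂ, s.re < R → DifferentiableAt ℂ (fun s => (G s : ℂ)) s := by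
    intro s hs
    refine hF.differentiableAt_lift (hGc.continuousAt (hopen.mem_nhds hs)) k⁻¹ Complex.exp
      Complex.differentiable_exp.differentiableAt ?_
    filter_upwards [hopen.mem_nhds hs] with t ht using hG t ht
  have hper : ∀ s : ℂ, s.re < R → G (s + 2 * Real.pi * Complex.I) = G s := by
    obtain ⟨ρ, hρ, hρF⟩ := hinj
    obtain ⟨R', hR', hdisp⟩ := displacement_small hGd (2 * Real.pi * Complex.I) hρ
    have hshift : ∀ s : ℂ, s.re < R → (s + 2 * Real.pi * Complex.I).re < R := by
      intro s hs; simpa using hs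
    have hFs : ∀ s : ℂ, s.re < R → F (G (s + 2 * Real.pi * Complex.I)) = F (G s) := by
      intro s hs
      rw [hG _ (hshift s hs), hG s hs, Complex.exp_periodic s]
    have h1 : ((R' - 1 : ℝ) : ℂ).re < R := by rw [Complex.ofReal_re]; linarith
    intro s hs
    refine hF.eqOn_of_comp_eqOn (convex_halfSpace_re_lt R).isPreconnected
      (g₁ := fun s => G (s + 2 * Real.pi * Complex.I))
      (hGc.comp (by fun_prop) hshift) hGc hFs (a := ((R' - 1 : ℝ) : ℂ)) h1 ?_ hs
    refine (hρF _ _ (hdisp _ ?_) (hFs _ h1).symm).symm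
    rw [Complex.ofReal_re]; linarith
  obtain ⟨H, hHc, -, hH⟩ := exists_extension_of_periodic hGd hper
  have hFH : ∀ w ∈ Metric.ball (0 : ℂ) (Real.exp R), F (H w) = k⁻¹ • (w : OnePoint ℂ) := by
    have h1 : ∀ w ∈ Metric.ball (0 : ℂ) (Real.exp R), w ≠ 0 → F (H w) = k⁻¹ • (w : OnePoint ℂ) := by
      intro w hw hw0
      have h2 : (Complex.log w).re < R := by
        rw [Complex.log_re, Real.log_lt_iff_lt_exp (norm_pos_iff.2 hw0)]
        simpa using hw
      have h3 := hH _ h2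
      rw [Complex.exp_log hw0] at h3
      rw [h3, hG _ h2, Complex.exp_log hw0]
    intro w hw
    by_cases hw0 : w = 0
    · subst hw0
      have hb := Metric.isOpen_ball.mem_nhds hw
      have e1 : Tendsto (fun w => F (H w)) (𝓝[≠] 0) (𝓝 (F (H 0))) :=
        ((hF.continuous.continuousAt.comp (hHc.continuousAt hb)).tendsto).mono_left
          nhdsWithin_le_nhds
      have e2 : Tendsto (fun w => F (H w)) (𝓝[≠] 0) (𝓝 (k⁻¹ • ((0 : ℂ) : OnePoint ℂ))) := by
        refine ((continuous_sphere_chart k).continuousAt.tendsto.mono_left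
          nhdsWithin_le_nhds).congr' ?_
        filter_upwards [mem_nhdsWithin_of_mem_nhds hb, self_mem_nhdsWithin] with w hw hw0
        exact (h1 w hw hw0).symm
      exact tendsto_nhds_unique e1 e2
    · exact h1 w hw hw0
  refine ⟨fun v => H (sphereCoord (k • v)), ?_, ?_, ?_⟩
  · refine hHc.comp (continuousOn_sphereCoord.comp (continuous_gl_smul k).continuousOn ?_) ?_
    · rintro _ ⟨w, hw, rfl⟩
      simp
    · rintro _ ⟨w, hw, rfl⟩
      simpa using hw
  · rintro _ ⟨w, hw, rfl⟩
    simp only [smul_inv_smul, sphereCoord_coe]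
    exact hFH w hw
  · simp only [hx, smul_inv_smul, sphereCoord_coe]
    have := hH _ hs₀
    rwa [Complex.exp_log hw₀, hG₀] at this

theorem IsDeveloping.isCoveringMapOn_range [DiscreteTopology Γ] (hF : IsDeveloping Γ A F)
    (hAc : IsClosed A) (hAd : DiscreteTopology A) : IsCoveringMapOn F (range F) := by
  have hL := hF.locBihol
  have hAe := eventually_proj_notMem Γ hAc hAd
  have hΩn : ∀ u : ℍ, ∀ᶠ y in 𝓝[≠] (F u), y ∈ F '' {z | proj Γ z ∉ A} := by
    intro u
    have h1 : F '' {w | w ≠ u → proj Γ w ∉ A} ∈ 𝓝 (F u) := by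
      rw [← hL.map_nhds u]
      exact image_mem_map (eventually_nhdsWithin_iff.1 (hAe u))
    filter_upwards [mem_nhdsWithin_of_mem_nhds h1, self_mem_nhdsWithin] with y hy hyu
    obtain ⟨w, hw, rfl⟩ := hy
    refine ⟨w, hw ?_, rfl⟩
    rintro rfl
    exact hyu rfl
  refine isCoveringMapOn_of_sections hL.continuous ?_
  rintro _ ⟨u, rfl⟩
  obtain ⟨k, hk⟩ := exists_gl_smul_eq_zero (F u)
  obtain ⟨r, hr, hrΩ⟩ := exists_sphereDisc_subset hk (eventually_nhdsWithin_iff.1 (hΩn u))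
  have hFu : F u = k⁻¹ • ((0 : ℂ) : OnePoint ℂ) := by rw [← hk, inv_smul_smul]
  have hΩ : ∀ w : ℂ, w ≠ 0 → w ∈ Metric.ball (0 : ℂ) r →
      k⁻¹ • (w : OnePoint ℂ) ∈ F '' {z | proj Γ z ∉ A} := by
    intro w hw hwr
    refine hrΩ ⟨w, hwr, rfl⟩ ?_
    rw [mem_compl_iff, mem_singleton_iff, hFu]
    intro h
    exact hw (OnePoint.coe_injective (smul_left_cancel _ h))
  have hVo : IsOpen (sphereDisc k r) := isOpenMap_sphere_chart k _ Metric.isOpen_ball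
  have hsec : ∀ x, F x ∈ sphereDisc k r → F x ≠ F u → ∃ σ : OnePoint ℂ → ℍ,
      ContinuousOn σ (sphereDisc k r) ∧ (∀ v ∈ sphereDisc k r, F (σ v) = v) ∧ σ (F x) = x := by
    rintro x ⟨w, hw, hwx⟩ hne
    refine exists_section_of_puncture hL hF.covering hF.uniformly_injective hr hΩ ?_ hw hwx.symm
    rintro rfl
    exact hne (by rw [← hwx, hFu])
  refine ⟨sphereDisc k r, hVo, ⟨0, by simpa using hr, hFu.symm⟩,
    (convex_ball (0 : ℂ) r).isPreconnected.image _ (continuous_sphere_chart k).continuousOn,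
    fun x _ => hL.exists_injOn x, fun x hx => ?_⟩
  by_cases hne : F x = F u
  · obtain ⟨N, hN, hNi⟩ := hL.exists_injOn x
    obtain ⟨w, ⟨hwV, hwσ⟩, hwN, hwx⟩ := ((hL.section_eq_of_eventually hVo hx).and
      (Eventually.and (mem_nhdsWithin_of_mem_nhds hN) self_mem_nhdsWithin)).exists
    obtain ⟨σ, h1, h2, h3⟩ := hsec w hwV
      (fun h => hwx (hNi hwN (mem_of_mem_nhds hN) (h.trans hne.symm)))
    exact ⟨σ, h1, h2, hwσ σ h1 h2 h3⟩
  · exact hsec x hx hne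

end

section

/-! ### Automorphisms of the hyperbolic plane -/

/-- The Cayley transform of `ℍ` to the unit disc. -/
def cay (z : ℍ) : ℂ := ((z : ℂ) - Complex.I) / (z + Complex.I)

lemma coe_add_I_ne_zero (z : ℍ) : (z : ℂ) + Complex.I ≠ 0 := by
  intro h
  have h1 := congrArg Complex.im h
  have h2 := z.im_pos
  simp at h1
  linarith

lemma norm_cay_lt (z : ℍ) : ‖cay z‖ < 1 := cayley_norm_lt z.im_pos

/-- The inverse of the Cayley transform. -/
def cayInv (g : ℂ) : ℍ :=
  if hg : ‖g‖ < 1 then ⟨Complex.I * (1 + g) / (1 - g), cayley_inv_im_pos hg⟩ else UpperHalfPlane.I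

lemma coe_cayInv {g : ℂ} (hg : ‖g‖ < 1) : (cayInv g : ℂ) = Complex.I * (1 + g) / (1 - g) := by
  rw [cayInv, dif_pos hg]

lemma one_sub_ne_zero_of_norm_lt {g : ℂ} (hg : ‖g‖ < 1) : 1 - g ≠ 0 := by
  intro h
  rw [← sub_eq_zero.1 h] at hg
  simp at hg

lemma cay_cayInv {g : ℂ} (hg : ‖g‖ < 1) : cay (cayInv g) = g := by
  have h1 := one_sub_ne_zero_of_norm_lt hg
  have h2 := coe_add_I_ne_zero (cayInv g)
  rw [coe_cayInv hg] at h2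
  rw [cay, coe_cayInv hg, div_eq_iff h2]
  field_simp
  ring

lemma cay_injective : Function.Injective cay := by
  intro z w h
  have h1 := coe_add_I_ne_zero z
  have h2 := coe_add_I_ne_zero w
  rw [cay, cay, div_eq_div_iff h1 h2] at h
  apply UpperHalfPlane.coe_injective
  have h3 : 2 * Complex.I * ((z : ℂ) - w) = 0 := by linear_combination h
  simpa [sub_eq_zero] using h3

lemma cayInv_cay (z : ℍ) : cayInv (cay z) = z := cay_injective (cay_cayInv (norm_cay_lt z))

lemma cay_I : cay UpperHalfPlane.I = 0 := by simp [cay]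

lemma cay_eq_zero_iff {z : ℍ} : cay z = 0 ↔ z = UpperHalfPlane.I := by
  rw [← cay_I]; exact cay_injective.eq_iff

lemma cayInv_zero : cayInv 0 = UpperHalfPlane.I := by rw [← cay_I, cayInv_cay]

lemma differentiableOn_cayInv :
    DifferentiableOn ℂ (fun g => (cayInv g : ℂ)) (Metric.ball 0 1) := by
  have h : DifferentiableOn ℂ (fun g : ℂ => Complex.I * (1 + g) / (1 - g)) (Metric.ball 0 1) := by
    refine DifferentiableOn.div (by fun_prop) (by fun_prop) ?_
    intro g hg
    exact one_sub_ne_zero_of_norm_lt (by simpa using hg)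
  exact h.congr fun g hg => coe_cayInv (by simpa using hg)

lemma continuous_cay : Continuous cay := by
  unfold cay
  exact (UpperHalfPlane.continuous_coe.sub continuous_const).div
    (UpperHalfPlane.continuous_coe.add continuous_const) coe_add_I_ne_zero

/-- `α` is a holomorphic self-map of the hyperbolic plane. -/
def HolUHP (α : ℍ → ℍ) : Prop :=
  ∀ z : ℍ, DifferentiableAt ℂ (fun s : ℂ => (α (UpperHalfPlane.ofComplex s) : ℂ)) z

lemma holUHP_smul (a : SL(2, ℝ)) : HolUHP fun z => a • z := by
  intro z
  have h : DifferentiableAt ℂ (fun s : ℂ => (((a 0 0 : ℝ) : ℂ) * s + ((a 0 1 : ℝ) : ℂ)) /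
      (((a 1 0 : ℝ) : ℂ) * s + ((a 1 1 : ℝ) : ℂ))) z :=
    DifferentiableAt.div (by fun_prop) (by fun_prop) (sl_denom_ne a z)
  refine h.congr_of_eventuallyEq ?_
  change ∀ᶠ s in 𝓝 (z : ℂ), _
  rw [eventually_coe_UHP]
  refine Eventually.of_forall fun w => ?_
  simp only [UpperHalfPlane.ofComplex_apply]
  exact sl_coe a w

lemma HolUHP.comp {α β : ℍ → ℍ} (hα : HolUHP α) (hβ : HolUHP β) : HolUHP (α ∘ β) := by
  intro z
  have h1 := hβ z
  have h2 : DifferentiableAt ℂ (fun s : ℂ => (α (UpperHalfPlane.ofComplex s) : ℂ))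
      ((β (UpperHalfPlane.ofComplex z) : ℍ) : ℂ) := hα _
  have h3 := DifferentiableAt.comp (g := fun s : ℂ => (α (UpperHalfPlane.ofComplex s) : ℂ))
    (z : ℂ) h2 h1
  refine h3.congr_of_eventuallyEq (Eventually.of_forall fun s => ?_)
  simp

lemma HolUHP.differentiableOn_disc {α : ℍ → ℍ} (hα : HolUHP α) :
    DifferentiableOn ℂ (fun g => cay (α (cayInv g))) (Metric.ball 0 1) := by
  have h : DifferentiableOn ℂ (fun g => (α (cayInv g) : ℂ)) (Metric.ball 0 1) := by
    intro g hg
    have h1 := (hα (cayInv g)).comp_differentiableWithinAt g (differentiableOn_cayInv g hg)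
    refine h1.congr (fun w _ => by simp) (by simp)
  unfold cay
  exact (h.sub_const _).div (h.add_const _) fun g _ => coe_add_I_ne_zero _

lemma HolUHP.norm_cay_le {α : ℍ → ℍ} (hα : HolUHP α) (hI : α UpperHalfPlane.I = UpperHalfPlane.I)
    (z : ℍ) : ‖cay (α z)‖ ≤ ‖cay z‖ := by
  have h := Complex.norm_le_norm_of_mapsTo_ball (z := cay z) hα.differentiableOn_disc
    (fun g _ => by simpa using (norm_cay_lt _).le) (by simp [cayInv_zero, hI, cay_I])
    (norm_cay_lt z)
  simpa [cayInv_cay] using h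

lemma HolUHP.exists_rotation {α β : ℍ → ℍ} (hα : HolUHP α) (hβ : HolUHP β)
    (hβα : ∀ z, β (α z) = z) (hI : α UpperHalfPlane.I = UpperHalfPlane.I) :
    ∃ c : ℂ, ‖c‖ = 1 ∧ ∀ z, cay (α z) = c * cay z := by
  have hIβ : β UpperHalfPlane.I = UpperHalfPlane.I := by
    have := hβα UpperHalfPlane.I
    rwa [hI] at this
  have hn : ∀ z, ‖cay (α z)‖ = ‖cay z‖ := by
    intro z
    refine le_antisymm (hα.norm_cay_le hI z) ?_
    have := hβ.norm_cay_le hIβ (α z)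
    rwa [hβα] at this
  set f : ℂ → ℂ := fun g => cay (α (cayInv g)) with hf
  have hf0 : f 0 = 0 := by simp [hf, cayInv_zero, hI, cay_I]
  have hhalf : ‖(1 / 2 : ℂ)‖ < 1 := by norm_num
  obtain ⟨C, hC, hCf⟩ := Complex.affine_of_mapsTo_ball_of_exists_norm_dslope_eq_div'
    (f := f) (c := 0) (R₁ := 1) (R₂ := 1) hα.differentiableOn_disc
    (fun g _ => by
      rw [hf0, mem_closedBall_zero_iff]
      exact (norm_cay_lt _).le) ⟨1 / 2, by simpa using hhalf, by
      rw [dslope_of_ne _ (by norm_num), slope_def_field, hf0, sub_zero, sub_zero, norm_div]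
      simp only [hf]
      rw [hn, cay_cayInv hhalf]
      norm_num⟩
  refine ⟨C, by simpa using hC, fun z => ?_⟩
  have h1 := hCf (x := cay z) (by simpa using norm_cay_lt z)
  simp only [hf0, sub_zero, zero_add, smul_eq_mul] at h1
  simp only [hf, cayInv_cay] at h1
  rw [h1, mul_comm]

/-- The rotation about `i`. -/
def rotMatrix (θ : ℝ) : SL(2, ℝ) :=
  ⟨!![Real.cos θ, Real.sin θ; -Real.sin θ, Real.cos θ], by
    rw [Matrix.det_fin_two]
    simp
    nlinarith [Real.sin_sq_add_cos_sq θ]⟩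

lemma cay_rotMatrix_smul (θ : ℝ) (z : ℍ) :
    cay (rotMatrix θ • z) = Complex.exp (2 * θ * Complex.I) * cay z := by
  have h1 := sl_denom_ne (rotMatrix θ) z
  have h3 := coe_add_I_ne_zero z
  have h2 := coe_add_I_ne_zero (rotMatrix θ • z)
  rw [cay, cay]
  rw [sl_coe] at h2 ⊢
  simp only [rotMatrix, Matrix.of_apply, Matrix.cons_val', Matrix.cons_val_zero,
    Matrix.cons_val_one, Matrix.cons_val_fin_one] at h1 h2 ⊢
  have h4 : Complex.exp (2 * θ * Complex.I) =
      (Complex.cos θ + Complex.sin θ * Complex.I) ^ 2 := by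
    rw [← Complex.exp_mul_I, ← Complex.exp_nat_mul]
    congr 1
    push_cast
    ring
  rw [h4]
  push_cast at h1 h2 ⊢
  have h5 := Complex.sin_sq_add_cos_sq (θ : ℂ)
  have h6 := Complex.I_sq
  set s := Complex.sin (θ : ℂ)
  set c := Complex.cos (θ : ℂ)
  have h7 : (c * z + s) / (-s * z + c) - Complex.I =
      (c + s * Complex.I) * (z - Complex.I) / (-s * z + c) := by
    rw [eq_div_iff h1, sub_mul, div_mul_cancel₀ _ h1]
    linear_combination s * h6
  have h8 : (c + s * Complex.I) * ((c * z + s) / (-s * z + c) + Complex.I) =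
      (z + Complex.I) / (-s * z + c) := by
    rw [eq_div_iff h1, mul_assoc, add_mul (_ / _), div_mul_cancel₀ _ h1]
    linear_combination (z + Complex.I) * h5 + (s * c - z * s ^ 2) * h6
  rw [mul_div_assoc', div_eq_div_iff h2 h3, h7]
  calc (c + s * Complex.I) * (z - Complex.I) / (-s * z + c) * (z + Complex.I)
      = (c + s * Complex.I) * (z - Complex.I) * ((z + Complex.I) / (-s * z + c)) := by ring
    _ = _ := by rw [← h8]; ring

lemma exists_rotMatrix {c : ℂ} (hc : ‖c‖ = 1) : ∃ k : SL(2, ℝ), ∀ z : ℍ, cay (k • z) = c * cay z := by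
  refine ⟨rotMatrix (c.arg / 2), fun z => ?_⟩
  rw [cay_rotMatrix_smul]
  congr 1
  have := Complex.norm_mul_exp_arg_mul_I c
  rw [hc] at this
  conv_rhs => rw [← this]
  push_cast
  rw [one_mul]
  congr 1
  ring_nf

lemma HolUHP.exists_sl {α β : ℍ → ℍ} (hα : HolUHP α) (hβ : HolUHP β)
    (hβα : ∀ z, β (α z) = z) : ∃ a : SL(2, ℝ), ∀ z, α z = a • z := by
  obtain ⟨b, hb⟩ := MulAction.exists_smul_eq SL(2, ℝ) (α UpperHalfPlane.I) UpperHalfPlane.I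
  obtain ⟨c, hc, hcz⟩ := ((holUHP_smul b).comp hα).exists_rotation (hβ.comp (holUHP_smul b⁻¹))
    (fun z => by simp [hβα]) hb
  obtain ⟨k, hk⟩ := exists_rotMatrix hc
  refine ⟨b⁻¹ * k, fun z => ?_⟩
  rw [mul_smul, eq_inv_smul_iff]
  apply cay_injective
  rw [hk]
  exact hcz z

/-! ### The extended group -/

lemma eq_one_or_neg_one_of_smul_eq {a : SL(2, ℝ)} {z w : ℍ} (hzw : z ≠ w) (hz : a • z = z)
    (hw : a • w = w) : a = 1 ∨ a = -1 := by
  have key : ∀ z : ℍ, a • z = z → 2 * a 1 0 * z.re + (a 1 1 - a 0 0) = 0 ∧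
      a 1 0 * (z.re ^ 2 - z.im ^ 2) + (a 1 1 - a 0 0) * z.re - a 0 1 = 0 := by
    intro z hz
    have h1 := congrArg UpperHalfPlane.coe hz
    rw [sl_coe, div_eq_iff (sl_denom_ne a z)] at h1
    have h2 := congrArg Complex.re h1
    have h3 := congrArg Complex.im h1
    simp at h2 h3
    have h4 := z.im_pos
    constructor
    · have : z.im * (2 * a 1 0 * z.re + (a 1 1 - a 0 0)) = 0 := by linear_combination -h3
      exact (mul_eq_zero.1 this).resolve_left h4.ne'
    · linear_combination -h2
  obtain ⟨h1, h2⟩ := key z hz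
  obtain ⟨h3, h4⟩ := key w hw
  have hc : a 1 0 = 0 := by
    by_contra hc
    have hre : z.re = w.re := by
      have : a 1 0 * (z.re - w.re) = 0 := by linear_combination (h1 - h3) / 2
      exact sub_eq_zero.1 ((mul_eq_zero.1 this).resolve_left hc)
    have him : z.im ^ 2 = w.im ^ 2 := by
      have : a 1 0 * (w.im ^ 2 - z.im ^ 2) = 0 := by rw [hre] at h2; linear_combination h2 - h4
      exact (sub_eq_zero.1 ((mul_eq_zero.1 this).resolve_left hc)).symm
    have him' : z.im = w.im := (pow_left_inj₀ z.im_pos.le w.im_pos.le two_ne_zero).1 him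
    exact hzw (UpperHalfPlane.ext (Complex.ext hre him'))
  have hd : a 1 1 = a 0 0 := by rw [hc] at h1; linarith
  have hb : a 0 1 = 0 := by rw [hc, hd] at h2; linarith
  have hdet := sl_det a
  rw [hc, hd, hb] at hdet
  have h5 : (a 0 0 - 1) * (a 0 0 + 1) = 0 := by linear_combination hdet
  rcases mul_eq_zero.1 h5 with h | h
  · left
    ext i j
    fin_cases i <;> fin_cases j <;> simp [hc, hd, hb] <;> linarith
  · right
    ext i j
    fin_cases i <;> fin_cases j <;> simp [hc, hd, hb] <;> linarith

/-- The group of all automorphisms `a` of `ℍ` which lift a monodromy transformation of the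
developing map `F`. -/
def developGroup (Γ : Subgroup SL(2, ℝ)) (F : ℍ → OnePoint ℂ) : Subgroup SL(2, ℝ) where
  carrier := {a | ∃ γ ∈ Γ, ∃ g : GL (Fin 2) ℂ, (∀ z, F (γ • z) = g • F z) ∧ ∀ z, F (a • z) = g • F z}
  mul_mem' := by
    rintro a b ⟨γ, hγ, g, h1, h2⟩ ⟨δ, hδ, k, h3, h4⟩
    exact ⟨γ * δ, mul_mem hγ hδ, g * k, fun z => by rw [mul_smul, h1, h3, mul_smul],
      fun z => by rw [mul_smul, h2, h4, mul_smul]⟩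
  one_mem' := ⟨1, one_mem _, 1, by simp, by simp⟩
  inv_mem' := by
    rintro a ⟨γ, hγ, g, h1, h2⟩
    exact ⟨γ⁻¹, inv_mem hγ, g⁻¹, fun z => by rw [eq_inv_smul_iff, ← h1, smul_inv_smul],
      fun z => by rw [eq_inv_smul_iff, ← h2, smul_inv_smul]⟩

variable {Γ : Subgroup SL(2, ℝ)} {A : Set (Orbifold Γ)} {F : ℍ → OnePoint ℂ}

lemma IsDeveloping.le_developGroup (hF : IsDeveloping Γ A F) : Γ ≤ developGroup Γ F := by
  intro γ hγ
  obtain ⟨g, hg⟩ := hF.equivariant γ hγ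
  exact ⟨γ, hγ, g, hg, hg⟩

lemma LocBihol.exists_hol_lift (hF : LocBihol F) (hcov : IsCoveringMapOn F (range F))
    {g : GL (Fin 2) ℂ} (hg : ∀ z, g • F z ∈ range F) {z w : ℍ} (hzw : F w = g • F z) :
    ∃ α : ℍ → ℍ, Continuous α ∧ HolUHP α ∧ α z = w ∧ ∀ v, F (α v) = g • F v := by
  obtain ⟨α, ⟨hα, hα'⟩, -⟩ := hcov.existsUnique_continuousMap_lifts
    (f := ⟨fun z => g • F z, (continuous_gl_smul g).comp hF.continuous⟩) (a₀ := z) (e₀ := w) hzw hg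
  have hα' : ∀ v, F (α v) = g • F v := congrFun hα'
  refine ⟨α, α.continuous, fun v => ?_, hα, hα'⟩
  obtain ⟨k, f, hf, -, hkf⟩ := hF v
  have hc : ContinuousAt (fun s : ℂ => α (UpperHalfPlane.ofComplex s)) v := by
    refine α.continuous.continuousAt.comp ?_
    exact (UpperHalfPlane.contMDiffAt_ofComplex (n := 0) v.im_pos).continuousAt
  refine hF.differentiableAt_lift hc (g * k⁻¹) f hf.differentiableAt ?_
  rw [eventually_coe_UHP]
  filter_upwards [hkf] with u hu
  rw [UpperHalfPlane.ofComplex_apply, hα', ← hu, mul_smul, inv_smul_smul]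

theorem IsDeveloping.exists_mem_developGroup [DiscreteTopology Γ] (hF : IsDeveloping Γ A F)
    (hAc : IsClosed A) (hAd : DiscreteTopology A) {γ : SL(2, ℝ)} (hγ : γ ∈ Γ)
    {g : GL (Fin 2) ℂ} (hg : ∀ z, F (γ • z) = g • F z) {z w : ℍ} (hzw : F w = g • F z) :
    ∃ a ∈ developGroup Γ F, a • z = w ∧ ∀ v, F (a • v) = g • F v := by
  have hcov := hF.isCoveringMapOn_range hAc hAd
  have hL := hF.locBihol
  have hg' : ∀ z, F (γ⁻¹ • z) = g⁻¹ • F z := fun z => by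
    rw [eq_inv_smul_iff, ← hg, smul_inv_smul]
  obtain ⟨α, hαc, hαh, hαz, hαF⟩ := hL.exists_hol_lift hcov (fun z => ⟨_, hg z⟩) hzw
  obtain ⟨β, hβc, hβh, hβw, hβF⟩ := hL.exists_hol_lift hcov (fun z => ⟨_, hg' z⟩)
    (z := w) (w := z) (by rw [hzw, inv_smul_smul])
  have hβα : ∀ v, β (α v) = v := fun v =>
    hL.eqOn_of_comp_eqOn isPreconnected_univ (hβc.comp hαc).continuousOn continuousOn_id
      (fun a _ => by simp [hβF, hαF]) (mem_univ z) (by simp [hαz, hβw]) (mem_univ v)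
  obtain ⟨a, ha⟩ := hαh.exists_sl hβh hβα
  have haF : ∀ v, F (a • v) = g • F v := fun v => by rw [← ha, hαF]
  exact ⟨a, ⟨γ, hγ, g, hg, haF⟩, by rw [← ha, hαz], haF⟩

theorem IsDeveloping.discreteTopology_developGroup [DiscreteTopology Γ]
    (hF : IsDeveloping Γ A F) (hAc : IsClosed A) (hAd : DiscreteTopology A) :
    DiscreteTopology (developGroup Γ F) := by
  have hL := hF.locBihol
  obtain ⟨z₁, hz₁⟩ := (isPathConnected_compl_of_discrete
    (eventually_proj_notMem Γ hAc hAd)).nonempty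
  obtain ⟨z₂, hz₂⟩ := (eventually_mem_nhdsWithin (s := ({z₁}ᶜ : Set ℍ)) (a := z₁)).exists
  obtain ⟨V, hV, hfin⟩ := hF.discontinuous z₁ hz₁
  obtain ⟨N₁, hN₁, hi₁⟩ := hL.exists_injOn z₁
  obtain ⟨N₂, hN₂, hi₂⟩ := hL.exists_injOn z₂
  have hcont : ∀ z : ℍ, Tendsto (fun a : SL(2, ℝ) => a • z) (𝓝 1) (𝓝 z) := by
    intro z
    have : Continuous fun a : SL(2, ℝ) => a • z := by fun_prop
    simpa using this.tendsto 1
  have hW : ∀ᶠ a : SL(2, ℝ) in 𝓝 1, F (a • z₁) ∈ V ∧ a • z₁ ∈ N₁ ∧ a • z₂ ∈ N₂ :=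
    (((hL.continuous.tendsto z₁).comp (hcont z₁)).eventually hV).and
      (((hcont z₁).eventually hN₁).and ((hcont z₂).eventually hN₂))
  have hWfin : {a : SL(2, ℝ) | a ∈ developGroup Γ F ∧
      F (a • z₁) ∈ V ∧ a • z₁ ∈ N₁ ∧ a • z₂ ∈ N₂}.Finite := by
    have hm : ∀ a ∈ developGroup Γ F, ∃ m : Equiv.Perm (OnePoint ℂ), (∀ z, F (a • z) = m (F z)) ∧
        ∃ γ ∈ Γ, ∃ g : GL (Fin 2) ℂ, m = MulAction.toPermHom (GL (Fin 2) ℂ) (OnePoint ℂ) g ∧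
          ∀ z, F (γ • z) = g • F z := by
      rintro a ⟨γ, hγ, g, h1, h2⟩
      exact ⟨_, h2, γ, hγ, g, rfl, h1⟩
    choose! m hmF hmΓ using hm
    refine Set.Finite.of_finite_fibers m (hfin.subset ?_) ?_
    · rintro _ ⟨a, ⟨ha, haV, -⟩, rfl⟩
      exact ⟨hmΓ a ha, F (a • z₁), ⟨F z₁, mem_of_mem_nhds hV, (hmF a ha z₁).symm⟩, haV⟩
    · intro x _
      by_cases hne : ({a : SL(2, ℝ) | a ∈ developGroup Γ F ∧
        F (a • z₁) ∈ V ∧ a • z₁ ∈ N₁ ∧ a • z₂ ∈ N₂} ∩ m ⁻¹' {x}).Nonempty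
      · obtain ⟨b, ⟨hb, -, hb₁, hb₂⟩, rfl⟩ := hne
        refine (Set.toFinite {b, -b}).subset ?_
        rintro a ⟨⟨ha, -, ha₁, ha₂⟩, hab⟩
        have hab : m a = m b := hab
        have e1 : a • z₁ = b • z₁ := hi₁ ha₁ hb₁ (by rw [hmF a ha, hmF b hb, hab])
        have e2 : a • z₂ = b • z₂ := hi₂ ha₂ hb₂ (by rw [hmF a ha, hmF b hb, hab])
        rcases eq_one_or_neg_one_of_smul_eq (a := b⁻¹ * a) (Ne.symm hz₂)
          (by rw [mul_smul, e1, inv_smul_smul]) (by rw [mul_smul, e2, inv_smul_smul]) with h | h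
        · left
          exact (inv_mul_eq_one.1 h).symm
        · right
          rw [inv_mul_eq_iff_eq_mul] at h
          simpa using h
      · rw [not_nonempty_iff_eq_empty.1 hne]
        exact finite_empty
  apply discreteTopology_of_isOpen_singleton_one
  rw [isOpen_iff_mem_nhds]
  rintro _ rfl
  have h1 : ∀ᶠ a : SL(2, ℝ) in 𝓝 1, (F (a • z₁) ∈ V ∧ a • z₁ ∈ N₁ ∧ a • z₂ ∈ N₂) ∧
      a ∉ {a : SL(2, ℝ) | a ∈ developGroup Γ F ∧
        F (a • z₁) ∈ V ∧ a • z₁ ∈ N₁ ∧ a • z₂ ∈ N₂} \ {1} :=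
    hW.and ((hWfin.subset sdiff_subset).isClosed.isOpen_compl.mem_nhds (fun h => h.2 rfl))
  have h2 : ∀ᶠ a : developGroup Γ F in 𝓝 1, _ :=
    (continuous_subtype_val.tendsto (1 : developGroup Γ F)).eventually h1
  filter_upwards [h2] with a ha
  by_contra hne
  exact ha.2 ⟨⟨a.2, ha.1⟩, fun h => hne (Subtype.ext h)⟩

end

section

/-! ### Elliptic and parabolic elements -/

lemma sl_neg_smul (a : SL(2, ℝ)) (z : ℍ) : (-a) • z = a • z := by
  rw [← neg_one_mul, mul_smul, sl_neg_one_smul]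

lemma smul_eq_iff_quadratic (a : SL(2, ℝ)) (z : ℍ) : a • z = z ↔
    2 * a 1 0 * z.re + (a 1 1 - a 0 0) = 0 ∧
      a 1 0 * (z.re ^ 2 - z.im ^ 2) + (a 1 1 - a 0 0) * z.re - a 0 1 = 0 := by
  rw [← UpperHalfPlane.coe_inj, sl_coe, div_eq_iff (sl_denom_ne a z), Complex.ext_iff]
  simp
  have h4 := z.im_pos
  constructor
  · rintro ⟨h2, h3⟩
    constructor
    · have : z.im * (2 * a 1 0 * z.re + (a 1 1 - a 0 0)) = 0 := by linear_combination -h3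
      exact (mul_eq_zero.1 this).resolve_left h4.ne'
    · linear_combination -h2
  · rintro ⟨h2, h3⟩
    exact ⟨by linear_combination -h3, by linear_combination -z.im * h2⟩

lemma exists_smul_eq_of_trace {a : SL(2, ℝ)} (ha : (a 0 0 + a 1 1) ^ 2 < 4) :
    ∃ z : ℍ, a • z = z := by
  have hdet := sl_det a
  have hc : a 1 0 ≠ 0 := by
    intro hc
    rw [hc] at hdet
    nlinarith [sq_nonneg (a 0 0 - a 1 1)]
  have h1 : 0 < 4 - (a 0 0 + a 1 1) ^ 2 := by linarith
  have h2 : 0 < Real.sqrt (4 - (a 0 0 + a 1 1) ^ 2) / (2 * |a 1 0|) := by positivity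
  refine ⟨⟨⟨(a 0 0 - a 1 1) / (2 * a 1 0), _⟩, h2⟩, ?_⟩
  rw [smul_eq_iff_quadratic]
  change 2 * a 1 0 * ((a 0 0 - a 1 1) / (2 * a 1 0)) + (a 1 1 - a 0 0) = 0 ∧
    a 1 0 * (((a 0 0 - a 1 1) / (2 * a 1 0)) ^ 2 -
      (Real.sqrt (4 - (a 0 0 + a 1 1) ^ 2) / (2 * |a 1 0|)) ^ 2) +
      (a 1 1 - a 0 0) * ((a 0 0 - a 1 1) / (2 * a 1 0)) - a 0 1 = 0
  rw [div_pow _ (2 * |a 1 0|), Real.sq_sqrt h1.le, mul_pow, sq_abs]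
  constructor
  · field_simp; ring
  · field_simp
    linear_combination 4 * hdet

/-- An element with arbitrarily small displacement is not hyperbolic. -/
lemma trace_sq_le_of_displacement {a : SL(2, ℝ)}
    (h : ∀ ρ > 0, ∃ z : ℍ, dist (z : ℂ) ((a • z : ℍ) : ℂ) < ρ * z.im) : (a 0 0 + a 1 1) ^ 2 ≤ 4 := by
  by_contra! hlt
  set ε := (a 0 0 + a 1 1) ^ 2 - 4 with hε
  have hε0 : 0 < ε := by linarith
  obtain ⟨ρ, hρ, hρ1, hρ2⟩ : ∃ ρ : ℝ, 0 < ρ ∧ ρ ≤ 1 / 2 ∧ ρ ≤ ε / 2 :=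
    ⟨min (1 / 2) (ε / 2), by positivity, min_le_left _ _, min_le_right _ _⟩
  obtain ⟨z, hz⟩ := h ρ hρ
  have hy := z.im_pos
  have hd := sl_denom_ne a z
  set D : ℂ := ((a 1 0 : ℝ) : ℂ) * z + ((a 1 1 : ℝ) : ℂ) with hD
  set Q : ℂ := (a 1 0 : ℝ) * (z : ℂ) ^ 2 + ((a 1 1 : ℝ) - (a 0 0 : ℝ) : ℂ) * z - (a 0 1 : ℝ) with hQ
  have h1 : (z : ℂ) - ((a • z : ℍ) : ℂ) = Q / D := by
    rw [sl_coe, eq_div_iff hd, sub_mul, div_mul_cancel₀ _ hd]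
    simp only [hQ, hD]
    ring
  have h2 : (a • z).im = z.im / Complex.normSq D := by
    have := UpperHalfPlane.coe_im (a • z)
    rw [← this, sl_coe, Complex.div_im]
    have hdet := sl_det a
    simp
    field_simp
    linear_combination
      (Complex.normSq (((a 1 0 : ℝ) : ℂ) * z + ((a 1 1 : ℝ) : ℂ)))⁻¹ * hdet
  have hN : 0 < Complex.normSq D := Complex.normSq_pos.2 hd
  have hQn : ε * z.im ^ 2 ≤ Complex.normSq Q := by
    have hdet := sl_det a
    have : Complex.normSq Q = (a 1 0 * z.re ^ 2 + (a 1 1 - a 0 0) * z.re - a 0 1 +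
        a 1 0 * z.im ^ 2) ^ 2 + ε * z.im ^ 2 := by
      rw [hQ, Complex.normSq_apply]
      simp [pow_two, hε]
      linear_combination (-4 * z.im * z.im) * hdet
    rw [this]
    nlinarith [sq_nonneg (a 1 0 * z.re ^ 2 + (a 1 1 - a 0 0) * z.re - a 0 1 + a 1 0 * z.im ^ 2)]
  have h3 : (1 - ρ) * z.im ≤ (a • z).im := by
    have e1 : ((z : ℂ) - ((a • z : ℍ) : ℂ)).im ≤ ‖(z : ℂ) - ((a • z : ℍ) : ℂ)‖ :=
      (le_abs_self _).trans (Complex.abs_im_le_norm _)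
    rw [dist_eq_norm] at hz
    have e2 : ((z : ℂ) - ((a • z : ℍ) : ℂ)).im = z.im - (a • z).im := rfl
    rw [e2] at e1
    linarith
  have h4 : (dist (z : ℂ) ((a • z : ℍ) : ℂ)) ^ 2 = Complex.normSq Q / Complex.normSq D := by
    rw [dist_eq_norm, ← Complex.normSq_eq_norm_sq, h1, map_div₀]
  have h5 : ε * z.im * (a • z).im ≤ (dist (z : ℂ) ((a • z : ℍ) : ℂ)) ^ 2 := by
    rw [h4, h2, mul_div_assoc']
    gcongr
    linarith
  have h6 : (dist (z : ℂ) ((a • z : ℍ) : ℂ)) ^ 2 < (ρ * z.im) ^ 2 := by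
    gcongr
  have h7 : ε * z.im * ((1 - ρ) * z.im) ≤ ε * z.im * (a • z).im := by gcongr
  have h8 : 0 < z.im ^ 2 := by positivity
  have h9 : ρ ^ 2 ≤ ε * (1 - ρ) := by nlinarith
  nlinarith

/-- The matrix of the translation by `t`. -/
def transMatrix (t : ℝ) : SL(2, ℝ) := ⟨!![1, t; 0, 1], by simp [Matrix.det_fin_two]⟩

lemma transMatrix_smul (t : ℝ) (z : ℍ) : transMatrix t • z = t +ᵥ z := by
  apply UpperHalfPlane.coe_injective
  rw [sl_coe, UpperHalfPlane.coe_vadd]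
  simp [transMatrix, add_comm]

lemma sl_mul_apply (a b : SL(2, ℝ)) (i j : Fin 2) :
    (a * b) i j = a i 0 * b 0 j + a i 1 * b 1 j := by
  rw [Matrix.SpecialLinearGroup.coe_mul, Matrix.mul_apply, Fin.sum_univ_two]

lemma exists_sl_entries {a b c d : ℝ} (h : a * d - b * c = 1) :
    ∃ g : SL(2, ℝ), g 0 0 = a ∧ g 0 1 = b ∧ g 1 0 = c ∧ g 1 1 = d :=
  ⟨⟨!![a, b; c, d], by rw [Matrix.det_fin_two]; simpa using h⟩, rfl, rfl, rfl, rfl⟩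

lemma exists_conj_translation {a : SL(2, ℝ)} (htr : (a 0 0 + a 1 1) ^ 2 = 4) (h1 : a ≠ 1)
    (h2 : a ≠ -1) : ∃ g : SL(2, ℝ), ∃ δ : ℝ, (δ = 1 ∨ δ = -1) ∧ ∀ z : ℍ, a • (g • z) = g • (δ +ᵥ z) := by
  have hdet := sl_det a
  have t00 : ∀ t, transMatrix t 0 0 = 1 := fun t => rfl
  have t01 : ∀ t, transMatrix t 0 1 = t := fun t => rfl
  have t10 : ∀ t, transMatrix t 1 0 = 0 := fun t => rfl
  have t11 : ∀ t, transMatrix t 1 1 = 1 := fun t => rfl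
  obtain ⟨ε, hε, hεt⟩ : ∃ ε : ℝ, ε ^ 2 = 1 ∧ a 0 0 + a 1 1 = 2 * ε :=
    ⟨(a 0 0 + a 1 1) / 2, by linarith, by ring⟩
  have hε' : ε = 1 ∨ ε = -1 := mul_self_eq_one_iff.1 (by rw [← sq]; exact hε)
  have key : ∀ (g : SL(2, ℝ)) (δ : ℝ), (∀ i j, (a * g) i j = ε * (g * transMatrix δ) i j) →
      ∀ z : ℍ, a • (g • z) = g • (δ +ᵥ z) := by
    intro g δ h z
    rw [← transMatrix_smul, ← mul_smul, ← mul_smul]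
    rcases hε' with rfl | rfl
    · have : a * g = g * transMatrix δ := by
        ext i j
        rw [h, one_mul]
      rw [this]
    · have : a * g = -(g * transMatrix δ) := by
        ext i j
        rw [h]; simp
      rw [this, sl_neg_smul]
  by_cases hc : a 1 0 = 0
  · have hd : a 1 1 = a 0 0 := by
      rw [hc] at hdet
      nlinarith [sq_nonneg (a 0 0 - a 1 1)]
    have ha : a 0 0 = ε := by linarith
    have hb : a 0 1 ≠ 0 := by
      intro hb
      rcases hε' with rfl | rfl
      · apply h1
        ext i j
        fin_cases i <;> fin_cases j <;> simp [hc, hd, hb, ha]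
      · apply h2
        ext i j
        fin_cases i <;> fin_cases j <;> simp [hc, hd, hb, ha]
    have hs : Real.sqrt |a 0 1| ≠ 0 := by positivity
    have hss : Real.sqrt |a 0 1| * Real.sqrt |a 0 1| = |a 0 1| := Real.mul_self_sqrt (abs_nonneg _)
    obtain ⟨δ, hδ, hδb⟩ : ∃ δ : ℝ, (δ = 1 ∨ δ = -1) ∧ ε * |a 0 1| * δ = a 0 1 := by
      rcases hε' with rfl | rfl <;> rcases abs_cases (a 0 1) with h | h
      · exact ⟨1, Or.inl rfl, by linarith⟩
      · exact ⟨-1, Or.inr rfl, by linarith⟩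
      · exact ⟨-1, Or.inr rfl, by linarith⟩
      · exact ⟨1, Or.inl rfl, by linarith⟩
    set s := Real.sqrt |a 0 1| with hs'
    rw [← hss] at hδb
    obtain ⟨g, g00, g01, g10, g11⟩ := exists_sl_entries (a := s) (b := 0) (c := 0) (d := s⁻¹)
      (by field_simp; ring)
    refine ⟨g, δ, hδ, key g δ ?_⟩
    simp only [Fin.forall_fin_two, sl_mul_apply, g00, g01, g10, g11, hc, hd, ha, t00, t01, t10, t11]
    refine ⟨⟨by ring, ?_⟩, by ring, by ring⟩
    field_simp
    linear_combination -hδb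
  · set p := (a 0 0 - a 1 1) / (2 * a 1 0) with hp
    have hpc : p * a 1 0 = (a 0 0 - a 1 1) / 2 := by rw [hp]; field_simp
    have hs : Real.sqrt |a 1 0| ≠ 0 := by positivity
    have hss : Real.sqrt |a 1 0| * Real.sqrt |a 1 0| = |a 1 0| := Real.mul_self_sqrt (abs_nonneg _)
    set s := Real.sqrt |a 1 0| with hs'
    obtain ⟨δ, hδ, hδb⟩ : ∃ δ : ℝ, (δ = 1 ∨ δ = -1) ∧ ε * |a 1 0| * δ = -a 1 0 := by
      rcases hε' with rfl | rfl <;> rcases abs_cases (a 1 0) with h | h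
      · exact ⟨-1, Or.inr rfl, by linarith⟩
      · exact ⟨1, Or.inl rfl, by linarith⟩
      · exact ⟨1, Or.inl rfl, by linarith⟩
      · exact ⟨-1, Or.inr rfl, by linarith⟩
    rw [← hss] at hδb
    have hd : a 1 1 = 2 * ε - a 0 0 := by linarith
    rw [hd] at hdet hpc
    obtain ⟨g, g00, g01, g10, g11⟩ := exists_sl_entries (a := p * s) (b := -s⁻¹) (c := s) (d := 0)
      (by field_simp; ring)
    refine ⟨g, δ, hδ, key g δ ?_⟩
    simp only [Fin.forall_fin_two, sl_mul_apply, g00, g01, g10, g11, hd, t00, t01, t10, t11]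
    clear_value p s
    refine ⟨⟨?_, ?_⟩, ?_, ?_⟩
    · have e1 : a 1 0 * (a 0 0 * p + a 0 1 - ε * p) = 0 := by
        linear_combination (a 0 0 - ε) * hpc - hdet + hε
      have := (mul_eq_zero.1 e1).resolve_left hc
      linear_combination s * this
    · field_simp
      linear_combination -p * hδb + hpc
    · linear_combination s * hpc
    · field_simp
      linear_combination -hδb

lemma differentiableAt_of_comp {G : ℂ → ℂ} {s : ℂ} (hG : ContinuousAt G s) {f k : ℂ → ℂ}
    (hf : AnalyticAt ℂ f (G s)) (hf' : deriv f (G s) ≠ 0) (hk : DifferentiableAt ℂ k s)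
    (h : ∀ᶠ t in 𝓝 s, f (G t) = k t) : DifferentiableAt ℂ G s := by
  have hs := hf.hasStrictDerivAt
  have h3 := hG.eventually (hs.eventually_left_inverse hf')
  have h4 : DifferentiableAt ℂ (fun t => f (G t)) s := hk.congr_of_eventuallyEq h
  have h5 : DifferentiableAt ℂ (fun t => hs.localInverse f (deriv f (G s)) (G s) hf' (f (G t))) s :=
    DifferentiableAt.comp s (hs.to_localInverse hf').hasDerivAt.differentiableAt h4
  refine h5.congr_of_eventuallyEq ?_
  filter_upwards [h3] with t ht using ht.symm

/-! ### The quotient map to the compact surface -/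

variable {Γ : Subgroup SL(2, ℝ)}

lemma finite_stabilizer [DiscreteTopology Γ] (z : ℍ) : {γ : SL(2, ℝ) | γ ∈ Γ ∧ γ • z = z}.Finite := by
  refine (finite_smul_mem_compact Γ (isCompact_singleton (x := z))
    (isCompact_singleton (x := z))).subset ?_
  rintro γ ⟨hγ, h⟩
  exact ⟨hγ, z, rfl, h⟩

lemma eventually_proj_ne [DiscreteTopology Γ] (z : ℍ) : ∀ᶠ w in 𝓝[≠] z, proj Γ w ≠ proj Γ z := by
  obtain ⟨U, hU, h⟩ := exists_nhds_smul_eq_self Γ z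
  filter_upwards [mem_nhdsWithin_of_mem_nhds hU, self_mem_nhdsWithin] with w hw hwz hwz2
  obtain ⟨γ, hγ, rfl⟩ := (proj_eq_iff Γ).1 hwz2
  exact hwz (h γ hγ z (mem_of_mem_nhds hU) hw)

lemma injOn_nhds_of_fibres [DiscreteTopology Γ] {X : Type*} {π : ℍ → X}
    (hπΓ : ∀ z w : ℍ, π z = π w ↔ proj Γ z = proj Γ w)
    {z : ℍ} (hz : proj Γ z ∉ conePoints Γ) : ∃ N ∈ 𝓝 z, InjOn π N := by
  obtain ⟨N, hN, hi⟩ := exists_injOn_proj Γ hz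
  exact ⟨N, hN, fun a ha b hb h => hi ha hb ((hπΓ a b).1 h)⟩

variable {X : Type} [TopologicalSpace X] [ChartedSpace ℂ X] [IsManifold 𝓘(ℂ) ω X] {π : ℍ → X}

lemma analyticAt_chart_comp (hπ : MDifferentiable 𝓘(ℂ) 𝓘(ℂ) π) {e : OpenPartialHomeomorph X ℂ}
    (he : e ∈ atlas ℂ X) {z : ℍ} (hz : π z ∈ e.source) :
    AnalyticAt ℂ (fun s => e (π (UpperHalfPlane.ofComplex s))) z := by
  have : IsManifold 𝓘(ℂ) 1 X := IsManifold.of_le (n := ω) (by simp)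
  have h1 : ∀ w : ℍ, π w ∈ e.source →
      DifferentiableAt ℂ (fun s => e (π (UpperHalfPlane.ofComplex s))) w := by
    intro w hw
    have h2 : MDifferentiableAt 𝓘(ℂ) 𝓘(ℂ) (fun v => e (π v)) w :=
      (mdifferentiableAt_atlas he hw).comp w (hπ w)
    exact UpperHalfPlane.mdifferentiableAt_iff.1 h2
  rw [Complex.analyticAt_iff_eventually_differentiableAt, eventually_coe_UHP]
  filter_upwards [hπ.continuous.continuousAt.eventually (e.open_source.mem_nhds hz)] with w hw
    using h1 w hw

lemma deriv_chart_comp_ne_zero [DiscreteTopology Γ] (hπ : MDifferentiable 𝓘(ℂ) 𝓘(ℂ) π)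
    (hπΓ : ∀ z w : ℍ, π z = π w ↔ proj Γ z = proj Γ w)
    {e : OpenPartialHomeomorph X ℂ} (he : e ∈ atlas ℂ X) {z : ℍ} (hz : π z ∈ e.source)
    (hzc : proj Γ z ∉ conePoints Γ) :
    deriv (fun s => e (π (UpperHalfPlane.ofComplex s))) z ≠ 0 := by
  obtain ⟨N, hN, hi⟩ := injOn_nhds_of_fibres hπΓ hzc
  have h1 : ((↑) : ℍ → ℂ) '' (N ∩ π ⁻¹' e.source) ∈ 𝓝 (z : ℂ) := by
    rw [nhds_coe_UHP]
    exact image_mem_map (inter_mem hN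
      (hπ.continuous.continuousAt.preimage_mem_nhds (e.open_source.mem_nhds hz)))
  refine deriv_ne_zero_of_injOn (analyticAt_chart_comp hπ he hz) h1 ?_
  rintro _ ⟨a, ⟨ha, hae⟩, rfl⟩ _ ⟨b, ⟨hb, hbe⟩, rfl⟩ hab
  simp only [UpperHalfPlane.ofComplex_apply] at hab
  rw [hi ha hb (e.injOn hae hbe hab)]

lemma isOpenMap_of_fibres [DiscreteTopology Γ] (hπ : MDifferentiable 𝓘(ℂ) 𝓘(ℂ) π)
    (hπΓ : ∀ z w : ℍ, π z = π w ↔ proj Γ z = proj Γ w) : IsOpenMap π := by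
  refine IsOpenMap.of_nhds_le fun z => ?_
  set e := chartAt ℂ (π z)
  have he : e ∈ atlas ℂ X := chart_mem_atlas _ _
  have hz : π z ∈ e.source := mem_chart_source _ _
  have hf := analyticAt_chart_comp hπ he hz
  have hs : ∀ᶠ w in 𝓝 z, π w ∈ e.source :=
    hπ.continuous.continuousAt.eventually (e.open_source.mem_nhds hz)
  rcases hf.eventually_constant_or_nhds_le_map_nhds with h | h
  · exfalso
    rw [eventually_coe_UHP] at h
    obtain ⟨w, ⟨h1, h2⟩, h3⟩ := (Eventually.and
      (mem_nhdsWithin_of_mem_nhds (h.and hs)) (eventually_proj_ne (Γ := Γ) z)).exists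
    refine h3 ((hπΓ w z).1 (e.injOn h2 hz ?_))
    simpa using h1
  · rw [nhds_coe_UHP, map_map] at h
    have h1 : (fun s => e (π (UpperHalfPlane.ofComplex s))) ∘ ((↑) : ℍ → ℂ) = fun w => e (π w) := by
      funext w; simp
    rw [h1] at h
    simp only [UpperHalfPlane.ofComplex_apply] at h
    intro U hU
    have h2 : {w | π w ∈ U ∧ π w ∈ e.source} ∈ 𝓝 z := Eventually.and hU hs
    have h3 : e '' (π '' {w | π w ∈ U ∧ π w ∈ e.source}) ∈ 𝓝 (e (π z)) := by
      rw [image_image]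
      exact h (image_mem_map h2)
    filter_upwards [e.continuousAt hz |>.preimage_mem_nhds h3, e.open_source.mem_nhds hz] with x hx hxs
    obtain ⟨_, ⟨w, hw, rfl⟩, hwx⟩ := hx
    rw [← e.injOn hw.2 hxs hwx]
    exact hw.1

end

section

/-! ### Cusps at the punctures -/

lemma eqOn_of_comp_eqOn_of_injOn {A X Y : Type*} [TopologicalSpace A] [TopologicalSpace X]
    [T2Space X] {f : X → Y} {s : Set A} {g₁ g₂ : A → X} (hs : IsPreconnected s)
    (h₁ : ContinuousOn g₁ s) (h₂ : ContinuousOn g₂ s) (he : ∀ a ∈ s, f (g₁ a) = f (g₂ a))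
    (hf : ∀ a ∈ s, ∃ N ∈ 𝓝 (g₁ a), InjOn f N) {a : A} (ha : a ∈ s) (h : g₁ a = g₂ a) :
    EqOn g₁ g₂ s := by
  have : PreconnectedSpace s := isPreconnected_iff_preconnectedSpace.1 hs
  rw [continuousOn_iff_continuous_domRestrict] at h₁ h₂
  have hcl : IsClopen {b : s | g₁ b = g₂ b} := by
    refine ⟨isClosed_eq h₁ h₂, ?_⟩
    rw [isOpen_iff_mem_nhds]
    rintro b hb
    obtain ⟨N, hN, hi⟩ := hf b b.2
    filter_upwards [h₁.continuousAt.eventually hN,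
      h₂.continuousAt.eventually (show N ∈ 𝓝 (g₂ b) from hb ▸ hN)] with c hc1 hc2
    exact hi hc1 hc2 (he c c.2)
  intro b hb
  have : (⟨b, hb⟩ : s) ∈ {b : s | g₁ b = g₂ b} := by
    rw [hcl.eq_univ ⟨⟨a, ha⟩, h⟩]; trivial
  exact this

variable {Γ : Subgroup SL(2, ℝ)} {X : Type} [TopologicalSpace X] [ChartedSpace ℂ X]
  [IsManifold 𝓘(ℂ) ω X] {π : ℍ → X}

lemma exists_puncture_lift [DiscreteTopology Γ] [T2Space X] (hcone : (conePoints Γ).Finite)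
    (hπ : MDifferentiable 𝓘(ℂ) 𝓘(ℂ) π) (hfin : ((range π)ᶜ).Finite)
    (hπΓ : ∀ z w : ℍ, π z = π w ↔ proj Γ z = proj Γ w) {x : X} (hx : x ∉ range π) :
    ∃ (R : ℝ) (G : ℂ → ℍ), (∀ s : ℂ, s.re < R → DifferentiableAt ℂ (fun s => (G s : ℂ)) s) ∧
      (∃ γ ∈ Γ, ∀ s : ℂ, s.re < R → G (s + 2 * Real.pi * Complex.I) = γ • G s) ∧
      (∀ U ∈ 𝓝 x, ∃ R', ∀ s : ℂ, s.re < R' → π (G s) ∈ U) ∧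
      ∀ R', ∃ W ∈ 𝓝 x, ∀ z, π z ∈ W → ∃ s : ℂ, s.re < R' ∧ proj Γ z = proj Γ (G s) := by
  classical
  set e := chartAt ℂ x with he
  have hea : e ∈ atlas ℂ X := chart_mem_atlas _ _
  have hxe : x ∈ e.source := mem_chart_source _ _
  set S : Set X := (range π)ᶜ ∪ π '' {z | proj Γ z ∈ conePoints Γ} with hS
  have hconeπ : (π '' {z | proj Γ z ∈ conePoints Γ}).Finite := by
    refine Set.Finite.of_finite_image (f := fun y => proj Γ (Function.invFun π y)) ?_ ?_
    · refine hcone.subset ?_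
      rintro _ ⟨_, ⟨z, hz, rfl⟩, rfl⟩
      have h1 : π (Function.invFun π (π z)) = π z := Function.invFun_eq ⟨z, rfl⟩
      simp only [(hπΓ _ _).1 h1]
      exact hz
    · rintro _ ⟨z, hz, rfl⟩ _ ⟨w, hw, rfl⟩ h
      have h1 : π (Function.invFun π (π z)) = π z := Function.invFun_eq ⟨z, rfl⟩
      have h2 : π (Function.invFun π (π w)) = π w := Function.invFun_eq ⟨w, rfl⟩
      rw [← h1, ← h2]
      exact (hπΓ _ _).2 h
  have hSfin : S.Finite := hfin.union hconeπ
  obtain ⟨r, hr, hball⟩ : ∃ r > 0, ∀ v ∈ Metric.ball (e x) r, v ∈ e.target ∧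
      e.symm v ∉ S \ {x} := by
    have h1 : ∀ᶠ v in 𝓝 (e x), v ∈ e.target ∧ e.symm v ∉ S \ {x} := by
      refine Eventually.and (e.open_target.mem_nhds (e.map_source hxe)) ?_
      refine (e.continuousAt_symm (e.map_source hxe)).eventually (p := fun y => y ∉ S \ {x}) ?_
      rw [e.left_inv hxe]
      exact (hSfin.subset sdiff_subset).isClosed.isOpen_compl.mem_nhds (fun h => h.2 rfl)
    exact Metric.eventually_nhds_iff_ball.1 h1
  obtain ⟨R, rfl⟩ : ∃ R, r = Real.exp R := ⟨Real.log r, (Real.exp_log hr).symm⟩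
  set d : ℂ → X := fun s => e.symm (e x + Complex.exp s) with hd
  have hmemb : ∀ {R' : ℝ} {s : ℂ}, s.re < R' → e x + Complex.exp s ∈ Metric.ball (e x) (Real.exp R') := by
    intro R' s hs
    rw [mem_ball_iff_norm, add_sub_cancel_left, Complex.norm_exp]
    exact Real.exp_lt_exp.2 hs
  have hdx : ∀ s : ℂ, s.re < R → d s ≠ x := by
    intro s hs h
    have h1 := e.right_inv (hball _ (hmemb hs)).1
    rw [show e.symm (e x + Complex.exp s) = x from h] at h1
    exact Complex.exp_ne_zero s (by linear_combination -h1)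
  have hdS : ∀ s : ℂ, s.re < R → d s ∉ S := fun s hs h => (hball _ (hmemb hs)).2 ⟨h, hdx s hs⟩
  have hdr : ∀ s : ℂ, s.re < R → d s ∈ range π := fun s hs => by
    by_contra h
    exact hdS s hs (Or.inl h)
  have hopen := isOpenMap_of_fibres hπ hπΓ
  set J : X → Orbifold Γ := fun y => proj Γ (Function.invFun π y) with hJ
  have hJπ : ∀ z, J (π z) = proj Γ z := fun z => (hπΓ _ _).1 (Function.invFun_eq ⟨z, rfl⟩)
  have hJc : ContinuousOn J (range π) := by
    rintro _ ⟨z, rfl⟩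
    refine ContinuousAt.continuousWithinAt ?_
    intro U hU
    rw [hJπ] at hU
    have h1 : π '' (proj Γ ⁻¹' U) ∈ 𝓝 (π z) :=
      hopen.image_mem_nhds ((continuous_proj Γ).continuousAt.preimage_mem_nhds hU)
    rw [mem_map]
    refine mem_of_superset h1 ?_
    rintro _ ⟨w, hw, rfl⟩
    rw [mem_preimage, hJπ]
    exact hw
  have hdc : ContinuousOn d {s | s.re < R} :=
    e.continuousOn_symm.comp (by fun_prop) fun s hs => (hball _ (hmemb hs)).1
  have hconec : ∀ s : ℂ, s.re < R → J (d s) ∈ (conePoints Γ)ᶜ := by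
    intro s hs h
    obtain ⟨z, hz⟩ := hdr s hs
    refine hdS s hs (Or.inr ⟨z, ?_, hz⟩)
    rwa [← hz, hJπ] at h
  have hs₀ : ((R - 1 : ℝ) : ℂ).re < R := by rw [Complex.ofReal_re]; linarith
  obtain ⟨z₀, hz₀⟩ := proj_surjective Γ (J (d ((R - 1 : ℝ) : ℂ)))
  obtain ⟨G, hGc, hG₀, hG⟩ := exists_lift_halfPlane
    (isCoveringMapOn_proj Γ hcone.isClosed subset_rfl) (hJc.comp hdc hdr) hconec hs₀ hz₀
  simp only [Function.comp_apply] at hG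
  have hGπ : ∀ s : ℂ, s.re < R → π (G s) = d s := by
    intro s hs
    obtain ⟨z, hz⟩ := hdr s hs
    rw [← hz, hπΓ, hG s hs, ← hz, hJπ]
  have hGe : ∀ s : ℂ, s.re < R → e (π (G s)) = e x + Complex.exp s := fun s hs => by
    rw [hGπ s hs]; exact e.right_inv (hball _ (hmemb hs)).1
  have hGcone : ∀ s : ℂ, s.re < R → proj Γ (G s) ∉ conePoints Γ := fun s hs => by
    rw [hG s hs]; exact hconec s hs
  have hGs : ∀ s : ℂ, s.re < R → π (G s) ∈ e.source := fun s hs => by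
    rw [hGπ s hs]; exact e.map_target (hball _ (hmemb hs)).1
  have hopn : IsOpen {s : ℂ | s.re < R} := isOpen_lt Complex.continuous_re continuous_const
  have hshift : ∀ s : ℂ, s.re < R → (s + 2 * Real.pi * Complex.I).re < R := by
    intro s hs; simpa using hs
  have hper : ∀ s : ℂ, s.re < R → proj Γ (G (s + 2 * Real.pi * Complex.I)) = proj Γ (G s) := by
    intro s hs
    rw [hG _ (hshift s hs), hG s hs]
    simp only [hd, Complex.exp_periodic s]
  refine ⟨R, G, ?_, ?_, ?_, ?_⟩
  · intro s hs
    have hcs : ContinuousAt (fun s => (G s : ℂ)) s :=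
      UpperHalfPlane.continuous_coe.continuousAt.comp (hGc.continuousAt (hopn.mem_nhds hs))
    refine differentiableAt_of_comp hcs (analyticAt_chart_comp hπ hea (hGs s hs))
      (deriv_chart_comp_ne_zero hπ hπΓ hea (hGs s hs) (hGcone s hs))
      (k := fun s => e x + Complex.exp s) (by fun_prop) ?_
    filter_upwards [hopn.mem_nhds hs] with t ht
    rw [UpperHalfPlane.ofComplex_apply]
    exact hGe t ht
  · obtain ⟨γ, hγ, hγs⟩ := (proj_eq_iff Γ).1 (hper _ hs₀)
    refine ⟨γ, hγ, ?_⟩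
    refine eqOn_of_comp_eqOn_of_injOn (f := proj Γ) (s := {s : ℂ | s.re < R})
      (g₁ := fun s => G (s + 2 * Real.pi * Complex.I)) (g₂ := fun s => γ • G s)
      (convex_halfSpace_re_lt R).isPreconnected
      (hGc.comp (by fun_prop) hshift) ((continuous_const_smul γ).comp_continuousOn hGc)
      (fun s hs => by rw [hper s hs, proj_smul Γ hγ])
      (fun s hs => exists_injOn_proj Γ (hGcone _ (hshift s hs))) hs₀ hγs.symm
  · intro U hU
    have h1 : e.symm ⁻¹' U ∈ 𝓝 (e x) :=
      (e.continuousAt_symm (e.map_source hxe)).preimage_mem_nhds (by rwa [e.left_inv hxe])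
    obtain ⟨r, hr, hrU⟩ := Metric.mem_nhds_iff.1 h1
    refine ⟨min R (Real.log r), fun s hs => ?_⟩
    rw [hGπ s (hs.trans_le (min_le_left _ _))]
    apply hrU
    have := hmemb (hs.trans_le (min_le_right R (Real.log r)))
    rwa [Real.exp_log hr] at this
  · intro R'
    set R₁ := min R R'
    refine ⟨e.source ∩ e ⁻¹' Metric.ball (e x) (Real.exp R₁), ?_, ?_⟩
    · exact inter_mem (e.open_source.mem_nhds hxe)
        ((e.continuousAt hxe).preimage_mem_nhds (Metric.ball_mem_nhds _ (Real.exp_pos _)))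
    · rintro z ⟨hz, hzb⟩
      have hne : e (π z) - e x ≠ 0 := by
        intro h
        have := e.injOn hz hxe (sub_eq_zero.1 h)
        exact hx ⟨z, this⟩
      have hlog : (Complex.log (e (π z) - e x)).re < R₁ := by
        rw [Complex.log_re, Real.log_lt_iff_lt_exp (norm_pos_iff.2 hne), ← mem_ball_iff_norm]
        exact hzb
      refine ⟨Complex.log (e (π z) - e x), hlog.trans_le (min_le_right _ _), ?_⟩
      rw [← hπΓ, hGπ _ (hlog.trans_le (min_le_left _ _))]
      simp only [hd]
      rw [Complex.exp_log hne, add_sub_cancel, e.left_inv hz]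

lemma HolUHP.differentiableAt_comp {α : ℍ → ℍ} (hα : HolUHP α) {G : ℂ → ℍ} {s : ℂ}
    (hG : DifferentiableAt ℂ (fun s => (G s : ℂ)) s) :
    DifferentiableAt ℂ (fun s => (α (G s) : ℂ)) s := by
  have h3 := DifferentiableAt.comp (g := fun s : ℂ => (α (UpperHalfPlane.ofComplex s) : ℂ))
    s (hα (G s)) hG
  refine h3.congr_of_eventuallyEq (Eventually.of_forall fun t => ?_)
  simp

theorem exists_cusp_of_puncture [DiscreteTopology Γ] [T2Space X] (hcone : (conePoints Γ).Finite)
    (hπ : MDifferentiable 𝓘(ℂ) 𝓘(ℂ) π) (hfin : ((range π)ᶜ).Finite)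
    (hπΓ : ∀ z w : ℍ, π z = π w ↔ proj Γ z = proj Γ w) {x : X} (hx : x ∉ range π) :
    ∃ g : SL(2, ℝ), (∃ γ ∈ Γ, ∀ z : ℍ, γ • (g • z) = g • ((1 : ℝ) +ᵥ z)) ∧
      ∃ W ∈ 𝓝 x, ∀ z, π z ∈ W → ∃ γ ∈ Γ, ∃ w : ℍ, 1 < w.im ∧ γ • (g • w) = z := by
  obtain ⟨R, G, hG, ⟨γ, hγ, hγG⟩, hGx, hW⟩ := exists_puncture_lift hcone hπ hfin hπΓ hx
  have hpow : ∀ (n : ℕ) (s : ℂ), s.re < R → G (s + n * (2 * Real.pi * Complex.I)) = γ ^ n • G s := by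
    intro n
    induction n with
    | zero => intro s _; simp
    | succ n ih =>
      intro s hs
      rw [pow_succ', mul_smul, ← ih s hs, ← hγG _ (by simpa using hs)]
      congr 1
      push_cast
      ring
  have hnontriv : ∀ n : ℕ, n ≠ 0 → ¬ ∀ z : ℍ, γ ^ n • z = z := by
    intro n hn htriv
    have hn0 : (0 : ℝ) < n := by positivity
    have hre : ∀ s : ℂ, s.re < R / n → (n * s).re < R := by
      intro s hs
      rw [lt_div_iff₀' hn0] at hs
      simpa using hs
    obtain ⟨H, hHc, -, hH⟩ := exists_extension_of_periodic (G := fun s => G (n * s)) (R := R / n)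
      (fun s hs => DifferentiableAt.comp (g := fun s => (G s : ℂ)) s (hG _ (hre s hs)) (by fun_prop))
      (fun s hs => by rw [mul_add, hpow n _ (hre s hs), htriv])
    refine hx ⟨H 0, ?_⟩
    have h0 : (0 : ℂ) ∈ Metric.ball (0 : ℂ) (Real.exp (R / n)) := by simp [Real.exp_pos]
    have h1 : Tendsto (fun w => π (H w)) (𝓝[≠] 0) (𝓝 (π (H 0))) :=
      (hπ.continuous.continuousAt.comp
        (hHc.continuousAt (Metric.isOpen_ball.mem_nhds h0))).tendsto.mono_left nhdsWithin_le_nhds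
    refine tendsto_nhds_unique h1 ?_
    intro U hU
    obtain ⟨R', hR'⟩ := hGx U hU
    have hb : Metric.ball (0 : ℂ) (Real.exp (min R R' / n)) ∈ 𝓝 (0 : ℂ) :=
      Metric.ball_mem_nhds _ (Real.exp_pos _)
    rw [mem_map]
    filter_upwards [mem_nhdsWithin_of_mem_nhds hb, self_mem_nhdsWithin] with w hw hw0
    have hw0 : w ≠ 0 := hw0
    have hlog : (Complex.log w).re < min R R' / n := by
      rw [Complex.log_re, Real.log_lt_iff_lt_exp (norm_pos_iff.2 hw0)]
      simpa using hw
    have h2 := hH (Complex.log w) (hlog.trans_le (by gcongr; exact min_le_left _ _))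
    rw [Complex.exp_log hw0] at h2
    rw [mem_preimage, h2]
    apply hR'
    rw [lt_div_iff₀' hn0] at hlog
    refine lt_of_lt_of_le ?_ (min_le_right R R')
    simpa using hlog
  have htr : (γ 0 0 + γ 1 1) ^ 2 ≤ 4 := by
    refine trace_sq_le_of_displacement fun ρ hρ => ?_
    obtain ⟨R', hR', h⟩ := displacement_small hG (2 * Real.pi * Complex.I) hρ
    have h1 : ((R' - 1 : ℝ) : ℂ).re < R' := by rw [Complex.ofReal_re]; linarith
    refine ⟨G ((R' - 1 : ℝ) : ℂ), ?_⟩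
    rw [← hγG _ (h1.trans_le hR')]
    exact h _ h1
  have htr' : (γ 0 0 + γ 1 1) ^ 2 = 4 := by
    refine htr.antisymm (not_lt.1 fun hlt => ?_)
    obtain ⟨z, hz⟩ := exists_smul_eq_of_trace hlt
    have hmem : ∀ n : ℕ, γ ^ n ∈ {δ : SL(2, ℝ) | δ ∈ Γ ∧ δ • z = z} := by
      intro n
      refine ⟨pow_mem hγ n, ?_⟩
      induction n with
      | zero => simp
      | succ n ih => rw [pow_succ, mul_smul, hz, ih]
    have hni : ¬ Function.Injective fun n : ℕ => γ ^ n := fun hinj =>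
      Set.infinite_of_injective_forall_mem hinj hmem (finite_stabilizer z)
    rw [Function.not_injective_iff] at hni
    obtain ⟨m, n, hmn, hne⟩ := hni
    rcases lt_or_gt_of_ne hne with h | h
    · refine hnontriv (n - m) (by omega) fun v => ?_
      have h1 : γ ^ n = γ ^ m * γ ^ (n - m) := by rw [← pow_add]; congr 1; omega
      have h2 : γ ^ (n - m) = 1 := by
        rw [← hmn] at h1
        simpa using h1.symm
      rw [h2, one_smul]
    · refine hnontriv (m - n) (by omega) fun v => ?_
      have h1 : γ ^ m = γ ^ n * γ ^ (m - n) := by rw [← pow_add]; congr 1; omega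
      have h2 : γ ^ (m - n) = 1 := by
        rw [hmn] at h1
        simpa using h1.symm
      rw [h2, one_smul]
  obtain ⟨g, δ, hδ, hgδ⟩ := exists_conj_translation htr'
    (fun h => hnontriv 1 one_ne_zero fun z => by rw [h]; simp)
    (fun h => hnontriv 1 one_ne_zero fun z => by rw [h, pow_one, sl_neg_one_smul])
  refine ⟨g, ?_, ?_⟩
  · rcases hδ with rfl | rfl
    · exact ⟨γ, hγ, hgδ⟩
    · refine ⟨γ⁻¹, inv_mem hγ, fun z => ?_⟩
      rw [inv_smul_eq_iff, hgδ, vadd_vadd]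
      simp
  · have hG1 : ∀ s : ℂ, s.re < R → DifferentiableAt ℂ (fun s => ((g⁻¹ • G s : ℍ) : ℂ)) s :=
      fun s hs => (holUHP_smul g⁻¹).differentiableAt_comp (hG s hs)
    obtain ⟨R', hR', hdisp⟩ := displacement_small hG1 (2 * Real.pi * Complex.I) one_pos
    obtain ⟨W, hWx, hWz⟩ := hW R'
    refine ⟨W, hWx, fun z hz => ?_⟩
    obtain ⟨s, hs, hsz⟩ := hWz z hz
    obtain ⟨γ', hγ', hγz⟩ := (proj_eq_iff Γ).1 hsz
    refine ⟨γ', hγ', g⁻¹ • G s, ?_, by rw [smul_inv_smul, hγz]⟩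
    have h1 := hdisp s hs
    have h2 : g⁻¹ • G (s + 2 * Real.pi * Complex.I) = δ +ᵥ (g⁻¹ • G s) := by
      rw [hγG s (hs.trans_le hR'), inv_smul_eq_iff, ← hgδ, smul_inv_smul]
    rw [h2, UpperHalfPlane.coe_vadd, one_mul] at h1
    rw [dist_comm, dist_eq_norm, add_sub_cancel_right, Complex.norm_real] at h1
    have h3 : ‖δ‖ = 1 := by rcases hδ with rfl | rfl <;> simp
    rwa [h3] at h1

end

section

/-! ### Compact sets and horoballs -/

lemma exists_isCompact_image {Z Y : Type*} [TopologicalSpace Z] [TopologicalSpace Y]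
    [WeaklyLocallyCompactSpace Z] {f : Z → Y} (hf : IsOpenMap f) {C : Set Y} (hC : IsCompact C)
    (hCf : C ⊆ range f) : ∃ K, IsCompact K ∧ C ⊆ f '' K := by
  refine hC.induction_on (p := fun s => ∃ K, IsCompact K ∧ s ⊆ f '' K)
    ⟨∅, isCompact_empty, by simp⟩ ?_ ?_ ?_
  · rintro s t hst ⟨K, hK, h⟩
    exact ⟨K, hK, hst.trans h⟩
  · rintro s t ⟨K, hK, h⟩ ⟨L, hL, h'⟩
    exact ⟨K ∪ L, hK.union hL, by rw [image_union]; exact union_subset_union h h'⟩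
  · intro y hy
    obtain ⟨z, rfl⟩ := hCf hy
    obtain ⟨K, hK, hKz⟩ := exists_compact_mem_nhds z
    exact ⟨f '' K, mem_nhdsWithin_of_mem_nhds (hf.image_mem_nhds hKz), K, hK, subset_rfl⟩

/-- The transformations `γ ∈ Γ` and the parabolic translations of the finitely many horoballs
`g i {Im > 1}` move each point of `ℍ` to a compact set or to one of the horoballs. -/
structure IsCuspCover (Γ : Subgroup SL(2, ℝ)) {I : Type} (g : I → SL(2, ℝ)) (K : Set ℍ) :
    Prop where
  isCompact : IsCompact K
  translation : ∀ i, ∃ γ ∈ Γ, ∀ z : ℍ, γ • (g i • z) = g i • ((1 : ℝ) +ᵥ z)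
  cover : ∀ z : ℍ, ∃ γ ∈ Γ, γ • z ∈ K ∨ ∃ i, ∃ w : ℍ, 1 < w.im ∧ γ • z = g i • w

variable {Γ Γ' : Subgroup SL(2, ℝ)}

theorem exists_isCuspCover [DiscreteTopology Γ] (hΓ : IsFiniteType Γ) :
    ∃ (I : Type) (_ : Finite I) (g : I → SL(2, ℝ)) (K : Set ℍ), IsCuspCover Γ g K := by
  obtain ⟨hcone, X, _, _, _, _, _, _, π, hπ, hfin, hπΓ⟩ := hΓ
  have h := fun x : ((range π)ᶜ : Set X) => exists_cusp_of_puncture hcone hπ hfin hπΓ x.2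
  choose g hg W hW hWg using h
  have hC : IsCompact (⋃ x, interior (W x))ᶜ :=
    (isOpen_iUnion fun x => isOpen_interior).isClosed_compl.isCompact
  obtain ⟨K, hK, hCK⟩ := exists_isCompact_image (isOpenMap_of_fibres hπ hπΓ) hC (by
    intro y hy
    by_contra hyr
    exact hy (mem_iUnion.2 ⟨⟨y, hyr⟩, mem_interior_iff_mem_nhds.2 (hW ⟨y, hyr⟩)⟩))
  refine ⟨((range π)ᶜ : Set X), hfin, g, K, hK, hg, fun z => ?_⟩
  by_cases hz : π z ∈ ⋃ x, interior (W x)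
  · obtain ⟨x, hx⟩ := mem_iUnion.1 hz
    obtain ⟨γ, hγ, w, hw, hγw⟩ := hWg x z (interior_subset hx)
    exact ⟨γ⁻¹, inv_mem hγ, Or.inr ⟨x, w, hw, by rw [← hγw, inv_smul_smul]⟩⟩
  · obtain ⟨k, hk, hkz⟩ := hCK hz
    obtain ⟨γ, hγ, hγz⟩ := (proj_eq_iff Γ).1 ((hπΓ k z).1 hkz)
    exact ⟨γ, hγ, Or.inl (by rwa [hγz])⟩

lemma vadd_ne_self (w : ℍ) {t : ℝ} (ht : t ≠ 0) : t +ᵥ w ≠ w := by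
  intro h
  have := congrArg UpperHalfPlane.re h
  rw [UpperHalfPlane.vadd_re] at this
  exact ht (by linarith)

lemma dist_vadd_le (t : ℝ) (w : ℍ) : dist (t +ᵥ w) w ≤ |t| / w.im := by
  refine (UpperHalfPlane.dist_le_dist_coe_div_sqrt _ _).trans ?_
  rw [UpperHalfPlane.vadd_im, Real.sqrt_mul_self w.im_pos.le, UpperHalfPlane.coe_vadd, dist_eq_norm,
    add_sub_cancel_right, Complex.norm_real, Real.norm_eq_abs]

/-- The translates of a compact set by a discrete group avoid a small enough horoball. -/
theorem exists_height_bound [DiscreteTopology Γ] {g γ : SL(2, ℝ)} (hγ : γ ∈ Γ)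
    (hγg : ∀ z : ℍ, γ • (g • z) = g • ((1 : ℝ) +ᵥ z)) {N : Set ℍ} (hN : IsCompact N) :
    ∃ T : ℝ, 1 ≤ T ∧ ∀ a ∈ Γ, ∀ z ∈ N, ∀ w : ℍ, a • z = g • w → w.im ≤ T := by
  have hΔ := finite_smul_mem_compact Γ hN (hN.cthickening (r := 1))
  set Δ := {δ : SL(2, ℝ) | δ ∈ Γ ∧ ∃ z ∈ N, δ • z ∈ Metric.cthickening 1 N}
  obtain ⟨m, hm, hm0⟩ : ∃ m : ℝ, (∀ δ ∈ Δ, (∀ z : ℍ, δ • z ≠ z) → ∀ z ∈ N, m ≤ dist (δ • z) z) ∧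
      0 < m := by
    have h1 : ∀ᶠ m : ℝ in 𝓝[>] 0, ∀ δ ∈ Δ, (∀ z : ℍ, δ • z ≠ z) → ∀ z ∈ N, m ≤ dist (δ • z) z := by
      refine (Filter.eventually_all_finite hΔ).2 fun δ _ => ?_
      by_cases hδ : ∀ z : ℍ, δ • z ≠ z
      · rcases N.eq_empty_or_nonempty with rfl | hne
        · simp
        · obtain ⟨z₀, -, hz₀⟩ := hN.exists_isMinOn hne
            (f := fun z : ℍ => dist (δ • z) z)
            (((continuous_const_smul δ).dist continuous_id).continuousOn)
          filter_upwards [Ioc_mem_nhdsGT (dist_pos.2 (hδ z₀))] with m hm _ z hz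
          exact hm.2.trans (hz₀ hz)
      · exact Eventually.of_forall fun m h => absurd h hδ
    exact (h1.and self_mem_nhdsWithin).exists
  refine ⟨max 1 (1 / m), le_max_left _ _, fun a ha z hz w hw => ?_⟩
  by_contra! hlt
  have hw1 : 1 < w.im := (le_max_left _ _).trans_lt hlt
  have hwm : 1 / m < w.im := (le_max_right _ _).trans_lt hlt
  set δ := a⁻¹ * γ * a with hδ
  have hdist : dist (δ • z) z ≤ 1 / w.im := by
    have h1 : dist (δ • z) z = dist ((1 : ℝ) +ᵥ w) w := by
      rw [hδ, mul_smul, mul_smul, ← dist_smul a, smul_inv_smul, hw, hγg, dist_smul]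
    rw [h1]
    simpa using dist_vadd_le 1 w
  have hδΔ : δ ∈ Δ := by
    refine ⟨mul_mem (mul_mem (inv_mem ha) hγ) ha, z, hz, ?_⟩
    refine Metric.mem_cthickening_of_dist_le _ z _ _ hz (hdist.trans ?_)
    rw [div_le_one w.im_pos]
    exact hw1.le
  have h2 := hm δ hδΔ (fun v hv => by
    rw [hδ, mul_smul, mul_smul, inv_smul_eq_iff] at hv
    obtain ⟨u, hu⟩ : ∃ u : ℍ, a • v = g • u := ⟨g⁻¹ • (a • v), by rw [smul_inv_smul]⟩
    rw [hu, hγg] at hv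
    exact vadd_ne_self u one_ne_zero (smul_left_cancel g hv)) z hz
  have h3 : m ≤ 1 / w.im := h2.trans hdist
  rw [le_div_iff₀ w.im_pos] at h3
  rw [div_lt_iff₀ hm0] at hwm
  linarith

lemma isCompact_box (a b c d : ℝ) (hc : 0 < c) :
    IsCompact {w : ℍ | w.re ∈ Icc a b ∧ w.im ∈ Icc c d} := by
  rw [UpperHalfPlane.isEmbedding_coe.isCompact_iff]
  have : ((↑) : ℍ → ℂ) '' {w : ℍ | w.re ∈ Icc a b ∧ w.im ∈ Icc c d} = Icc a b ×ℂ Icc c d := by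
    ext s
    constructor
    · rintro ⟨w, hw, rfl⟩
      exact hw
    · intro hs
      exact ⟨⟨s, hc.trans_le hs.2.1⟩, hs, rfl⟩
  rw [this]
  exact isCompact_Icc.reProdIm isCompact_Icc

lemma zpow_translation {g γ : SL(2, ℝ)} (hγg : ∀ z : ℍ, γ • (g • z) = g • ((1 : ℝ) +ᵥ z)) (n : ℤ)
    (z : ℍ) : γ ^ n • (g • z) = g • ((n : ℝ) +ᵥ z) := by
  have hnat : ∀ (n : ℕ) (z : ℍ), γ ^ n • (g • z) = g • ((n : ℝ) +ᵥ z) := by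
    intro n
    induction n with
    | zero => simp
    | succ n ih =>
      intro z
      rw [pow_succ, mul_smul, hγg, ih, vadd_vadd]
      push_cast
      rfl
  rcases Int.eq_nat_or_neg n with ⟨k, rfl | rfl⟩
  · exact_mod_cast hnat k z
  · rw [zpow_neg, zpow_natCast, inv_smul_eq_iff, hnat, vadd_vadd]
    simp

lemma exists_translate_mem_box (T : ℝ) {w : ℍ} (h1 : 1 ≤ w.im) (hT : w.im ≤ T) :
    ∃ n : ℤ, (n : ℝ) +ᵥ w ∈ {w : ℍ | w.re ∈ Icc (0 : ℝ) 1 ∧ w.im ∈ Icc 1 T} := by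
  refine ⟨-⌊w.re⌋, ?_, ?_⟩
  · rw [UpperHalfPlane.vadd_re]
    push_cast
    exact ⟨by linarith [Int.floor_le w.re], by linarith [Int.lt_floor_add_one w.re]⟩
  · rw [UpperHalfPlane.vadd_im]
    exact ⟨h1, hT⟩

lemma IsCuspCover.exists_compact {I : Type} [Finite I] {g : I → SL(2, ℝ)} {K : Set ℍ}
    (h : IsCuspCover Γ g K) (T : I → ℝ) : ∃ L, IsCompact L ∧ ∀ z : ℍ, ∃ γ ∈ Γ, γ • z ∈ L ∨
      ∃ i, ∃ w : ℍ, T i < w.im ∧ 1 < w.im ∧ γ • z = g i • w := by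
  refine ⟨K ∪ ⋃ i, (fun w => g i • w) '' {w : ℍ | w.re ∈ Icc (0 : ℝ) 1 ∧ w.im ∈ Icc 1 (T i)},
    h.isCompact.union (isCompact_iUnion fun i => (isCompact_box _ _ _ _ one_pos).image
      (continuous_const_smul _)), fun z => ?_⟩
  obtain ⟨γ, hγ, hz | ⟨i, w, hw, hz⟩⟩ := h.cover z
  · exact ⟨γ, hγ, Or.inl (Or.inl hz)⟩
  · rcases lt_or_ge (T i) w.im with hT | hT
    · exact ⟨γ, hγ, Or.inr ⟨i, w, hT, hw, hz⟩⟩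
    · obtain ⟨n, hn⟩ := exists_translate_mem_box (T i) hw.le hT
      obtain ⟨δ, hδ, hδg⟩ := h.translation i
      refine ⟨δ ^ n * γ, mul_mem (zpow_mem hδ n) hγ, Or.inl (Or.inr (mem_iUnion.2 ⟨i, _, hn, ?_⟩))⟩
      rw [mul_smul, hz, zpow_translation hδg]

theorem IsCuspCover.exists_compact_orbit [DiscreteTopology Γ'] (hle : Γ ≤ Γ') {I : Type} [Finite I]
    {g : I → SL(2, ℝ)} {K : Set ℍ} (h : IsCuspCover Γ g K) {N : Set ℍ} (hN : IsCompact N) :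
    ∃ L, IsCompact L ∧ ∀ a ∈ Γ', ∀ z ∈ N, ∃ γ ∈ Γ, γ • (a • z) ∈ L := by
  have hT : ∀ i, ∃ T : ℝ, 1 ≤ T ∧ ∀ a ∈ Γ', ∀ z ∈ N, ∀ w : ℍ, a • z = g i • w → w.im ≤ T := by
    intro i
    obtain ⟨γ, hγ, hγg⟩ := h.translation i
    exact exists_height_bound (hle hγ) hγg hN
  choose T hT1 hT using hT
  obtain ⟨L, hL, hLz⟩ := h.exists_compact T
  refine ⟨L, hL, fun a ha z hz => ?_⟩
  obtain ⟨γ, hγ, h1 | ⟨i, w, hw, -, h1⟩⟩ := hLz (a • z)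
  · exact ⟨γ, hγ, h1⟩
  · exact absurd (hT i (γ * a) (mul_mem (hle hγ) ha) z hz w (by rw [mul_smul, h1])) (not_le.2 hw)

/-- The map of orbifolds induced by an inclusion of groups. -/
def orbifoldMap (hle : Γ ≤ Γ') : Orbifold Γ → Orbifold Γ' :=
  Quotient.lift (proj Γ') fun z w h => by
    obtain ⟨γ, hγ, rfl⟩ := (proj_eq_iff Γ).1 (Quotient.sound h)
    exact proj_smul Γ' (hle hγ) w

@[simp] lemma orbifoldMap_proj (hle : Γ ≤ Γ') (z : ℍ) : orbifoldMap hle (proj Γ z) = proj Γ' z := rfl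

lemma continuous_orbifoldMap (hle : Γ ≤ Γ') : Continuous (orbifoldMap hle) :=
  (isOpenQuotientMap_proj Γ).isQuotientMap.continuous_iff.2 (continuous_proj Γ')

theorem isFiniteRamifiedCovering_orbifoldMap [DiscreteTopology Γ] [DiscreteTopology Γ']
    (hΓ : IsFiniteType Γ) (hle : Γ ≤ Γ') : IsFiniteRamifiedCovering (orbifoldMap hle) := by
  obtain ⟨I, _, g, K, hK⟩ := exists_isCuspCover hΓ
  refine ⟨?_, ?_, ?_, ⟨1, fun z => by rw [one_smul, orbifoldMap_proj]⟩⟩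
  · have : WeaklyLocallyCompactSpace (Orbifold Γ') :=
      ⟨fun y => by
        obtain ⟨z, rfl⟩ := proj_surjective Γ' y
        obtain ⟨N, hN, hNz⟩ := exists_compact_mem_nhds z
        exact ⟨_, hN.image (continuous_proj Γ'),
          (isOpenQuotientMap_proj Γ').isOpenMap.image_mem_nhds hNz⟩⟩
    rw [isProperMap_iff_isCompact_preimage]
    refine ⟨continuous_orbifoldMap hle, fun C hC => ?_⟩
    obtain ⟨N, hN, hCN⟩ := exists_isCompact_image (isOpenQuotientMap_proj Γ').isOpenMap hC
      (by rw [(proj_surjective Γ').range_eq]; exact subset_univ _)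
    obtain ⟨L, hL, hLN⟩ := hK.exists_compact_orbit hle hN
    refine (hL.image (continuous_proj Γ)).of_isClosed_subset
      (hC.isClosed.preimage (continuous_orbifoldMap hle)) ?_
    intro x hx
    obtain ⟨z, rfl⟩ := proj_surjective Γ x
    obtain ⟨n, hn, hnz⟩ := hCN hx
    rw [orbifoldMap_proj] at hnz
    obtain ⟨a, ha, haz⟩ := (proj_eq_iff Γ').1 hnz.symm
    obtain ⟨γ, hγ, hγL⟩ := hLN a ha n hn
    exact ⟨_, hγL, by rw [haz, proj_smul Γ hγ]⟩
  · intro y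
    obtain ⟨z, rfl⟩ := proj_surjective Γ' y
    exact ⟨proj Γ z, rfl⟩
  · intro y
    obtain ⟨z, rfl⟩ := proj_surjective Γ' y
    obtain ⟨L, hL, hLz⟩ := hK.exists_compact_orbit hle (isCompact_singleton (x := z))
    refine ((finite_smul_mem_compact Γ' (isCompact_singleton (x := z)) hL).image
      fun a => proj Γ (a • z)).subset ?_
    intro x hx
    obtain ⟨w, rfl⟩ := proj_surjective Γ x
    obtain ⟨a, ha, haw⟩ := (proj_eq_iff Γ').1 (show proj Γ' w = proj Γ' z from hx)
    obtain ⟨γ, hγ, hγL⟩ := hLz a ha z rfl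
    refine ⟨γ * a, ⟨mul_mem (hle hγ) ha, z, rfl, by rwa [mul_smul]⟩, ?_⟩
    simp only
    rw [mul_smul, proj_smul Γ hγ, haw]

end

section

/-! ### Normalized cusps -/

/-- The translations by integers are exactly the translations of the horoballs at `g` in `Γ`. -/
def IsCusp (Γ : Subgroup SL(2, ℝ)) (g : SL(2, ℝ)) : Prop :=
  ∀ t : ℝ, (∃ a ∈ Γ, ∀ z : ℍ, a • (g • z) = g • (t +ᵥ z)) ↔ ∃ n : ℤ, (n : ℝ) = t

variable {Γ : Subgroup SL(2, ℝ)}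

/-- The group of all translations at `g`. -/
def cuspTranslations (Γ : Subgroup SL(2, ℝ)) (g : SL(2, ℝ)) : AddSubgroup ℝ where
  carrier := {t | ∃ a ∈ Γ, ∀ z : ℍ, a • (g • z) = g • (t +ᵥ z)}
  zero_mem' := ⟨1, one_mem _, by simp⟩
  add_mem' := by
    rintro s t ⟨a, ha, hag⟩ ⟨b, hb, hbg⟩
    exact ⟨a * b, mul_mem ha hb, fun z => by rw [mul_smul, hbg, hag, vadd_vadd]⟩
  neg_mem' := by
    rintro s ⟨a, ha, hag⟩
    exact ⟨a⁻¹, inv_mem ha, fun z => by rw [inv_smul_eq_iff, hag, vadd_vadd]; simp⟩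

lemma finite_cuspTranslations [DiscreteTopology Γ] (g : SL(2, ℝ)) :
    {t ∈ (cuspTranslations Γ g : Set ℝ) | 0 < t ∧ t ≤ 1}.Finite := by
  have h := finite_smul_mem_compact Γ (isCompact_singleton (x := g • UpperHalfPlane.I))
    ((isCompact_box 0 1 1 1 one_pos).image (continuous_const_smul g))
  refine (h.image fun a => (g⁻¹ • (a • (g • UpperHalfPlane.I))).re).subset ?_
  rintro t ⟨⟨a, ha, hag⟩, ht0, ht1⟩
  refine ⟨a, ⟨ha, _, rfl, t +ᵥ UpperHalfPlane.I, ⟨?_, ?_⟩, (hag _).symm⟩, ?_⟩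
  · rw [UpperHalfPlane.vadd_re]; simp [ht0.le, ht1]
  · rw [UpperHalfPlane.vadd_im]; simp
  · simp only
    rw [hag, inv_smul_smul, UpperHalfPlane.vadd_re]; simp

lemma exists_dilation {r : ℝ} (hr : 0 < r) : ∃ k : SL(2, ℝ), ∀ z : ℍ, ((k • z : ℍ) : ℂ) = r * z := by
  have hs : Real.sqrt r ≠ 0 := by positivity
  obtain ⟨k, h1, h2, h3, h4⟩ := exists_sl_entries (a := Real.sqrt r) (b := 0) (c := 0)
    (d := (Real.sqrt r)⁻¹) (by field_simp; ring)
  refine ⟨k, fun z => ?_⟩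
  rw [sl_coe, h1, h2, h3, h4]
  have h5 : (Real.sqrt r : ℂ) * Real.sqrt r = r := by
    rw [← Complex.ofReal_mul, Real.mul_self_sqrt hr.le]
  have hs' : (Real.sqrt r : ℂ) ≠ 0 := by exact_mod_cast hs
  rw [← h5]
  push_cast
  field_simp
  ring

lemma exists_isCusp [DiscreteTopology Γ] {g : SL(2, ℝ)}
    (h : ∃ γ ∈ Γ, ∀ z : ℍ, γ • (g • z) = g • ((1 : ℝ) +ᵥ z)) :
    ∃ g', IsCusp Γ g' ∧ ∀ w : ℍ, 1 < w.im → ∃ w' : ℍ, 1 < w'.im ∧ g • w = g' • w' := by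
  have h1 : (1 : ℝ) ∈ {t ∈ (cuspTranslations Γ g : Set ℝ) | 0 < t ∧ t ≤ 1} :=
    ⟨h, one_pos, le_rfl⟩
  obtain ⟨r, ⟨hr, hr0, hr1⟩, hmin⟩ := Set.exists_min_image _ id (finite_cuspTranslations g) ⟨1, h1⟩
  have hleast : IsLeast {t : ℝ | t ∈ cuspTranslations Γ g ∧ 0 < t} r := by
    refine ⟨⟨hr, hr0⟩, fun t ht => ?_⟩
    rcases le_or_gt t 1 with h | h
    · exact hmin t ⟨ht.1, ht.2, h⟩
    · exact hr1.trans h.le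
  have hcyc := AddSubgroup.cyclic_of_min hleast
  obtain ⟨k, hk⟩ := exists_dilation hr0
  have hkv : ∀ (t : ℝ) (z : ℍ), k • (t +ᵥ z) = (r * t) +ᵥ (k • z) := by
    intro t z
    apply UpperHalfPlane.coe_injective
    rw [hk, UpperHalfPlane.coe_vadd, UpperHalfPlane.coe_vadd, hk]
    push_cast
    ring
  refine ⟨g * k, fun t => ?_, fun w hw => ⟨k⁻¹ • w, ?_, by rw [mul_smul, smul_inv_smul]⟩⟩
  · have e1 : (∃ a ∈ Γ, ∀ z : ℍ, a • ((g * k) • z) = (g * k) • (t +ᵥ z)) ↔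
        r * t ∈ cuspTranslations Γ g := by
      constructor
      · rintro ⟨a, ha, hat⟩
        refine ⟨a, ha, fun z => ?_⟩
        have := hat (k⁻¹ • z)
        rwa [mul_smul, mul_smul, smul_inv_smul, hkv, smul_inv_smul] at this
      · rintro ⟨a, ha, hat⟩
        exact ⟨a, ha, fun z => by rw [mul_smul, mul_smul, hat, hkv]⟩
    rw [e1, hcyc, AddSubgroup.mem_closure_singleton]
    constructor
    · rintro ⟨n, hn⟩
      rw [zsmul_eq_mul, mul_comm] at hn
      exact ⟨n, mul_left_cancel₀ hr0.ne' hn⟩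
    · rintro ⟨n, rfl⟩
      exact ⟨n, by rw [zsmul_eq_mul, mul_comm]⟩
  · have h2 := congrArg Complex.im (hk (k⁻¹ • w))
    rw [smul_inv_smul, Complex.im_ofReal_mul] at h2
    have h3 : w.im = r * (k⁻¹ • w).im := h2
    have h4 := (k⁻¹ • w).im_pos
    nlinarith

/-! ### Shimizu's lemma -/

lemma im_sl_smul (a : SL(2, ℝ)) (z : ℍ) :
    (a • z).im = z.im / ((a 1 0 * z.re + a 1 1) ^ 2 + (a 1 0 * z.im) ^ 2) := by
  have hd := sl_denom_ne a z
  have hN : (a 1 0 * z.re + a 1 1) ^ 2 + (a 1 0 * z.im) ^ 2 =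
      Complex.normSq (((a 1 0 : ℝ) : ℂ) * z + ((a 1 1 : ℝ) : ℂ)) := by
    rw [Complex.normSq_apply]
    simp
    ring
  rw [hN, ← UpperHalfPlane.coe_im (a • z), sl_coe, Complex.div_im]
  have hdet := sl_det a
  have : 0 < Complex.normSq (((a 1 0 : ℝ) : ℂ) * z + ((a 1 1 : ℝ) : ℂ)) := Complex.normSq_pos.2 hd
  simp
  field_simp
  linear_combination hdet

lemma sq_lower_left_le {a : SL(2, ℝ)} {w w' : ℍ} (h : a • w = w') :
    (a 1 0) ^ 2 * w.im * w'.im ≤ 1 := by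
  rw [← h, im_sl_smul]
  have h1 := w.im_pos
  have h2 : 0 < (a 1 0 * w.re + a 1 1) ^ 2 + (a 1 0 * w.im) ^ 2 := by
    have h3 : 0 < (a • w).im := (a • w).im_pos
    rw [im_sl_smul] at h3
    by_contra! hle
    exact absurd h3 (not_lt.2 (div_nonpos_of_nonneg_of_nonpos h1.le hle))
  rw [mul_div_assoc', div_le_one h2]
  nlinarith [sq_nonneg (a 1 0 * w.re + a 1 1)]

lemma conj_trans_entries (A : SL(2, ℝ)) :
    (A * transMatrix 1 * A⁻¹) 0 0 = 1 - A 0 0 * A 1 0 ∧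
    (A * transMatrix 1 * A⁻¹) 0 1 = A 0 0 ^ 2 ∧
    (A * transMatrix 1 * A⁻¹) 1 0 = -A 1 0 ^ 2 ∧
    (A * transMatrix 1 * A⁻¹) 1 1 = 1 + A 0 0 * A 1 0 := by
  have hdet := sl_det A
  have t00 : transMatrix 1 0 0 = 1 := rfl
  have t01 : transMatrix 1 0 1 = 1 := rfl
  have t10 : transMatrix 1 1 0 = 0 := rfl
  have t11 : transMatrix 1 1 1 = 1 := rfl
  have i00 : A⁻¹ 0 0 = A 1 1 := by rw [Matrix.SpecialLinearGroup.SL2_inv_expl]; rfl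
  have i01 : A⁻¹ 0 1 = -A 0 1 := by rw [Matrix.SpecialLinearGroup.SL2_inv_expl]; rfl
  have i10 : A⁻¹ 1 0 = -A 1 0 := by rw [Matrix.SpecialLinearGroup.SL2_inv_expl]; rfl
  have i11 : A⁻¹ 1 1 = A 0 0 := by rw [Matrix.SpecialLinearGroup.SL2_inv_expl]; rfl
  simp only [sl_mul_apply, t00, t01, t10, t11, i00, i01, i10, i11]
  refine ⟨?_, ?_, ?_, ?_⟩
  · linear_combination hdet
  · ring
  · ring
  · linear_combination hdet

lemma sl_eq_or_neg_of_smul_eq {A B : SL(2, ℝ)} (h : ∀ z : ℍ, A • z = B • z) : A = B ∨ A = -B := by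
  have hne : UpperHalfPlane.I ≠ (1 : ℝ) +ᵥ UpperHalfPlane.I := (vadd_ne_self _ one_ne_zero).symm
  rcases eq_one_or_neg_one_of_smul_eq (a := B⁻¹ * A) hne
    (by rw [mul_smul, h, inv_smul_smul]) (by rw [mul_smul, h, inv_smul_smul]) with h1 | h1
  · left; exact (inv_mul_eq_one.1 h1).symm
  · right
    rw [inv_mul_eq_iff_eq_mul] at h1
    simpa using h1

lemma smul_I_mem_box {M : SL(2, ℝ)} {B : ℝ} (hB2 : 2 ≤ B) (ha1 : 1 / 2 ≤ M 0 0)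
    (ha2 : M 0 0 ≤ 3 / 2) (hb1 : 0 ≤ M 0 1) (hb2 : M 0 1 ≤ B ^ 2) (hc1 : |M 1 0| ≤ 1)
    (hd1 : 1 / 2 ≤ M 1 1) (hd2 : M 1 1 ≤ 3 / 2) : M • UpperHalfPlane.I ∈
      {w : ℍ | w.re ∈ Icc (-(8 * B ^ 2)) (8 * B ^ 2) ∧ w.im ∈ Icc (1 / 4) 4} := by
  obtain ⟨hc2, hc3⟩ := abs_le.1 hc1
  have him : (M • UpperHalfPlane.I).im =
      1 / (M 1 1 ^ 2 + M 1 0 ^ 2) := by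
    rw [im_sl_smul]; simp
  have hre : (M • UpperHalfPlane.I).re =
      (M 0 1 * M 1 1 + M 0 0 * M 1 0) /
        (M 1 1 ^ 2 + M 1 0 ^ 2) := by
    rw [← UpperHalfPlane.coe_re, sl_coe, Complex.div_re, Complex.normSq_apply]
    simp
    rw [← add_div]
    congr 1
    ring
  have hden1 : 1 / 4 ≤ M 1 1 ^ 2 + M 1 0 ^ 2 := by nlinarith
  have hden2 : M 1 1 ^ 2 + M 1 0 ^ 2 ≤ 4 := by nlinarith
  have hden0 : 0 < M 1 1 ^ 2 + M 1 0 ^ 2 := by linarith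
  refine ⟨?_, ?_⟩
  · rw [hre]
    have hB4 : 4 ≤ B ^ 2 := by nlinarith
    have e1 : 0 ≤ M 0 1 * M 1 1 := by positivity
    have e2 : M 0 1 * M 1 1 ≤ B ^ 2 * (3 / 2) :=
      mul_le_mul hb2 hd2 (by linarith) (by positivity)
    have e3 : |M 0 0 * M 1 0| ≤ 3 / 2 := by
      rw [abs_mul, abs_of_pos (by linarith : 0 < M 0 0)]
      nlinarith [abs_nonneg (M 1 0)]
    obtain ⟨e4, e5⟩ := abs_le.1 e3
    constructor
    · rw [le_div_iff₀ hden0]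
      nlinarith
    · rw [div_le_iff₀ hden0]
      nlinarith
  · rw [him]
    constructor
    · rw [le_div_iff₀ hden0]; linarith
    · rw [div_le_iff₀ hden0]; linarith

/-- Shimizu's lemma. -/
theorem lower_left_eq_zero [DiscreteTopology Γ] {g γ : SL(2, ℝ)} (hγ : γ ∈ Γ)
    (hγg : ∀ z : ℍ, γ • (g • z) = g • ((1 : ℝ) +ᵥ z)) {A a : SL(2, ℝ)} (ha : a ∈ Γ)
    (haA : ∀ z : ℍ, a • (g • z) = g • (A • z)) (hA : |A 1 0| ≤ 1 / 2) : A 1 0 = 0 := by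
  by_contra hc
  obtain ⟨S, hS0, hSs⟩ : ∃ S : ℕ → SL(2, ℝ), S 0 = A ∧
      ∀ n, S (n + 1) = S n * transMatrix 1 * (S n)⁻¹ :=
    ⟨fun n => Nat.rec A (fun _ B => B * transMatrix 1 * B⁻¹) n, rfl, fun _ => rfl⟩
  have hS : ∀ n, ∃ b ∈ Γ, ∀ z : ℍ, b • (g • z) = g • (S n • z) := by
    intro n
    induction n with
    | zero => exact ⟨a, ha, by rwa [hS0]⟩
    | succ n ih =>
      obtain ⟨b, hb, hbS⟩ := ih
      refine ⟨b * γ * b⁻¹, mul_mem (mul_mem hb hγ) (inv_mem hb), fun z => ?_⟩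
      have h1 : b⁻¹ • (g • z) = g • ((S n)⁻¹ • z) := by
        rw [inv_smul_eq_iff, hbS, smul_inv_smul]
      rw [hSs, mul_smul, mul_smul, h1, hγg, hbS, mul_smul, mul_smul, transMatrix_smul]
  choose b hbΓ hbS using hS
  have hrec : ∀ n, S (n + 1) 0 0 = 1 - S n 0 0 * S n 1 0 ∧ S (n + 1) 0 1 = S n 0 0 ^ 2 ∧
      S (n + 1) 1 0 = -S n 1 0 ^ 2 ∧ S (n + 1) 1 1 = 1 + S n 0 0 * S n 1 0 :=
    fun n => by rw [hSs]; exact conj_trans_entries (S n)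
  obtain ⟨B, hB2, hBA⟩ : ∃ B : ℝ, 2 ≤ B ∧ |A 0 0| ≤ B := ⟨_, le_max_left _ _, le_max_right _ _⟩
  have hbound : ∀ n, S n 1 0 ≠ 0 ∧ |S n 1 0| ≤ (1 / 2) ^ (n + 1) ∧ |S n 0 0| ≤ B := by
    intro n
    induction n with
    | zero => rw [hS0, zero_add, pow_one]; exact ⟨hc, hA, hBA⟩
    | succ n ih =>
      obtain ⟨h1, h2, h3⟩ := ih
      have h4 : |S n 1 0| ≤ 1 / 2 := h2.trans (by
        rw [pow_succ]
        have : (1 / 2 : ℝ) ^ n ≤ 1 := pow_le_one₀ (by norm_num) (by norm_num)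
        linarith)
      refine ⟨?_, ?_, ?_⟩
      · rw [(hrec n).2.2.1]
        simpa using h1
      · rw [(hrec n).2.2.1, abs_neg, abs_pow, pow_succ (1 / 2 : ℝ), sq]
        exact mul_le_mul h2 h4 (abs_nonneg _) (by positivity)
      · rw [(hrec n).1]
        refine (abs_sub _ _).trans ?_
        rw [abs_one, abs_mul]
        nlinarith [abs_nonneg (S n 0 0), abs_nonneg (S n 1 0)]
  have hanti : ∀ m n, m < n → |S n 1 0| < |S m 1 0| := by
    have h1 : StrictAnti fun n => |S n 1 0| := by
      refine strictAnti_nat_of_succ_lt fun n => ?_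
      rw [(hrec n).2.2.1, abs_neg, abs_pow, sq]
      obtain ⟨h1, h2, -⟩ := hbound n
      have h3 : 0 < |S n 1 0| := abs_pos.2 h1
      have h4 : |S n 1 0| ≤ 1 / 2 := h2.trans (by
        rw [pow_succ]
        have : (1 / 2 : ℝ) ^ n ≤ 1 := pow_le_one₀ (by norm_num) (by norm_num)
        linarith)
      nlinarith
    exact fun m n h => h1 h
  have hev : ∀ᶠ n in atTop, S (n + 1) • UpperHalfPlane.I ∈
      {w : ℍ | w.re ∈ Icc (-(8 * B ^ 2)) (8 * B ^ 2) ∧ w.im ∈ Icc (1 / 4) 4} := by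
    have h1 : Tendsto (fun n : ℕ => B * (1 / 2 : ℝ) ^ (n + 1)) atTop (𝓝 (B * 0)) :=
      ((tendsto_pow_atTop_nhds_zero_of_lt_one (by norm_num) (by norm_num)).comp
        (tendsto_add_atTop_nat 1)).const_mul B
    rw [mul_zero] at h1
    filter_upwards [h1.eventually (gt_mem_nhds (show (0 : ℝ) < 1 / 2 by norm_num))] with n hn
    obtain ⟨h00, h01, h10, h11⟩ := hrec n
    obtain ⟨-, h2, h3⟩ := hbound n
    obtain ⟨-, h4, -⟩ := hbound (n + 1)
    have h5 : |S n 0 0 * S n 1 0| ≤ 1 / 2 := by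
      rw [abs_mul]
      exact (mul_le_mul h3 h2 (abs_nonneg _) (by linarith)).trans hn.le
    obtain ⟨h6, h7⟩ := abs_le.1 h5
    have hc1 : |S (n + 1) 1 0| ≤ 1 := h4.trans (pow_le_one₀ (by norm_num) (by norm_num))
    have hd1 : 1 / 2 ≤ S (n + 1) 1 1 := by rw [h11]; linarith
    have hd2 : S (n + 1) 1 1 ≤ 3 / 2 := by rw [h11]; linarith
    have ha1 : 1 / 2 ≤ S (n + 1) 0 0 := by rw [h00]; linarith
    have ha2 : S (n + 1) 0 0 ≤ 3 / 2 := by rw [h00]; linarith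
    have hb1 : 0 ≤ S (n + 1) 0 1 := by rw [h01]; positivity
    have hb2 : S (n + 1) 0 1 ≤ B ^ 2 := by
      rw [h01, ← sq_abs]
      gcongr
    exact smul_I_mem_box hB2 ha1 ha2 hb1 hb2 hc1 hd1 hd2
  obtain ⟨n₀, hn₀⟩ := eventually_atTop.1 hev
  have hfin := finite_smul_mem_compact Γ (isCompact_singleton (x := g • UpperHalfPlane.I))
    ((isCompact_box (-(8 * B ^ 2)) (8 * B ^ 2) (1 / 4) 4 (by norm_num)).image
      (continuous_const_smul g))
  have hninj : ¬ Function.Injective fun n : ℕ => b (n₀ + n + 1) := fun hinj =>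
    hfin.not_infinite (Set.infinite_of_injective_forall_mem hinj fun n =>
      ⟨hbΓ _, _, rfl, _, hn₀ (n₀ + n) (by omega), (hbS _ _).symm⟩)
  rw [Function.not_injective_iff] at hninj
  obtain ⟨m, n, hmn, hne⟩ := hninj
  have hSmn : ∀ z : ℍ, S (n₀ + m + 1) • z = S (n₀ + n + 1) • z := by
    intro z
    apply smul_left_cancel g
    rw [← hbS, ← hbS, hmn]
  have habs : |S (n₀ + m + 1) 1 0| = |S (n₀ + n + 1) 1 0| := by
    rcases sl_eq_or_neg_of_smul_eq hSmn with h | h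
    · rw [h]
    · rw [h]; simp
  rcases lt_or_gt_of_ne hne with h | h
  · exact absurd habs (hanti _ _ (by omega)).ne'
  · exact absurd habs (hanti _ _ (by omega)).ne

/-- Elements which move a point high up at one cusp to a point high up at another one come from
translations. -/
theorem IsCusp.exists_translation [DiscreteTopology Γ] {g₁ g₂ : SL(2, ℝ)} (h₁ : IsCusp Γ g₁)
    (h₂ : IsCusp Γ g₂) {a : SL(2, ℝ)} (ha : a ∈ Γ) {w w' : ℍ} (hw : 2 < w.im) (hw' : 2 < w'.im)
    (haw : a • (g₂ • w) = g₁ • w') : ∃ t : ℝ, ∀ z : ℍ, a • (g₂ • z) = g₁ • (t +ᵥ z) := by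
  obtain ⟨γ₁, hγ₁, hγg₁⟩ := (h₁ 1).2 ⟨1, by simp⟩
  obtain ⟨γ₂, hγ₂, hγg₂⟩ := (h₂ 1).2 ⟨1, by simp⟩
  obtain ⟨b, hb⟩ : ∃ b, b = g₁⁻¹ * a * g₂ := ⟨_, rfl⟩
  have hbz : ∀ z : ℍ, a • (g₂ • z) = g₁ • (b • z) := fun z => by
    rw [hb, mul_smul, mul_smul, smul_inv_smul]
  clear hb
  have hbinv : ∀ z : ℍ, a⁻¹ • (g₁ • z) = g₂ • (b⁻¹ • z) := fun z => by
    rw [inv_smul_eq_iff, hbz, smul_inv_smul]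
  have hbw : b • w = w' := by
    apply smul_left_cancel g₁
    rw [← hbz, haw]
  have hc1 := sq_lower_left_le hbw
  have hc2 : (b 1 0) ^ 2 ≤ 1 / 2 := by
    have : 0 ≤ (b 1 0) ^ 2 := sq_nonneg _
    nlinarith [mul_pos (show 0 < w.im - 2 by linarith) (show 0 < w'.im - 2 by linarith)]
  have hconj : ∀ z : ℍ, (a * γ₂ * a⁻¹) • (g₁ • z) = g₁ • ((b * transMatrix 1 * b⁻¹) • z) := by
    intro z
    rw [mul_smul, mul_smul, hbinv, hγg₂, hbz, mul_smul, mul_smul, transMatrix_smul]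
  obtain ⟨-, -, hent, -⟩ := conj_trans_entries b
  have hc : b 1 0 = 0 := by
    have := lower_left_eq_zero hγ₁ hγg₁ (mul_mem (mul_mem ha hγ₂) (inv_mem ha)) hconj
      (by rw [hent, abs_neg, abs_of_nonneg (sq_nonneg _)]; exact hc2)
    rw [hent] at this
    simpa using this
  have hdet := sl_det b
  rw [hc, mul_zero, sub_zero] at hdet
  have hbcoe : ∀ z : ℍ, ((b • z : ℍ) : ℂ) = ((b 0 0 ^ 2 : ℝ) : ℂ) * z + ((b 0 0 * b 0 1 : ℝ) : ℂ) := by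
    intro z
    have hd := sl_denom_ne b z
    rw [sl_coe]
    rw [hc] at hd ⊢
    rw [div_eq_iff hd]
    have : ((b 0 0 : ℝ) : ℂ) * ((b 1 1 : ℝ) : ℂ) = 1 := by exact_mod_cast hdet
    push_cast
    linear_combination (-(b 0 0 : ℂ) * z - (b 0 1 : ℂ)) * this
  have hbv : ∀ (t : ℝ) (z : ℍ), b • (t +ᵥ z) = (b 0 0 ^ 2 * t) +ᵥ (b • z) := by
    intro t z
    apply UpperHalfPlane.coe_injective
    rw [hbcoe, UpperHalfPlane.coe_vadd, UpperHalfPlane.coe_vadd, hbcoe]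
    push_cast
    ring
  have hbv' : ∀ (t : ℝ) (z : ℍ), b⁻¹ • (t +ᵥ z) = (b 1 1 ^ 2 * t) +ᵥ (b⁻¹ • z) := by
    intro t z
    rw [inv_smul_eq_iff, hbv, smul_inv_smul]
    congr 1
    linear_combination (-t * (b 0 0 * b 1 1 + 1)) * hdet
  obtain ⟨m, hm⟩ := (h₁ (b 0 0 ^ 2)).1 ⟨a * γ₂ * a⁻¹, mul_mem (mul_mem ha hγ₂) (inv_mem ha),
    fun z => by
      rw [mul_smul, mul_smul, hbinv, hγg₂, hbz, hbv, smul_inv_smul, mul_one]⟩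
  obtain ⟨n, hn⟩ := (h₂ (b 1 1 ^ 2)).1 ⟨a⁻¹ * γ₁ * a, mul_mem (mul_mem (inv_mem ha) hγ₁) ha,
    fun z => by
      rw [mul_smul, mul_smul, hbz, hγg₁, hbinv, hbv', inv_smul_smul, mul_one]⟩
  have hmn : m * n = 1 := by
    have : ((m * n : ℤ) : ℝ) = 1 := by
      push_cast
      rw [hm, hn, ← mul_pow, hdet, one_pow]
    exact_mod_cast this
  have hm0 : 0 ≤ m := by
    have : (0 : ℝ) ≤ m := by rw [hm]; positivity
    exact_mod_cast this
  have hm1 : m = 1 := by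
    rcases Int.eq_one_or_neg_one_of_mul_eq_one hmn with h | h
    · exact h
    · omega
  rw [hm1] at hm
  refine ⟨b 0 0 * b 0 1, fun z => ?_⟩
  rw [hbz]
  congr 1
  apply UpperHalfPlane.coe_injective
  rw [hbcoe, UpperHalfPlane.coe_vadd, ← hm]
  push_cast
  ring

end

section

/-! ### Adding the punctures to `ℍ / Γ` -/

/-- A system of inequivalent normalized cusps, whose horoballs cover `ℍ / Γ` up to a
compact set. -/
structure IsCuspSystem (Γ : Subgroup SL(2, ℝ)) {I : Type} (g : I → SL(2, ℝ)) (K : Set ℍ) :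
    Prop extends IsCuspCover Γ g K where
  isCusp : ∀ i, IsCusp Γ (g i)
  eq_of_translation : ∀ i j, ∀ a ∈ Γ, ∀ t : ℝ, (∀ z : ℍ, a • (g i • z) = g j • (t +ᵥ z)) → i = j

variable {Γ Γ' : Subgroup SL(2, ℝ)}

theorem IsCuspCover.exists_isCuspSystem [DiscreteTopology Γ'] (hle : Γ ≤ Γ') {I : Type} [Finite I]
    {g : I → SL(2, ℝ)} {K : Set ℍ} (h : IsCuspCover Γ g K) :
    ∃ (J : Type) (_ : Finite J) (g' : J → SL(2, ℝ)), IsCuspSystem Γ' g' K := by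
  have hn : ∀ i, ∃ g', IsCusp Γ' g' ∧
      ∀ w : ℍ, 1 < w.im → ∃ w' : ℍ, 1 < w'.im ∧ g i • w = g' • w' := fun i => by
    obtain ⟨γ, hγ, hγg⟩ := h.translation i
    exact exists_isCusp ⟨γ, hle hγ, hγg⟩
  choose g₁ hg₁ hgg₁ using hn
  let s : Setoid I :=
    { r := fun i j => ∃ a ∈ Γ', ∃ t : ℝ, ∀ z : ℍ, a • (g₁ i • z) = g₁ j • (t +ᵥ z)
      iseqv :=
        { refl := fun i => ⟨1, one_mem _, 0, by simp⟩
          symm := by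
            rintro i j ⟨a, ha, t, hat⟩
            refine ⟨a⁻¹, inv_mem ha, -t, fun z => ?_⟩
            rw [inv_smul_eq_iff, hat, vadd_vadd]; simp
          trans := by
            rintro i j k ⟨a, ha, t, hat⟩ ⟨b, hb, u, hbu⟩
            exact ⟨b * a, mul_mem hb ha, u + t, fun z => by rw [mul_smul, hat, hbu, vadd_vadd]⟩ } }
  refine ⟨Quotient s, inferInstance, fun j => g₁ j.out, ⟨⟨h.isCompact, fun j => ?_, fun z => ?_⟩,
    fun j => hg₁ _, fun j k a ha t hat => ?_⟩⟩
  · exact (hg₁ j.out 1).2 ⟨1, by simp⟩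
  · obtain ⟨γ, hγ, hz | ⟨i, w, hw, hz⟩⟩ := h.cover z
    · exact ⟨γ, hle hγ, Or.inl hz⟩
    · obtain ⟨w', hw', hww⟩ := hgg₁ i w hw
      obtain ⟨a, ha, t, hat⟩ : s i (Quotient.mk s i).out := s.symm (Quotient.mk_out i)
      refine ⟨a * γ, mul_mem ha (hle hγ), Or.inr ⟨Quotient.mk s i, t +ᵥ w', ?_, ?_⟩⟩
      · rwa [UpperHalfPlane.vadd_im]
      · rw [mul_smul, hz, hww, hat]
  · rw [← Quotient.out_eq j, ← Quotient.out_eq k]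
    exact Quotient.sound ⟨a, ha, t, hat⟩

lemma IsCuspSystem.vadd_of_smul_eq [DiscreteTopology Γ] {I : Type} {g : I → SL(2, ℝ)} {K : Set ℍ}
    (h : IsCuspSystem Γ g K) {i j : I} {a : SL(2, ℝ)} (ha : a ∈ Γ) {w w' : ℍ} (hw : 2 < w.im)
    (hw' : 2 < w'.im) (haw : a • (g i • w) = g j • w') :
    i = j ∧ ∃ n : ℤ, ∀ z : ℍ, a • (g i • z) = g i • ((n : ℝ) +ᵥ z) := by
  obtain ⟨t, ht⟩ := (h.isCusp j).exists_translation (h.isCusp i) ha hw hw' haw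
  obtain rfl := h.eq_of_translation i j a ha t ht
  obtain ⟨n, rfl⟩ := (h.isCusp i t).1 ⟨a, ha, ht⟩
  exact ⟨rfl, n, ht⟩

/-- The space `ℍ / Γ` with one point added for each of the cusps `g i`. -/
def WithCusps (Γ : Subgroup SL(2, ℝ)) {I : Type} (_ : I → SL(2, ℝ)) : Type := Orbifold Γ ⊕ I

namespace WithCusps

variable {I : Type} {g : I → SL(2, ℝ)}

variable (Γ g) in
/-- The projection of `ℍ`. -/
def pt (z : ℍ) : WithCusps Γ g := Sum.inl (proj Γ z)

variable (Γ g) in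
/-- The added point at the cusp `g i`. -/
def cusp (i : I) : WithCusps Γ g := Sum.inr i

lemma pt_eq_iff {z w : ℍ} : pt Γ g z = pt Γ g w ↔ ∃ γ ∈ Γ, γ • z = w := by
  rw [← proj_eq_iff, eq_comm (a := proj Γ w)]; exact Sum.inl_injective.eq_iff

lemma pt_ne_cusp (z : ℍ) (i : I) : pt Γ g z ≠ cusp Γ g i := Sum.inl_ne_inr

lemma cusp_injective : Function.Injective (cusp Γ g) := Sum.inr_injective

lemma pt_smul {γ : SL(2, ℝ)} (hγ : γ ∈ Γ) (z : ℍ) : pt Γ g (γ • z) = pt Γ g z :=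
  (pt_eq_iff.2 ⟨γ, hγ, rfl⟩).symm

lemma exists_eq (x : WithCusps Γ g) : (∃ z, x = pt Γ g z) ∨ ∃ i, x = cusp Γ g i := by
  rcases x with x | i
  · obtain ⟨z, rfl⟩ := proj_surjective Γ x
    exact Or.inl ⟨z, rfl⟩
  · exact Or.inr ⟨i, rfl⟩

instance : TopologicalSpace (WithCusps Γ g) where
  IsOpen U := IsOpen (pt Γ g ⁻¹' U) ∧ ∀ i, cusp Γ g i ∈ U →
    ∃ T : ℝ, ∀ w : ℍ, T < w.im → pt Γ g (g i • w) ∈ U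
  isOpen_univ := ⟨isOpen_univ, fun _ _ => ⟨0, fun _ _ => mem_univ _⟩⟩
  isOpen_inter _ _ hU hV := ⟨hU.1.inter hV.1, fun i hi => by
    obtain ⟨T, hT⟩ := hU.2 i hi.1
    obtain ⟨T', hT'⟩ := hV.2 i hi.2
    exact ⟨max T T', fun w hw => ⟨hT w ((le_max_left _ _).trans_lt hw),
      hT' w ((le_max_right _ _).trans_lt hw)⟩⟩⟩
  isOpen_sUnion S hS := ⟨by
      rw [preimage_sUnion]
      exact isOpen_biUnion fun U hU => (hS U hU).1,
    fun i ⟨U, hU, hi⟩ => by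
      obtain ⟨T, hT⟩ := (hS U hU).2 i hi
      exact ⟨T, fun w hw => ⟨U, hU, hT w hw⟩⟩⟩

lemma isOpen_iff {U : Set (WithCusps Γ g)} : IsOpen U ↔ IsOpen (pt Γ g ⁻¹' U) ∧
    ∀ i, cusp Γ g i ∈ U → ∃ T : ℝ, ∀ w : ℍ, T < w.im → pt Γ g (g i • w) ∈ U := Iff.rfl

lemma continuous_pt : Continuous (pt Γ g) := ⟨fun _ hU => hU.1⟩

lemma preimage_image_pt (V : Set ℍ) : pt Γ g ⁻¹' (pt Γ g '' V) = proj Γ ⁻¹' (proj Γ '' V) := by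
  ext z
  constructor
  · rintro ⟨w, hw, hwz⟩
    exact ⟨w, hw, Sum.inl_injective hwz⟩
  · rintro ⟨w, hw, hwz⟩
    exact ⟨w, hw, congrArg Sum.inl hwz⟩

lemma isOpen_preimage_image_pt {V : Set ℍ} (hV : IsOpen V) :
    IsOpen (pt Γ g ⁻¹' (pt Γ g '' V)) := by
  rw [preimage_image_pt]
  exact ((isOpenQuotientMap_proj Γ).isOpenMap V hV).preimage (continuous_proj Γ)

lemma isOpenMap_pt : IsOpenMap (pt Γ g) := fun _ hV =>
  ⟨isOpen_preimage_image_pt hV, fun i ⟨z, _, hz⟩ => absurd hz (pt_ne_cusp z i)⟩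

variable (Γ g) in
/-- A neighbourhood of the added point. -/
def horo (i : I) (T : ℝ) : Set (WithCusps Γ g) :=
  insert (cusp Γ g i) (pt Γ g '' ((fun w => g i • w) '' {w : ℍ | T < w.im}))

lemma isOpen_setOf_lt_im (T : ℝ) : IsOpen {w : ℍ | T < w.im} :=
  isOpen_lt continuous_const UpperHalfPlane.continuous_im

lemma isOpen_horo (i : I) (T : ℝ) : IsOpen (horo Γ g i T) := by
  refine ⟨?_, fun j hj => ⟨T, fun w hw => ?_⟩⟩
  · have : pt Γ g ⁻¹' horo Γ g i T =
        pt Γ g ⁻¹' (pt Γ g '' ((fun w => g i • w) '' {w : ℍ | T < w.im})) := by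
      ext z
      exact or_iff_right (pt_ne_cusp z i)
    rw [this]
    exact isOpen_preimage_image_pt ((Homeomorph.smul (g i)).isOpenMap _ (isOpen_setOf_lt_im T))
  · rcases hj with hj | ⟨z, _, hz⟩
    · obtain rfl := cusp_injective hj
      exact Or.inr ⟨_, ⟨w, hw, rfl⟩, rfl⟩
    · exact absurd hz (pt_ne_cusp z j)

lemma cusp_mem_horo (i : I) (T : ℝ) : cusp Γ g i ∈ horo Γ g i T := mem_insert _ _

lemma pt_mem_horo {i : I} {T : ℝ} {z : ℍ} :
    pt Γ g z ∈ horo Γ g i T ↔ ∃ γ ∈ Γ, ∃ w : ℍ, T < w.im ∧ γ • z = g i • w := by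
  constructor
  · rintro (h | ⟨_, ⟨w, hw, rfl⟩, h⟩)
    · exact absurd h (pt_ne_cusp z i)
    · obtain ⟨γ, hγ, h⟩ := pt_eq_iff.1 h.symm
      exact ⟨γ, hγ, w, hw, h⟩
  · rintro ⟨γ, hγ, w, hw, h⟩
    exact Or.inr ⟨_, ⟨w, hw, rfl⟩, (pt_eq_iff.2 ⟨γ, hγ, h⟩).symm⟩

lemma exists_lt_im (T : ℝ) : ∃ w : ℍ, T < w.im :=
  ⟨⟨((max T 0 + 1 : ℝ) : ℂ) * Complex.I, by simp; positivity⟩, by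
    change T < (((max T 0 + 1 : ℝ) : ℂ) * Complex.I).im
    simp only [Complex.mul_I_im, Complex.ofReal_re]
    linarith [le_max_left T 0]⟩

lemma connectedSpace : ConnectedSpace (WithCusps Γ g) := by
  have hd : DenseRange (pt Γ g) := by
    intro x
    rcases exists_eq x with ⟨z, rfl⟩ | ⟨i, rfl⟩
    · exact subset_closure ⟨z, rfl⟩
    · rw [mem_closure_iff]
      intro U hU hi
      obtain ⟨T, hT⟩ := (isOpen_iff.1 hU).2 i hi
      obtain ⟨w, hw⟩ := exists_lt_im T
      exact ⟨_, hT w hw, _, rfl⟩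
  have := hd.preconnectedSpace continuous_pt
  exact ⟨⟨pt Γ g UpperHalfPlane.I⟩⟩

lemma finite_compl_range_pt [Finite I] : (range (pt Γ g))ᶜ.Finite := by
  refine (finite_range (cusp Γ g)).subset fun x hx => ?_
  rcases exists_eq x with ⟨z, rfl⟩ | ⟨i, rfl⟩
  · exact absurd ⟨z, rfl⟩ hx
  · exact ⟨i, rfl⟩

variable {K : Set ℍ}

lemma compactSpace [Finite I] (h : IsCuspSystem Γ g K) : CompactSpace (WithCusps Γ g) := by
  refine ⟨isCompact_iff_ultrafilter_le_nhds.2 fun 𝓤 _ => ?_⟩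
  by_cases hc : ∃ i, (𝓤 : Filter (WithCusps Γ g)) ≤ 𝓝 (cusp Γ g i)
  · obtain ⟨i, hi⟩ := hc
    exact ⟨_, mem_univ _, hi⟩
  push Not at hc
  have h1 : ∀ i, ∃ U, IsOpen U ∧ cusp Γ g i ∈ U ∧ U ∉ 𝓤 := by
    intro i
    by_contra! hU
    refine hc i fun V hV => ?_
    obtain ⟨U, hUV, hU', hi⟩ := mem_nhds_iff.1 hV
    exact mem_of_superset (hU U hU' hi) hUV
  choose U hUo hUi hU𝓤 using h1
  choose T hT using fun i => (isOpen_iff.1 (hUo i)).2 i (hUi i)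
  obtain ⟨L, hL, hcov⟩ := h.toIsCuspCover.exists_compact T
  have hLU : pt Γ g '' L ∈ 𝓤 := by
    refine mem_of_superset (iInter_mem.2 fun i =>
      Ultrafilter.compl_mem_iff_notMem.2 (hU𝓤 i)) fun x hx => ?_
    rcases exists_eq x with ⟨z, rfl⟩ | ⟨i, rfl⟩
    · obtain ⟨γ, hγ, hz | ⟨i, w, hw, -, hz⟩⟩ := hcov z
      · exact ⟨_, hz, pt_smul hγ z⟩
      · refine absurd ?_ (mem_iInter.1 hx i)
        rw [← pt_smul hγ z, hz]
        exact hT i w hw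
    · exact absurd (hUi i) (mem_iInter.1 hx i)
  obtain ⟨x, -, hx⟩ := (hL.image continuous_pt).ultrafilter_le_nhds 𝓤 (le_principal_iff.2 hLU)
  exact ⟨x, mem_univ _, hx⟩

instance t2Space_orbifold [DiscreteTopology Γ] : T2Space (Orbifold Γ) :=
  t2Space_of_properlyDiscontinuousSMul_of_t2Space

variable [DiscreteTopology Γ]

lemma t2Space (h : IsCuspSystem Γ g K) : T2Space (WithCusps Γ g) := by
  have h1 : ∀ (z : ℍ) (i : I), ∃ U V : Set (WithCusps Γ g), IsOpen U ∧ IsOpen V ∧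
      pt Γ g z ∈ U ∧ cusp Γ g i ∈ V ∧ Disjoint U V := by
    intro z i
    obtain ⟨N, hN, hzN⟩ := exists_compact_mem_nhds z
    obtain ⟨γ, hγ, hγg⟩ := h.translation i
    obtain ⟨T, -, hT⟩ := exists_height_bound hγ hγg hN
    refine ⟨pt Γ g '' interior N, horo Γ g i T, isOpenMap_pt _ isOpen_interior, isOpen_horo i T,
      ⟨z, mem_interior_iff_mem_nhds.2 hzN, rfl⟩, cusp_mem_horo i T, ?_⟩
    rw [Set.disjoint_left]
    rintro _ ⟨v, hv, rfl⟩ hvh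
    obtain ⟨a, ha, w, hw, hvw⟩ := pt_mem_horo.1 hvh
    exact absurd hw (not_lt.2 (hT a ha v (interior_subset hv) w hvw))
  refine ⟨fun x y hxy => ?_⟩
  rcases exists_eq x with ⟨z, rfl⟩ | ⟨i, rfl⟩ <;> rcases exists_eq y with ⟨w, rfl⟩ | ⟨j, rfl⟩
  · have hne : proj Γ z ≠ proj Γ w := fun h => hxy (congrArg Sum.inl h)
    obtain ⟨U, V, hU, hV, hz, hw, hd⟩ := t2_separation hne
    refine ⟨pt Γ g '' (proj Γ ⁻¹' U), pt Γ g '' (proj Γ ⁻¹' V),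
      isOpenMap_pt _ (hU.preimage (continuous_proj Γ)),
      isOpenMap_pt _ (hV.preimage (continuous_proj Γ)), ⟨z, hz, rfl⟩, ⟨w, hw, rfl⟩, ?_⟩
    rw [Set.disjoint_left]
    rintro _ ⟨v, hv, rfl⟩ ⟨v', hv', hvv⟩
    have : proj Γ v' = proj Γ v := Sum.inl_injective hvv
    exact Set.disjoint_left.1 hd hv (by rw [← this]; exact hv')
  · exact h1 z j
  · obtain ⟨U, V, hU, hV, h2, h3, hd⟩ := h1 w i
    exact ⟨V, U, hV, hU, h3, h2, hd.symm⟩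
  · refine ⟨horo Γ g i 2, horo Γ g j 2, isOpen_horo i 2, isOpen_horo j 2, cusp_mem_horo i 2,
      cusp_mem_horo j 2, ?_⟩
    rw [Set.disjoint_left]
    intro x hx hx'
    rcases exists_eq x with ⟨z, rfl⟩ | ⟨k, rfl⟩
    · obtain ⟨a, ha, w, hw, hzw⟩ := pt_mem_horo.1 hx
      obtain ⟨b, hb, w', hw', hzw'⟩ := pt_mem_horo.1 hx'
      have : (b * a⁻¹) • (g i • w) = g j • w' := by
        rw [← hzw, mul_smul, inv_smul_smul, hzw']
      exact hxy (by rw [(h.vadd_of_smul_eq (mul_mem hb (inv_mem ha)) hw hw' this).1])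
    · rcases hx with hx | ⟨z, _, hz⟩
      · rcases hx' with hx' | ⟨z, _, hz⟩
        · exact hxy (hx.symm.trans hx')
        · exact absurd hz (pt_ne_cusp z k)
      · exact absurd hz (pt_ne_cusp z k)

end WithCusps

/-- The cone points of an orbifold covered by a compact set and finitely many cusps are finite in
number. -/
theorem IsCuspSystem.finite_conePoints [DiscreteTopology Γ] {I : Type} [Finite I]
    {g : I → SL(2, ℝ)} {K : Set ℍ} (h : IsCuspSystem Γ g K) : (conePoints Γ).Finite := by
  obtain ⟨L, hL, hcov⟩ := h.toIsCuspCover.exists_compact fun _ => 2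
  have hloc : ∀ z : ℍ, ∃ N ∈ 𝓝 z, ∀ w ∈ N, proj Γ w ∈ conePoints Γ → w = z := by
    intro z
    obtain ⟨N, hN, hNz⟩ := exists_nhds_smul_eq_self Γ z
    refine ⟨N, hN, fun w hw hwc => ?_⟩
    by_contra hne
    obtain ⟨v, hvw, γ, hγ, h1, h2, hv⟩ := hwc
    obtain ⟨δ, hδ, rfl⟩ := (proj_eq_iff Γ).1 hvw.symm
    have hfix : (δ * γ * δ⁻¹) • (δ • v) = δ • v := by
      rw [mul_smul, mul_smul, inv_smul_smul, hv]
    have hfix' := hNz (δ * γ * δ⁻¹) (mul_mem (mul_mem hδ hγ) (inv_mem hδ)) (δ • v) hw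
      (by rwa [hfix])
    rcases eq_one_or_neg_one_of_smul_eq hne hfix hfix' with h3 | h3
    · exact h1 (by simpa [mul_inv_eq_one] using h3)
    · apply h2
      rw [mul_inv_eq_iff_eq_mul] at h3
      have : δ * γ = δ * (-1) := by rw [h3]; simp
      exact mul_left_cancel this
  choose N hN hNz using hloc
  obtain ⟨t, -, ht⟩ := hL.elim_nhds_subcover N fun z _ => hN z
  refine (t.finite_toSet.image (proj Γ)).subset fun x hx => ?_
  obtain ⟨z, rfl⟩ := proj_surjective Γ x
  obtain ⟨γ, hγ, hz | ⟨i, w, hw, -, hz⟩⟩ := hcov z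
  · obtain ⟨v, hv, hzv⟩ := mem_iUnion₂.1 (ht hz)
    rw [← proj_smul Γ hγ z] at hx ⊢
    exact ⟨v, hv, by rw [hNz v _ hzv hx]⟩
  · exfalso
    rw [← proj_smul Γ hγ z, hz] at hx
    obtain ⟨v, hvw, a, ha, h1, h2, hv⟩ := hx
    obtain ⟨δ, hδ, hvw⟩ := (proj_eq_iff Γ).1 hvw.symm
    have hfix : (δ * a * δ⁻¹) • (g i • w) = g i • w := by
      rw [← hvw, mul_smul, mul_smul, inv_smul_smul, hv]
    obtain ⟨-, n, hn⟩ := h.vadd_of_smul_eq (mul_mem (mul_mem hδ ha) (inv_mem hδ)) hw hw hfix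
    have hn0 : (n : ℝ) = 0 := by
      by_contra hne
      refine vadd_ne_self w hne (smul_left_cancel (g i) ?_)
      rw [← hn, hfix]
    have hall : ∀ z : ℍ, a • z = (1 : SL(2, ℝ)) • z := by
      intro z
      have := hn ((g i)⁻¹ • (δ • z))
      rw [smul_inv_smul, hn0, zero_vadd, smul_inv_smul, mul_smul, mul_smul, inv_smul_smul] at this
      rw [one_smul]
      exact smul_left_cancel δ this
    rcases sl_eq_or_neg_of_smul_eq hall with h3 | h3
    · exact h1 h3
    · exact h2 h3

end

section

/-! ### Constructing charts -/

/-- Two open maps with the same fibres differ by a local homeomorphism. -/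
lemma exists_openPartialHomeomorph {Z X Y : Type*} [TopologicalSpace Z] [TopologicalSpace X]
    [TopologicalSpace Y] [Nonempty Z] {U : Set Z} (hU : IsOpen U) {p : Z → X} {f : Z → Y}
    (hpc : ContinuousOn p U) (hpo : ∀ V ⊆ U, IsOpen V → IsOpen (p '' V))
    (hfc : ContinuousOn f U) (hfo : ∀ V ⊆ U, IsOpen V → IsOpen (f '' V))
    (hpf : ∀ z ∈ U, ∀ w ∈ U, p z = p w ↔ f z = f w) :
    ∃ e : OpenPartialHomeomorph X Y, e.source = p '' U ∧ ∀ z ∈ U, e (p z) = f z := by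
  have h1 : ∀ x, ∃ z, x ∈ p '' U → z ∈ U ∧ p z = x := fun x => by
    by_cases hx : x ∈ p '' U
    · obtain ⟨z, hz⟩ := hx
      exact ⟨z, fun _ => hz⟩
    · exact ⟨Classical.arbitrary Z, fun h => absurd h hx⟩
  have h2 : ∀ y, ∃ z, y ∈ f '' U → z ∈ U ∧ f z = y := fun x => by
    by_cases hx : x ∈ f '' U
    · obtain ⟨z, hz⟩ := hx
      exact ⟨z, fun _ => hz⟩
    · exact ⟨Classical.arbitrary Z, fun h => absurd h hx⟩
  choose σ hσ using h1
  choose τ hτ using h2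
  have hφ : ∀ z ∈ U, f (σ (p z)) = f z := fun z hz => by
    obtain ⟨h3, h4⟩ := hσ _ ⟨z, hz, rfl⟩
    exact (hpf _ h3 _ hz).1 h4
  have hψ : ∀ z ∈ U, p (τ (f z)) = p z := fun z hz => by
    obtain ⟨h3, h4⟩ := hτ _ ⟨z, hz, rfl⟩
    exact (hpf _ h3 _ hz).2 h4
  refine ⟨⟨⟨⟨fun x => f (σ x), fun y => p (τ y), p '' U, f '' U, ?_, ?_, ?_, ?_⟩, ?_, ?_⟩,
    hpo U subset_rfl hU, hfo U subset_rfl hU⟩, rfl, hφ⟩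
  · rintro _ ⟨z, hz, rfl⟩
    exact ⟨z, hz, (hφ z hz).symm⟩
  · rintro _ ⟨z, hz, rfl⟩
    exact ⟨z, hz, (hψ z hz).symm⟩
  · rintro _ ⟨z, hz, rfl⟩
    rw [hφ z hz, hψ z hz]
  · rintro _ ⟨z, hz, rfl⟩
    rw [hψ z hz, hφ z hz]
  · rw [continuousOn_open_iff (hpo U subset_rfl hU)]
    intro t ht
    convert hpo (U ∩ f ⁻¹' t) inter_subset_left (hfc.isOpen_inter_preimage hU ht) using 1
    ext x
    constructor
    · rintro ⟨⟨z, hz, rfl⟩, hx⟩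
      exact ⟨z, ⟨hz, by rw [mem_preimage, ← hφ z hz]; exact hx⟩, rfl⟩
    · rintro ⟨z, ⟨hz, hzt⟩, rfl⟩
      exact ⟨⟨z, hz, rfl⟩, by
        change f (σ (p z)) ∈ t
        rw [hφ z hz]; exact hzt⟩
  · rw [continuousOn_open_iff (hfo U subset_rfl hU)]
    intro t ht
    convert hfo (U ∩ p ⁻¹' t) inter_subset_left (hpc.isOpen_inter_preimage hU ht) using 1
    ext x
    constructor
    · rintro ⟨⟨z, hz, rfl⟩, hx⟩
      exact ⟨z, ⟨hz, by rw [mem_preimage, ← hψ z hz]; exact hx⟩, rfl⟩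
    · rintro ⟨z, ⟨hz, hzt⟩, rfl⟩
      exact ⟨⟨z, hz, rfl⟩, by
        change p (τ (f z)) ∈ t
        rw [hψ z hz]; exact hzt⟩

/-- A function is holomorphic if its composition with a holomorphic open function is. -/
lemma differentiableAt_of_comp_open {f h : ℂ → ℂ} {z : ℂ} (hf : AnalyticAt ℂ f z)
    (hfo : 𝓝 (f z) ≤ map f (𝓝 z)) (hc : ContinuousAt h (f z)) {k : ℂ → ℂ} (hk : AnalyticAt ℂ k z)
    (hhk : ∀ᶠ w in 𝓝 z, h (f w) = k w) : DifferentiableAt ℂ h (f z) := by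
  have hne : ∀ᶠ w in 𝓝[≠] z, deriv f w ≠ 0 := by
    refine hf.deriv.eventually_eq_zero_or_eventually_ne_zero.resolve_left fun h0 => ?_
    obtain ⟨ε, hε, hball⟩ := Metric.eventually_nhds_iff_ball.1
      (h0.and hf.eventually_analyticAt)
    have hconst : ∀ᶠ w in 𝓝 z, f w = f z := by
      filter_upwards [Metric.ball_mem_nhds z hε] with w hw
      exact Metric.isOpen_ball.is_const_of_deriv_eq_zero (convex_ball z ε).isPreconnected
        (fun v hv => (hball v hv).2.differentiableAt.differentiableWithinAt)
        (fun v hv => (hball v hv).1) hw (Metric.mem_ball_self hε)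
    have h1 : ({f z} : Set ℂ) ∈ 𝓝 (f z) := hfo (by rw [mem_map]; exact hconst)
    obtain ⟨u, hu, hu'⟩ := (Eventually.and (eventually_mem_nhdsWithin (a := f z) (s := {f z}ᶜ))
      (mem_nhdsWithin_of_mem_nhds h1)).exists
    exact hu hu'
  rw [eventually_nhdsWithin_iff] at hne
  have hgood : ∀ᶠ w in 𝓝 z, w ≠ z → DifferentiableAt ℂ h (f w) := by
    filter_upwards [hne, hf.eventually_analyticAt, hk.eventually_analyticAt,
      hhk.eventually_nhds] with w h1 h2 h3 h4 hwz
    have hs := h2.hasStrictDerivAt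
    have hs' := h1 hwz
    have h5 := hs.eventually_right_inverse hs'
    have hinv : hs.localInverse f (deriv f w) w hs' (f w) = w :=
      (hs.eventually_left_inverse hs').self_of_nhds
    have hd := (hs.to_localInverse hs').hasDerivAt
    have h6 : DifferentiableAt ℂ (fun u => k (hs.localInverse f (deriv f w) w hs' u)) (f w) := by
      refine DifferentiableAt.comp (f w) ?_ hd.differentiableAt
      rw [hinv]
      exact h3.differentiableAt
    refine h6.congr_of_eventuallyEq ?_
    have h7 : ∀ᶠ u in 𝓝 (f w), h (f (hs.localInverse f (deriv f w) w hs' u)) =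
        k (hs.localInverse f (deriv f w) w hs' u) := by
      refine hd.continuousAt.tendsto.eventually (p := fun v => h (f v) = k v) ?_
      rw [hinv]
      exact h4
    filter_upwards [h5, h7] with u hu hu'
    rw [← hu', hu]
  have hpunct : ∀ᶠ u in 𝓝 (f z), u ≠ f z → DifferentiableAt ℂ h u := by
    apply hfo
    rw [mem_map]
    filter_upwards [hgood] with w hw hwz
    exact hw fun h => hwz (by rw [h])
  exact (Complex.analyticAt_of_differentiable_on_punctured_nhds_of_continuousAt
    (eventually_nhdsWithin_iff.2 hpunct) hc).differentiableAt

lemma isOpenMap_cay : IsOpenMap cay := by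
  intro V hV
  have hc : ContinuousOn cayInv (Metric.ball 0 1) := by
    rw [UpperHalfPlane.isOpenEmbedding_coe.isInducing.continuousOn_iff]
    exact differentiableOn_cayInv.continuousOn
  convert hc.isOpen_inter_preimage Metric.isOpen_ball hV using 1
  ext u
  constructor
  · rintro ⟨z, hz, rfl⟩
    exact ⟨by simpa using norm_cay_lt z, by rwa [mem_preimage, cayInv_cay]⟩
  · rintro ⟨hu, hV⟩
    exact ⟨_, hV, cay_cayInv (by simpa using hu)⟩

lemma isOpenMap_complex_pow {n : ℕ} (hn : n ≠ 0) : IsOpenMap fun z : ℂ => z ^ n := by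
  have h : AnalyticOnNhd ℂ (fun z : ℂ => z ^ n) univ := fun z _ => by fun_prop
  rcases h.is_constant_or_isOpen isPreconnected_univ with ⟨w, hw⟩ | h
  · have h0 := hw 0 (mem_univ _)
    have h1 := hw 1 (mem_univ _)
    simp only [zero_pow hn, one_pow] at h0 h1
    exact absurd (h0.trans h1.symm) zero_ne_one
  · exact fun s hs => h s (subset_univ _) hs

lemma isOpenMap_exp : IsOpenMap fun z : ℂ => Complex.exp (2 * Real.pi * Complex.I * z) := by
  have h1 : IsOpenMap Complex.exp := Complex.isOpenMap_exp
  have h2 : (2 * Real.pi * Complex.I : ℂ) ≠ 0 := Complex.two_pi_I_ne_zero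
  exact h1.comp (Homeomorph.mulLeft₀ _ h2).isOpenMap

lemma HolUHP.differentiableAt_cay {α : ℍ → ℍ} (hα : HolUHP α) (z : ℍ) :
    DifferentiableAt ℂ (fun s => cay (α (UpperHalfPlane.ofComplex s))) z := by
  unfold cay
  exact ((hα z).sub_const _).div ((hα z).add_const _) (coe_add_I_ne_zero _)

variable {Γ : Subgroup SL(2, ℝ)}

/-- The stabilizer of a point acts by a group of roots of unity. -/
lemma exists_rotation_order [DiscreteTopology Γ] {b : SL(2, ℝ)} {z₀ : ℍ}
    (hb : b • UpperHalfPlane.I = z₀) : ∃ n : ℕ, n ≠ 0 ∧ ∀ c : ℂ, c ^ n = 1 ↔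
      ∃ γ ∈ Γ, γ • z₀ = z₀ ∧ ∀ z : ℍ, cay (b⁻¹ • (γ • (b • z))) = c * cay z := by
  obtain ⟨v, hv⟩ : ∃ v : ℍ, cay v ≠ 0 := ⟨(1 : ℝ) +ᵥ UpperHalfPlane.I, fun h =>
    vadd_ne_self _ one_ne_zero (cay_eq_zero_iff.1 h)⟩
  let C : Subgroup ℂˣ :=
    { carrier := {c | ∃ γ ∈ Γ, ∀ z : ℍ, cay (b⁻¹ • (γ • (b • z))) = c * cay z}
      one_mem' := ⟨1, one_mem _, fun z => by simp⟩
      mul_mem' := by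
        rintro c d ⟨γ, hγ, hc⟩ ⟨δ, hδ, hd⟩
        refine ⟨γ * δ, mul_mem hγ hδ, fun z => ?_⟩
        have := hc (b⁻¹ • (δ • (b • z)))
        rw [smul_inv_smul, hd] at this
        rw [mul_smul, this, Units.val_mul, mul_assoc]
      inv_mem' := by
        rintro c ⟨γ, hγ, hc⟩
        refine ⟨γ⁻¹, inv_mem hγ, fun z => ?_⟩
        have := hc (b⁻¹ • (γ⁻¹ • (b • z)))
        rw [smul_inv_smul, smul_inv_smul, inv_smul_smul] at this
        rw [this, ← mul_assoc, Units.inv_mul, one_mul] }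
  have hfix : ∀ (c : ℂ) (γ : SL(2, ℝ)), (∀ z : ℍ, cay (b⁻¹ • (γ • (b • z))) = c * cay z) →
      γ • z₀ = z₀ := by
    intro c γ h
    have := h UpperHalfPlane.I
    rw [cay_I, mul_zero, cay_eq_zero_iff, inv_smul_eq_iff, hb] at this
    exact this
  have hCfin : (C : Set ℂˣ).Finite := by
    refine Finite.of_finite_image (((finite_stabilizer (Γ := Γ) z₀).image
      fun γ => cay (b⁻¹ • (γ • (b • v))) / cay v).subset ?_) Units.val_injective.injOn
    rintro _ ⟨c, ⟨γ, hγ, hc⟩, rfl⟩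
    exact ⟨γ, ⟨hγ, hfix _ γ hc⟩, by simp only; rw [hc, mul_div_cancel_right₀ _ hv]⟩
  have : Finite C := hCfin
  have hn : Nat.card C ≠ 0 := Nat.card_pos.ne'
  have : NeZero (Nat.card C) := ⟨hn⟩
  have hle : C ≤ rootsOfUnity (Nat.card C) ℂ := fun c hc => by
    rw [mem_rootsOfUnity]
    have := pow_card_eq_one' (x := (⟨c, hc⟩ : C))
    exact congrArg Subtype.val this
  have hCeq : C = rootsOfUnity (Nat.card C) ℂ := by
    apply Subgroup.eq_of_le_of_card_ge hle
    exact card_rootsOfUnity ℂ _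
  refine ⟨Nat.card C, hn, fun c => ⟨fun hc => ?_, ?_⟩⟩
  · have hc0 : c ≠ 0 := by rintro rfl; simp [hn] at hc
    have hmem : Units.mk0 c hc0 ∈ C := by
      rw [hCeq, mem_rootsOfUnity]
      ext
      simpa using hc
    obtain ⟨γ, hγ, h⟩ := hmem
    exact ⟨γ, hγ, hfix _ γ h, h⟩
  · rintro ⟨γ, hγ, -, h⟩
    have hc0 : c ≠ 0 := by
      rintro rfl
      have h0 := h v
      rw [zero_mul, cay_eq_zero_iff, inv_smul_eq_iff, hb, smul_eq_iff_eq_inv_smul] at h0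
      have h1 : γ⁻¹ • z₀ = z₀ := by rw [inv_smul_eq_iff, hfix _ γ h]
      rw [h1, ← hb] at h0
      exact hv (by rw [smul_left_cancel b h0, cay_I])
    have hmem : Units.mk0 c hc0 ∈ C := ⟨γ, hγ, h⟩
    have := hle hmem
    rw [mem_rootsOfUnity] at this
    simpa using congrArg Units.val this

end

section

/-- The exponential coordinate of a punctured disc. -/
def cuspExp (z : ℍ) : ℂ := Complex.exp (2 * Real.pi * Complex.I * z)

lemma cuspExp_ne_zero (z : ℍ) : cuspExp z ≠ 0 := Complex.exp_ne_zero _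

lemma norm_cuspExp (z : ℍ) : ‖cuspExp z‖ = Real.exp (-(2 * Real.pi * z.im)) := by
  rw [cuspExp, Complex.norm_exp]
  congr 1
  simp

lemma norm_cuspExp_lt {z : ℍ} {r : ℝ} (hr : 0 < r) :
    ‖cuspExp z‖ < r ↔ -Real.log r / (2 * Real.pi) < z.im := by
  have hπ := Real.two_pi_pos
  rw [norm_cuspExp, ← Real.lt_log_iff_exp_lt hr, div_lt_iff₀ hπ]
  constructor <;> intro h <;> linarith

lemma cuspExp_eq_iff {z w : ℍ} : cuspExp z = cuspExp w ↔ ∃ n : ℤ, w = (n : ℝ) +ᵥ z := by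
  have h2 : (2 * Real.pi * Complex.I : ℂ) ≠ 0 := Complex.two_pi_I_ne_zero
  rw [cuspExp, cuspExp, eq_comm, Complex.exp_eq_exp_iff_exists_int]
  refine exists_congr fun n => ?_
  rw [UpperHalfPlane.ext_iff, UpperHalfPlane.coe_vadd]
  constructor
  · intro h
    apply mul_left_cancel₀ h2
    rw [h]
    push_cast
    ring
  · intro h
    rw [h]
    push_cast
    ring

lemma exists_cuspExp_eq {u : ℂ} (h0 : u ≠ 0) (h1 : ‖u‖ < 1) : ∃ z, cuspExp z = u := by
  have h2 : (2 * Real.pi * Complex.I : ℂ) ≠ 0 := Complex.two_pi_I_ne_zero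
  have hπ := Real.two_pi_pos
  have him : (Complex.log u / (2 * Real.pi * Complex.I)).im = -Real.log ‖u‖ / (2 * Real.pi) := by
    have : Complex.log u / (2 * Real.pi * Complex.I) =
        ((2 * Real.pi : ℝ) : ℂ)⁻¹ * (-Complex.I * Complex.log u) := by
      rw [div_eq_iff h2]
      have : (Real.pi : ℂ) ≠ 0 := by exact_mod_cast Real.pi_ne_zero
      push_cast
      field_simp
      linear_combination (Complex.log u) * Complex.I_sq
    rw [this, ← Complex.ofReal_inv, Complex.im_ofReal_mul]
    simp [Complex.log_re]
    field_simp
  refine ⟨⟨Complex.log u / (2 * Real.pi * Complex.I), ?_⟩, ?_⟩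
  · rw [him]
    have := Real.log_neg (norm_pos_iff.2 h0) h1
    exact div_pos (by linarith) hπ
  · change Complex.exp (2 * Real.pi * Complex.I * (Complex.log u / (2 * Real.pi * Complex.I))) = u
    rw [mul_div_cancel₀ _ h2, Complex.exp_log h0]

lemma isOpenMap_cuspExp : IsOpenMap cuspExp :=
  isOpenMap_exp.comp UpperHalfPlane.isOpenEmbedding_coe.isOpenMap

lemma continuous_cuspExp : Continuous cuspExp :=
  Complex.continuous_exp.comp (continuous_const.mul UpperHalfPlane.continuous_coe)

lemma HolUHP.differentiableAt_cuspExp {α : ℍ → ℍ} (hα : HolUHP α) (z : ℍ) :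
    DifferentiableAt ℂ (fun s => cuspExp (α (UpperHalfPlane.ofComplex s))) z :=
  ((hα z).const_mul _).cexp

variable {Γ : Subgroup SL(2, ℝ)}

namespace WithCusps

variable {I : Type} {g : I → SL(2, ℝ)} {K : Set ℍ}

/-- The chart is holomorphic away from the added points. -/
def IsPtChart (e : OpenPartialHomeomorph (WithCusps Γ g) ℂ) : Prop :=
  ∀ z, pt Γ g z ∈ e.source →
    DifferentiableAt ℂ (fun s => e (pt Γ g (UpperHalfPlane.ofComplex s))) z

lemma IsPtChart.analyticAt {e : OpenPartialHomeomorph (WithCusps Γ g) ℂ} (he : IsPtChart e) {z : ℍ}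
    (hz : pt Γ g z ∈ e.source) :
    AnalyticAt ℂ (fun s => e (pt Γ g (UpperHalfPlane.ofComplex s))) z := by
  rw [Complex.analyticAt_iff_eventually_differentiableAt, eventually_coe_UHP]
  filter_upwards [continuous_pt.continuousAt.eventually (e.open_source.mem_nhds hz)] with w hw
    using he w hw

lemma IsPtChart.differentiableAt_transition {e e' : OpenPartialHomeomorph (WithCusps Γ g) ℂ}
    (he : IsPtChart e) (he' : IsPtChart e') {z : ℍ} (hz : pt Γ g z ∈ e.source)
    (hz' : pt Γ g z ∈ e'.source) :
    DifferentiableAt ℂ (fun u => e' (e.symm u)) (e (pt Γ g z)) := by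
  have hoc : UpperHalfPlane.ofComplex z = z := UpperHalfPlane.ofComplex_apply z
  have := differentiableAt_of_comp_open (h := fun u => e' (e.symm u)) (he.analyticAt hz) ?_ ?_
    (he'.analyticAt hz') ?_
  · simpa only [hoc] using this
  · simp only [hoc]
    have h1 : 𝓝 (e (pt Γ g z)) ≤ map (fun w => e (pt Γ g w)) (𝓝 z) := by
      rw [← e.map_nhds_eq hz, ← Function.comp_def, ← map_map]
      exact map_mono (isOpenMap_pt.nhds_le z)
    refine h1.trans (le_of_eq ?_)
    rw [nhds_coe_UHP, map_map]
    simp [Function.comp_def]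
  · simp only [hoc]
    refine ContinuousAt.comp (f := e.symm) ?_ (e.continuousAt_symm (e.map_source hz))
    rw [e.left_inv hz]
    exact e'.continuousAt hz'
  · refine (eventually_ofComplex (p := fun w => e' (e.symm (e (pt Γ g w))) = e' (pt Γ g w))).2 ?_
    filter_upwards [continuous_pt.continuousAt.eventually (e.open_source.mem_nhds hz)] with w hw
    rw [e.left_inv hw]

variable [DiscreteTopology Γ]

variable (Γ g) in
lemma exists_isPtChart (z₀ : ℍ) : ∃ e : OpenPartialHomeomorph (WithCusps Γ g) ℂ,
    IsPtChart e ∧ pt Γ g z₀ ∈ e.source ∧ ∀ i, cusp Γ g i ∉ e.source := by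
  obtain ⟨b, hb⟩ := MulAction.exists_smul_eq SL(2, ℝ) UpperHalfPlane.I z₀
  obtain ⟨n, hn, hrot⟩ := exists_rotation_order (Γ := Γ) hb
  obtain ⟨N, hN, hNz⟩ := exists_nhds_smul_eq_self Γ z₀
  have hbz : b⁻¹ • z₀ = UpperHalfPlane.I := by rw [inv_smul_eq_iff, hb]
  have hco : IsOpenMap fun z : ℍ => cay (b⁻¹ • z) :=
    isOpenMap_cay.comp (Homeomorph.smul b⁻¹).isOpenMap
  have hcc : Continuous fun z : ℍ => cay (b⁻¹ • z) :=
    continuous_cay.comp (continuous_const_smul b⁻¹)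
  have hcinj : Function.Injective fun z : ℍ => cay (b⁻¹ • z) := fun z w h =>
    smul_left_cancel b⁻¹ (cay_injective h)
  obtain ⟨r, hr, hball⟩ := Metric.mem_nhds_iff.1
    (show (fun z : ℍ => cay (b⁻¹ • z)) '' N ∈ 𝓝 (0 : ℂ) by
      have := hco.image_mem_nhds hN
      rwa [hbz, cay_I] at this)
  set U : Set ℍ := {z | ‖cay (b⁻¹ • z)‖ < r} with hU
  have hUo : IsOpen U := isOpen_lt hcc.norm continuous_const
  have hUN : U ⊆ N := fun z hz => by
    obtain ⟨w, hw, hwz⟩ := hball (mem_ball_zero_iff.2 hz : cay (b⁻¹ • z) ∈ Metric.ball (0 : ℂ) r)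
    rwa [← hcinj hwz]
  have hfc : Continuous fun z : ℍ => cay (b⁻¹ • z) ^ n := hcc.pow n
  have hfo : IsOpenMap fun z : ℍ => cay (b⁻¹ • z) ^ n := (isOpenMap_complex_pow hn).comp hco
  have hpf : ∀ z ∈ U, ∀ w ∈ U, pt Γ g z = pt Γ g w ↔ cay (b⁻¹ • z) ^ n = cay (b⁻¹ • w) ^ n := by
    intro z hz w hw
    rw [pt_eq_iff]
    constructor
    · rintro ⟨γ, hγ, rfl⟩
      have hfix := hNz γ hγ z (hUN hz) (hUN hw)
      obtain ⟨c, -, hc⟩ := HolUHP.exists_rotation (α := fun z => (b⁻¹ * γ * b) • z)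
        (β := fun z => (b⁻¹ * γ * b)⁻¹ • z) (holUHP_smul _) (holUHP_smul _)
        (fun z => inv_smul_smul _ _)
        (by rw [mul_smul, mul_smul, hb, hfix, hbz])
      have hc' : ∀ z : ℍ, cay (b⁻¹ • (γ • (b • z))) = c * cay z := fun z => by
        rw [← hc, mul_smul, mul_smul]
      have hcn := (hrot c).2 ⟨γ, hγ, hfix, hc'⟩
      have := hc' (b⁻¹ • z)
      rw [smul_inv_smul] at this
      rw [this, mul_pow, hcn, one_mul]
    · intro h
      by_cases h0 : cay (b⁻¹ • z) = 0
      · rw [h0, zero_pow hn, eq_comm, pow_eq_zero_iff hn, ← h0] at h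
        exact ⟨1, one_mem _, by rw [one_smul]; exact (hcinj h).symm⟩
      · obtain ⟨γ, hγ, -, hc⟩ := (hrot (cay (b⁻¹ • w) / cay (b⁻¹ • z))).1
          (by rw [div_pow, h, div_self (by rw [← h]; exact pow_ne_zero n h0)])
        have := hc (b⁻¹ • z)
        rw [smul_inv_smul, div_mul_cancel₀ _ h0] at this
        exact ⟨γ, hγ, hcinj this⟩
  obtain ⟨e, he, hef⟩ := exists_openPartialHomeomorph hUo (p := pt Γ g)
    (f := fun z : ℍ => cay (b⁻¹ • z) ^ n) continuous_pt.continuousOn (fun V _ hV => isOpenMap_pt V hV)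
    hfc.continuousOn (fun V _ hV => hfo V hV) hpf
  refine ⟨e, fun z hz => ?_, ?_, fun i hi => ?_⟩
  · rw [he] at hz
    obtain ⟨w, hw, hwz⟩ := hz
    obtain ⟨γ, hγ, hwz⟩ := pt_eq_iff.1 hwz.symm
    have hd := ((holUHP_smul (b⁻¹ * γ)).differentiableAt_cay z).pow n
    refine hd.congr_of_eventuallyEq ?_
    refine (eventually_ofComplex (p := fun v => e (pt Γ g v) = cay ((b⁻¹ * γ) • v) ^ n)).2 ?_
    have hev : ∀ᶠ v : ℍ in 𝓝 z, γ • v ∈ U :=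
      (continuous_const_smul γ).continuousAt.eventually
        (hUo.mem_nhds (show γ • z ∈ U by rw [hwz]; exact hw))
    filter_upwards [hev] with v hv
    rw [mul_smul, ← hef _ hv, pt_smul hγ]
  · rw [he]
    exact ⟨z₀, by simp [hU, hbz, cay_I, hr], rfl⟩
  · rw [he] at hi
    obtain ⟨z, -, hz⟩ := hi
    exact pt_ne_cusp z i hz

lemma exists_cusp_isPtChart (h : IsCuspSystem Γ g K) (i : I) :
    ∃ e : OpenPartialHomeomorph (WithCusps Γ g) ℂ,
      IsPtChart e ∧ cusp Γ g i ∈ e.source ∧ ∀ j, cusp Γ g j ∈ e.source → j = i := by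
  have hψ' : ∀ u : ℂ, ∃ x : WithCusps Γ g, (u = 0 → x = cusp Γ g i) ∧
      ∀ z, cuspExp z = u → x = pt Γ g (g i • z) := by
    intro u
    by_cases h0 : u = 0
    · exact ⟨cusp Γ g i, fun _ => rfl, fun z hz => absurd (hz.trans h0) (cuspExp_ne_zero z)⟩
    by_cases h1 : ∃ z, cuspExp z = u
    · obtain ⟨z, hz⟩ := h1
      refine ⟨pt Γ g (g i • z), fun h => absurd h h0, fun w hw => ?_⟩
      obtain ⟨n, rfl⟩ := cuspExp_eq_iff.1 (hz.trans hw.symm)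
      obtain ⟨a, ha, hat⟩ := (h.isCusp i n).2 ⟨n, rfl⟩
      exact pt_eq_iff.2 ⟨a, ha, hat z⟩
    · exact ⟨cusp Γ g i, fun _ => rfl, fun z hz => absurd ⟨z, hz⟩ h1⟩
  choose ψ hψ0 hψ using hψ'
  have hψ0 : ψ 0 = cusp Γ g i := hψ0 0 rfl
  have hψE : ∀ z, ψ (cuspExp z) = pt Γ g (g i • z) := fun z => hψ _ z rfl
  set r : ℝ := Real.exp (-(4 * Real.pi)) with hr
  have hr0 : 0 < r := Real.exp_pos _
  have hr1 : r < 1 := Real.exp_lt_one_iff.2 (by linarith [Real.pi_pos])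
  have hrim : ∀ z, cuspExp z ∈ Metric.ball (0 : ℂ) r ↔ 2 < z.im := by
    intro z
    rw [mem_ball_zero_iff, norm_cuspExp_lt hr0, hr, Real.log_exp]
    have : -(-(4 * Real.pi)) / (2 * Real.pi) = 2 := by
      have := Real.pi_ne_zero
      field_simp
      norm_num
    rw [this]
  have hcases : ∀ u ∈ Metric.ball (0 : ℂ) r, u = 0 ∨ ∃ z : ℍ, 2 < z.im ∧ cuspExp z = u := by
    intro u hu
    by_cases h0 : u = 0
    · exact Or.inl h0
    · obtain ⟨z, hz⟩ := exists_cuspExp_eq h0 ((mem_ball_zero_iff.1 hu).trans hr1)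
      exact Or.inr ⟨z, (hrim z).1 (by rwa [hz]), hz⟩
  have hcont : ContinuousOn ψ (Metric.ball 0 r) := by
    intro u hu
    apply ContinuousAt.continuousWithinAt
    obtain rfl | ⟨z, -, rfl⟩ := hcases u hu
    · rw [ContinuousAt, hψ0, tendsto_nhds]
      intro V hV hiV
      obtain ⟨T, hT⟩ := (isOpen_iff.1 hV).2 i hiV
      have hρ : 0 < min 1 (Real.exp (-(2 * Real.pi * T))) := lt_min one_pos (Real.exp_pos _)
      filter_upwards [Metric.ball_mem_nhds (0 : ℂ) hρ] with u hu
      rw [mem_ball_zero_iff] at hu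
      by_cases h0 : u = 0
      · rw [mem_preimage, h0, hψ0]; exact hiV
      · obtain ⟨z, rfl⟩ := exists_cuspExp_eq h0 (hu.trans_le (min_le_left _ _))
        rw [mem_preimage, hψE]
        have h2 := hu.trans_le (min_le_right _ _)
        rw [norm_cuspExp, Real.exp_lt_exp, neg_lt_neg_iff] at h2
        exact hT z (lt_of_mul_lt_mul_left h2 Real.two_pi_pos.le)
    · rw [ContinuousAt, hψE]
      have h1 : Tendsto (fun v => ψ (cuspExp v)) (𝓝 z) (𝓝 (pt Γ g (g i • z))) := by
        simp only [hψE]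
        exact (continuous_pt.comp (continuous_const_smul (g i))).tendsto z
      exact (tendsto_map'_iff.2 h1).mono_left (isOpenMap_cuspExp.nhds_le z)
  have hopen : ∀ V ⊆ Metric.ball (0 : ℂ) r, IsOpen V → IsOpen (ψ '' V) := by
    intro V hVr hV
    have himage : pt Γ g ⁻¹' (ψ '' V) =
        pt Γ g ⁻¹' (pt Γ g '' ((fun z => g i • z) '' (cuspExp ⁻¹' V))) := by
      ext z
      constructor
      · rintro ⟨u, hu, huz⟩
        obtain rfl | ⟨w, -, rfl⟩ := hcases u (hVr hu)
        · rw [hψ0] at huz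
          exact absurd huz.symm (pt_ne_cusp z i)
        · rw [hψE] at huz
          exact ⟨_, ⟨w, hu, rfl⟩, huz⟩
      · rintro ⟨_, ⟨w, hw, rfl⟩, hwz⟩
        exact ⟨_, hw, by rw [hψE]; exact hwz⟩
    refine isOpen_iff.2 ⟨?_, ?_⟩
    · rw [himage]
      exact isOpen_preimage_image_pt
        ((Homeomorph.smul (g i)).isOpenMap _ (hV.preimage continuous_cuspExp))
    · rintro j ⟨u, hu, huj⟩
      obtain rfl | ⟨w, -, rfl⟩ := hcases u (hVr hu)
      · rw [hψ0] at huj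
        obtain rfl := cusp_injective huj
        obtain ⟨ε, hε, hεV⟩ := Metric.isOpen_iff.1 hV 0 hu
        refine ⟨-Real.log ε / (2 * Real.pi), fun w hw => ⟨cuspExp w, hεV ?_, hψE w⟩⟩
        rw [mem_ball_zero_iff]
        exact (norm_cuspExp_lt hε).2 hw
      · rw [hψE] at huj
        exact absurd huj (pt_ne_cusp _ j)
  have hinj : ∀ u ∈ Metric.ball (0 : ℂ) r, ∀ v ∈ Metric.ball (0 : ℂ) r, ψ u = ψ v ↔ id u = id v := by
    intro u hu v hv
    refine ⟨fun huv => ?_, fun huv => congrArg ψ huv⟩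
    obtain rfl | ⟨z, hz, rfl⟩ := hcases u hu <;> obtain rfl | ⟨w, hw, rfl⟩ := hcases v hv
    · rfl
    · rw [hψ0, hψE] at huv
      exact absurd huv.symm (pt_ne_cusp _ i)
    · rw [hψ0, hψE] at huv
      exact absurd huv (pt_ne_cusp _ i)
    · rw [hψE, hψE] at huv
      obtain ⟨a, ha, haz⟩ := pt_eq_iff.1 huv
      obtain ⟨-, n, hn⟩ := h.vadd_of_smul_eq ha hz hw haz
      rw [hn] at haz
      exact cuspExp_eq_iff.2 ⟨n, (smul_left_cancel (g i) haz).symm⟩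
  obtain ⟨e, he, hef⟩ := exists_openPartialHomeomorph Metric.isOpen_ball hcont hopen
    continuousOn_id (fun V _ hV => by simpa using hV) hinj
  refine ⟨e, fun z hz => ?_, ?_, fun j hj => ?_⟩
  · rw [he] at hz
    obtain ⟨u, hu, huz⟩ := hz
    obtain rfl | ⟨w, -, rfl⟩ := hcases u hu
    · rw [hψ0] at huz
      exact absurd huz.symm (pt_ne_cusp z i)
    rw [hψE] at huz
    obtain ⟨γ, hγ, hwz⟩ := pt_eq_iff.1 huz.symm
    have hwz' : ((g i)⁻¹ * γ) • z = w := by rw [mul_smul, hwz, inv_smul_smul]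
    refine ((holUHP_smul ((g i)⁻¹ * γ)).differentiableAt_cuspExp z).congr_of_eventuallyEq ?_
    refine (eventually_ofComplex
      (p := fun v => e (pt Γ g v) = cuspExp (((g i)⁻¹ * γ) • v))).2 ?_
    have hev : ∀ᶠ v : ℍ in 𝓝 z, cuspExp (((g i)⁻¹ * γ) • v) ∈ Metric.ball (0 : ℂ) r :=
      (continuous_cuspExp.comp (continuous_const_smul ((g i)⁻¹ * γ))).continuousAt.eventually
        (Metric.isOpen_ball.mem_nhds (by
          simp only [Function.comp_apply]
          rwa [hwz']))
    filter_upwards [hev] with v hv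
    have := hef _ hv
    rw [hψE, mul_smul, smul_inv_smul, pt_smul hγ] at this
    rw [this, mul_smul]
    rfl
  · rw [he]
    exact ⟨0, Metric.mem_ball_self hr0, hψ0⟩
  · rw [he] at hj
    obtain ⟨u, hu, huj⟩ := hj
    obtain rfl | ⟨w, -, rfl⟩ := hcases u hu
    · rw [hψ0] at huj
      exact (cusp_injective huj).symm
    · rw [hψE] at huj
      exact absurd huj (pt_ne_cusp _ j)

theorem exists_chartedSpace (h : IsCuspSystem Γ g K) :
    ∃ _ : ChartedSpace ℂ (WithCusps Γ g), IsManifold 𝓘(ℂ) ω (WithCusps Γ g) ∧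
      MDifferentiable 𝓘(ℂ) 𝓘(ℂ) (pt Γ g) := by
  choose C hC hCi hCj using exists_cusp_isPtChart h
  choose B hB hBz hBi using exists_isPtChart Γ g
  have hchart : ∀ x : WithCusps Γ g, ∃ e : OpenPartialHomeomorph (WithCusps Γ g) ℂ,
      e ∈ range B ∪ range C ∧ x ∈ e.source := by
    intro x
    rcases exists_eq x with ⟨z, rfl⟩ | ⟨i, rfl⟩
    · exact ⟨B z, Or.inl ⟨z, rfl⟩, hBz z⟩
    · exact ⟨C i, Or.inr ⟨i, rfl⟩, hCi i⟩
  have hpt : ∀ e ∈ range B ∪ range C, IsPtChart e := by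
    rintro _ (⟨z, rfl⟩ | ⟨i, rfl⟩)
    exacts [hB z, hC i]
  have hcusp : ∀ e ∈ range B ∪ range C, ∀ i, cusp Γ g i ∈ e.source → e = C i := by
    rintro _ (⟨z, rfl⟩ | ⟨i, rfl⟩) j hj
    · exact absurd hj (hBi z j)
    · rw [hCj i j hj]
  choose ch hch hchx using hchart
  let cs : ChartedSpace ℂ (WithCusps Γ g) :=
    { atlas := range B ∪ range C
      chartAt := ch
      mem_chart_source := hchx
      chart_mem_atlas := hch }
  refine ⟨cs, ?_, ?_⟩
  · refine isManifold_of_contDiffOn _ _ _ fun e e' he he' => ?_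
    have hopen : IsOpen (e.symm ≫ₕ e').source := (e.symm ≫ₕ e').open_source
    have hd : DifferentiableOn ℂ (fun u => e' (e.symm u)) (e.symm ≫ₕ e').source := by
      intro u hu
      apply DifferentiableAt.differentiableWithinAt
      rw [OpenPartialHomeomorph.trans_source] at hu
      obtain ⟨hu1, hu2⟩ := hu
      have hu3 : e.symm u ∈ e.source := e.map_target hu1
      have hu4 : e (e.symm u) = u := e.right_inv hu1
      rcases exists_eq (e.symm u) with ⟨z, hz⟩ | ⟨i, hi⟩
      · rw [← hu4, hz]
        rw [hz] at hu3
        exact (hpt e he).differentiableAt_transition (hpt e' he') hu3 (by rw [← hz]; exact hu2)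
      · have h1 : e = e' := by
          rw [hcusp e he i (by rw [← hi]; exact hu3), hcusp e' he' i (by rw [← hi]; exact hu2)]
        subst h1
        refine differentiableAt_id.congr_of_eventuallyEq ?_
        filter_upwards [e.open_target.mem_nhds hu1] with v hv using e.right_inv hv
    have hcd : ContDiffOn ℂ ω (fun u => e' (e.symm u)) (e.symm ≫ₕ e').source :=
      (hd.analyticOnNhd hopen).contDiffOn hopen.uniqueDiffOn
    simpa [Function.comp_def] using hcd
  · intro z
    rw [mdifferentiableAt_iff_target]
    refine ⟨continuous_pt.continuousAt, ?_⟩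
    rw [UpperHalfPlane.mdifferentiableAt_iff]
    exact hpt _ (hch (pt Γ g z)) z (hchx _)

end WithCusps

theorem IsCuspSystem.isFiniteType [DiscreteTopology Γ] {I : Type} [Finite I]
    {g : I → SL(2, ℝ)} {K : Set ℍ} (h : IsCuspSystem Γ g K) : IsFiniteType Γ := by
  obtain ⟨cs, hm, hπ⟩ := WithCusps.exists_chartedSpace h
  refine ⟨h.finite_conePoints, WithCusps Γ g, inferInstance, cs, hm, WithCusps.t2Space h,
    WithCusps.compactSpace h, WithCusps.connectedSpace, WithCusps.pt Γ g, hπ,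
    WithCusps.finite_compl_range_pt, fun z w => Sum.inl_injective.eq_iff⟩

theorem IsFiniteType.of_le {Γ' : Subgroup SL(2, ℝ)} [DiscreteTopology Γ] [DiscreteTopology Γ']
    (hΓ : IsFiniteType Γ) (hle : Γ ≤ Γ') : IsFiniteType Γ' := by
  obtain ⟨I, _, g, K, h⟩ := exists_isCuspCover hΓ
  obtain ⟨J, _, g', h'⟩ := h.exists_isCuspSystem hle
  exact h'.isFiniteType

end

section

/-! ### The projective structure on the quotient by the enlarged group -/

section Structure

variable {Γ : Subgroup SL(2, ℝ)} [DiscreteTopology Γ] {F : ℍ → OnePoint ℂ}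

lemma exists_chart_of_locBihol (hF : LocBihol F)
    (heq : ∀ a ∈ Γ, ∃ g : GL (Fin 2) ℂ, ∀ z, F (a • z) = g • F z)
    (hfin : (conePoints Γ).Finite) {z : ℍ} (hz : proj Γ z ∉ conePoints Γ) :
    ∃ e : OpenPartialHomeomorph (Orbifold Γ) (OnePoint ℂ), proj Γ z ∈ e.source ∧
      e.source ⊆ (conePoints Γ)ᶜ ∧ ∀ v, proj Γ v ∈ e.source →
        ∃ g : GL (Fin 2) ℂ, ∀ᶠ w in 𝓝 v, e (proj Γ w) = g • F w := by
  obtain ⟨N, hN, hNi⟩ := exists_injOn_proj Γ hz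
  obtain ⟨M, hM, hMi⟩ := hF.exists_injOn z
  have hC : proj Γ ⁻¹' (conePoints Γ)ᶜ ∈ 𝓝 z :=
    (hfin.isClosed.isOpen_compl.preimage (continuous_proj Γ)).mem_nhds hz
  obtain ⟨U, hU, hUo, hzU⟩ := mem_nhds_iff.1 (inter_mem (inter_mem hN hM) hC)
  obtain ⟨e, he, hef⟩ := exists_openPartialHomeomorph hUo (p := proj Γ) (f := F)
    (continuous_proj Γ).continuousOn (fun V _ hV => (isOpenQuotientMap_proj Γ).isOpenMap V hV)
    hF.continuous.continuousOn (fun V _ hV => hF.isOpenMap V hV)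
    (fun v hv w hw => by
      rw [(hNi).eq_iff (hU hv).1.1 (hU hw).1.1, hMi.eq_iff (hU hv).1.2 (hU hw).1.2])
  refine ⟨e, by rw [he]; exact ⟨z, hzU, rfl⟩, ?_, fun v hv => ?_⟩
  · rw [he]
    rintro _ ⟨v, hv, rfl⟩
    exact (hU hv).2
  · rw [he] at hv
    obtain ⟨u, hu, huv⟩ := hv
    obtain ⟨γ, hγ, rfl⟩ := (proj_eq_iff Γ).1 huv
    obtain ⟨g, hg⟩ := heq γ hγ
    refine ⟨g, ?_⟩
    filter_upwards [(continuous_const_smul γ).continuousAt.eventually (hUo.mem_nhds hu)] with w hw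
    rw [← proj_smul Γ hγ w, hef _ hw, hg]

/-- The projective structure on `ℍ / Γ` with developing map `F`. -/
def developStructure (hF : LocBihol F)
    (heq : ∀ a ∈ Γ, ∃ g : GL (Fin 2) ℂ, ∀ z, F (a • z) = g • F z)
    (hfin : (conePoints Γ).Finite) : SingularProjectiveStructure Γ where
  sing := conePoints Γ
  isClosed_sing := hfin.isClosed
  discrete_sing := hfin.instDiscreteTopology
  conePoints_subset := subset_rfl
  atlas := {e | e.source ⊆ (conePoints Γ)ᶜ ∧ ∀ z, proj Γ z ∈ e.source →
    ∃ g : GL (Fin 2) ℂ, ∀ᶠ w in 𝓝 z, e (proj Γ w) = g • F w}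
  source_subset _ h := h.1
  exists_chart x hx := by
    obtain ⟨z, rfl⟩ := proj_surjective Γ x
    obtain ⟨e, h1, h2, h3⟩ := exists_chart_of_locBihol hF heq hfin hx
    exact ⟨e, ⟨h2, h3⟩, h1⟩
  holomorphic := by
    rintro e ⟨-, he⟩ z hz
    obtain ⟨g, hg⟩ := he z hz
    obtain ⟨k, f, hf, -, hkf⟩ := hF z
    refine ⟨f, hf, k * g⁻¹, ?_⟩
    rw [eventually_coe_UHP]
    filter_upwards [hg, hkf] with w hw hw'
    rw [UpperHalfPlane.ofComplex_apply, hw, ← hw', mul_smul, inv_smul_smul]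
  moebius_transition := by
    rintro φ ⟨-, hφ⟩ ψ ⟨-, hψ⟩ x hx hx'
    obtain ⟨z, rfl⟩ := proj_surjective Γ x
    obtain ⟨g, hg⟩ := hφ z hx
    obtain ⟨k, hk⟩ := hψ z hx'
    refine ⟨k * g⁻¹, ?_⟩
    rw [← map_proj_nhds, eventually_map]
    filter_upwards [hg, hk] with w hw hw'
    rw [hw, hw', mul_smul, inv_smul_smul]

/-- If points with the same image under the developing map are equivalent, then the structure is
uniformizable. -/
theorem isUniformizable_developStructure (hF : LocBihol F)
    (heq : ∀ a ∈ Γ, ∃ g : GL (Fin 2) ℂ, ∀ z, F (a • z) = g • F z)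
    (hfin : (conePoints Γ).Finite) (hfib : ∀ z w, F z = F w → proj Γ z = proj Γ w) :
    (developStructure hF heq hfin).IsUniformizable := by
  have hCo : IsOpen (conePoints Γ)ᶜ := hfin.isClosed.isOpen_compl
  let R : Set ℍ := {z | proj Γ z ∉ conePoints Γ}
  have hRo : IsOpen R := hCo.preimage (continuous_proj Γ)
  let E : Type := {x : OnePoint ℂ // ∃ z ∈ R, F z = x}
  let Φ : R → E := fun z => ⟨F z, z, z.2, rfl⟩
  have hΦs : Function.Surjective Φ := by
    rintro ⟨_, z, hz, rfl⟩
    exact ⟨⟨z, hz⟩, rfl⟩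
  have hΦc : Continuous Φ := (hF.continuous.comp continuous_subtype_val).subtype_mk _
  have hΦo : IsOpenMap Φ := by
    have h1 : IsOpenMap fun z : R => F z := hF.isOpenMap.comp hRo.isOpenMap_subtype_val
    intro V hV
    refine ⟨_, h1 V hV, ?_⟩
    ext x
    constructor
    · rintro ⟨z, hz, hzx⟩
      exact ⟨z, hz, Subtype.ext hzx⟩
    · rintro ⟨z, hz, rfl⟩
      exact ⟨z, hz, rfl⟩
  have hΦs' := hΦs
  choose σ hσ using hΦs'
  let π : R → (developStructure hF heq hfin).Regular := fun z => ⟨proj Γ z, z.2⟩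
  let p : E → (developStructure hF heq hfin).Regular := fun x => π (σ x)
  have hpΦ : ∀ z : R, p (Φ z) = π z := fun z =>
    Subtype.ext (hfib _ _ (congrArg Subtype.val (hσ (Φ z))))
  have hπc : Continuous π := ((continuous_proj Γ).comp continuous_subtype_val).subtype_mk _
  have hpc : Continuous p := by
    rw [(IsOpenQuotientMap.mk hΦs hΦc hΦo).isQuotientMap.continuous_iff]
    exact hπc.congr fun z => (hpΦ z).symm
  have hmap : ∀ z, map Φ (𝓝 z) = 𝓝 (Φ z) := fun z =>
    (IsOpenQuotientMap.mk hΦs hΦc hΦo).map_nhds_eq z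
  refine ⟨E, inferInstance, p, Subtype.val, ⟨?_, ?_, ?_, ?_, ?_⟩, Subtype.val_injective⟩
  · have hR : IsConnected R := (isPathConnected_compl_of_discrete
      (eventually_proj_notMem Γ hfin.isClosed hfin.instDiscreteTopology)).isConnected
    have : ConnectedSpace R := isConnected_iff_connectedSpace.1 hR
    exact hΦs.connectedSpace hΦc
  · rw [isCoveringMap_iff_isCoveringMapOn_univ]
    refine isCoveringMapOn_of_sections hpc ?_
    rintro ⟨y, hy⟩ -
    obtain ⟨z, rfl⟩ := proj_surjective Γ y
    obtain ⟨N, hN, hNi⟩ := exists_injOn_proj Γ hy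
    obtain ⟨B, hBN, hBo, hzB, hBc⟩ := (locallyConnectedSpace_iff_subsets_isOpen_isConnected.1
      inferInstance) z _ (inter_mem hN (hRo.mem_nhds hy))
    have hBi : InjOn (proj Γ) B := hNi.mono fun x hx => (hBN hx).1
    obtain ⟨τ, hτ, hτ2⟩ := exists_section_of_injOn (isOpenQuotientMap_proj Γ).isOpenMap hBo hBi
    have hVo : IsOpen (proj Γ '' B) := (isOpenQuotientMap_proj Γ).isOpenMap _ hBo
    have hpV : ∀ x : E, ((p x : (developStructure hF heq hfin).Regular) : Orbifold Γ) ∈ proj Γ '' B →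
        ∃ b ∈ B, ∃ a ∈ Γ, F (a • b) = x := by
      rintro x ⟨b, hb, hbx⟩
      obtain ⟨a, ha, hab⟩ := (proj_eq_iff Γ).1 hbx.symm
      exact ⟨b, hb, a, ha, by rw [hab]; exact congrArg Subtype.val (hσ x)⟩
    have haB : ∀ a ∈ Γ, ∀ b ∈ B, a • b ∈ R := fun a ha b hb => by
      change proj Γ (a • b) ∉ _
      rw [proj_smul Γ ha]
      exact (hBN hb).2
    refine ⟨Subtype.val ⁻¹' (proj Γ '' B), hVo.preimage continuous_subtype_val, ⟨z, hzB, rfl⟩, ?_,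
      fun x hx => ?_, fun x hx => ?_⟩
    · have : Subtype.val ⁻¹' (proj Γ '' B) = π '' (Subtype.val ⁻¹' B) := by
        ext ⟨y, hy⟩
        constructor
        · rintro ⟨b, hb, rfl⟩
          exact ⟨⟨b, (hBN hb).2⟩, hb, rfl⟩
        · rintro ⟨b, hb, hby⟩
          exact ⟨b, hb, congrArg Subtype.val hby⟩
      rw [this]
      refine IsPreconnected.image ?_ _ hπc.continuousOn
      exact hBc.isPreconnected.preimage_of_isOpenMap Subtype.val_injective
        hRo.isOpenMap_subtype_val (by
          rw [Subtype.range_coe]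
          exact fun b hb => (hBN hb).2)
    · obtain ⟨b, hb, a, ha, hab⟩ := hpV x hx
      have hxe : x = Φ ⟨a • b, haB a ha b hb⟩ := Subtype.ext hab.symm
      refine ⟨Φ '' {v | a⁻¹ • (v : ℍ) ∈ B}, ?_, ?_⟩
      · rw [hxe]
        refine hΦo.image_mem_nhds ((hBo.preimage
          ((continuous_const_smul a⁻¹).comp continuous_subtype_val)).mem_nhds ?_)
        change a⁻¹ • (a • b) ∈ B
        rwa [inv_smul_smul]
      · rintro _ ⟨v, hv, rfl⟩ _ ⟨w, hw, rfl⟩ hvw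
        rw [hpΦ, hpΦ] at hvw
        have h1 : proj Γ (a⁻¹ • (v : ℍ)) = proj Γ (a⁻¹ • (w : ℍ)) := by
          rw [proj_smul Γ (inv_mem ha), proj_smul Γ (inv_mem ha)]
          exact congrArg Subtype.val hvw
        have h2 : v = w := Subtype.ext (smul_left_cancel _ (hBi hv hw h1))
        rw [h2]
    · obtain ⟨b, hb, a, ha, hab⟩ := hpV x hx
      have hmem : ∀ y : (developStructure hF heq hfin).Regular, (y : Orbifold Γ) ∈ proj Γ '' B →
          a • τ y ∈ R := by
        rintro _ ⟨c, hc, hcy⟩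
        rw [← hcy, hτ2 c hc]
        exact haB a ha c hc
      classical
      refine ⟨fun y => if h : (y : Orbifold Γ) ∈ proj Γ '' B then Φ ⟨a • τ y, hmem y h⟩ else x,
        ?_, ?_, ?_⟩
      · have hind : Topology.IsInducing fun e : E => (e : OnePoint ℂ) := .subtypeVal
        rw [hind.continuousOn_iff]
        have h1 : ContinuousOn (fun y : (developStructure hF heq hfin).Regular => F (a • τ y))
            (Subtype.val ⁻¹' (proj Γ '' B)) :=
          (hF.continuous.comp (continuous_const_smul a)).comp_continuousOn
            (hτ.comp continuous_subtype_val.continuousOn fun y hy => hy)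
        refine h1.congr fun y hy => ?_
        have hy' : (y : Orbifold Γ) ∈ proj Γ '' B := hy
        simp only [Function.comp_apply, dif_pos hy']
        rfl
      · intro y hy
        have hy' : (y : Orbifold Γ) ∈ proj Γ '' B := hy
        simp only [dif_pos hy']
        rw [hpΦ]
        apply Subtype.ext
        change proj Γ (a • τ y) = y
        obtain ⟨c, hc, hcy⟩ := hy'
        rw [proj_smul Γ ha, ← hcy, hτ2 c hc]
      · have hx' : ((p x : (developStructure hF heq hfin).Regular) : Orbifold Γ) ∈ proj Γ '' B := hx
        simp only [dif_pos hx']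
        apply Subtype.ext
        change F (a • τ (p x)) = x
        have h1 : ((p x : (developStructure hF heq hfin).Regular) : Orbifold Γ) = proj Γ b := by
          have h2 : x = Φ ⟨a • b, haB a ha b hb⟩ := Subtype.ext hab.symm
          rw [h2, hpΦ]
          exact proj_smul Γ ha b
        rw [h1, hτ2 b hb, hab]
  · rintro x φ ⟨-, hφ⟩ hx
    obtain ⟨g, hg⟩ := hφ (σ x) hx
    refine ⟨g⁻¹, ?_⟩
    rw [← hσ x, ← hmap, eventually_map]
    filter_upwards [continuous_subtype_val.continuousAt.eventually hg] with w hw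
    rw [hpΦ]
    change F w = g⁻¹ • φ (proj Γ w)
    rw [hw, inv_smul_smul]
  · intro x x' hxx'
    obtain ⟨a, ha, hax⟩ := (proj_eq_iff Γ).1 (congrArg Subtype.val hxx').symm
    obtain ⟨g, hg⟩ := heq a ha
    have hR : ∀ b ∈ Γ, ∀ z : R, b • (z : ℍ) ∈ R := fun b hb z => by
      change proj Γ (b • (z : ℍ)) ∉ _
      rw [proj_smul Γ hb]
      exact z.2
    have hg' : ∀ z, F (a⁻¹ • z) = g⁻¹ • F z := fun z => by
      rw [eq_inv_smul_iff, ← hg, smul_inv_smul]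
    have hact : ∀ b ∈ Γ, ∀ k : GL (Fin 2) ℂ, (∀ z, F (b • z) = k • F z) → ∀ e : E,
        ∃ z ∈ R, F z = k • (e : OnePoint ℂ) := by
      rintro b hb k hk ⟨_, z, hz, rfl⟩
      exact ⟨b • z, hR b hb ⟨z, hz⟩, hk z⟩
    let c : E ≃ₜ E :=
      { toFun := fun e => ⟨g • (e : OnePoint ℂ), hact a ha g hg e⟩
        invFun := fun e => ⟨g⁻¹ • (e : OnePoint ℂ), hact a⁻¹ (inv_mem ha) g⁻¹ hg' e⟩
        left_inv := fun e => Subtype.ext (inv_smul_smul _ _)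
        right_inv := fun e => Subtype.ext (smul_inv_smul _ _)
        continuous_toFun := ((continuous_gl_smul g).comp continuous_subtype_val).subtype_mk _
        continuous_invFun := ((continuous_gl_smul g⁻¹).comp continuous_subtype_val).subtype_mk _ }
    refine ⟨c, fun e => ?_, ?_⟩
    · have h1 : c e = Φ ⟨a • (σ e : ℍ), hR a ha (σ e)⟩ := by
        apply Subtype.ext
        change g • (e : OnePoint ℂ) = F (a • (σ e : ℍ))
        rw [hg]
        exact congrArg (g • ·) (congrArg Subtype.val (hσ e)).symm
      rw [h1, hpΦ]
      exact Subtype.ext (proj_smul Γ ha _)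
    · apply Subtype.ext
      change g • (x : OnePoint ℂ) = x'
      have h1 : F (σ x) = x := congrArg Subtype.val (hσ x)
      have h2 : F (σ x') = x' := congrArg Subtype.val (hσ x')
      rw [← h1, ← h2, ← hax, hg]
  · intro c _ hc
    exact Homeomorph.ext fun e => Subtype.ext (hc e)

end Structure

theorem exists_uniformizable {Γ : Subgroup SL(2, ℝ)} [DiscreteTopology Γ] (hfin : IsFiniteType Γ)
    (P : SingularProjectiveStructure Γ) (hP : P.IsBoundedCovering) :
    ∃ (Γ' : Subgroup SL(2, ℝ)) (P' : SingularProjectiveStructure Γ')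
      (q : Orbifold Γ → Orbifold Γ'), DiscreteTopology Γ' ∧ IsFiniteType Γ' ∧
      IsFiniteRamifiedCovering q ∧ P.IsPullback P' q ∧ P'.IsUniformizable := by
  obtain ⟨F, hF, hFP⟩ := hP.exists_isDeveloping
  have hdisc := hF.discreteTopology_developGroup P.isClosed_sing P.discrete_sing
  have hle := hF.le_developGroup
  have hfin' : IsFiniteType (developGroup Γ F) := hfin.of_le hle
  have heq : ∀ a ∈ developGroup Γ F, ∃ g : GL (Fin 2) ℂ, ∀ z, F (a • z) = g • F z := by
    rintro a ⟨-, -, g, -, hg⟩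
    exact ⟨g, hg⟩
  refine ⟨developGroup Γ F, developStructure hF.locBihol heq hfin'.1, orbifoldMap hle, hdisc, hfin',
    isFiniteRamifiedCovering_orbifoldMap hfin hle, ?_, ?_⟩
  · rintro φ hφ ψ ⟨-, hψ⟩ x hx hx'
    obtain ⟨z, rfl⟩ := proj_surjective Γ x
    obtain ⟨g, hg⟩ := hFP φ hφ z hx
    obtain ⟨k, hk⟩ := hψ z hx'
    refine ⟨k * g, ?_⟩
    rw [← map_proj_nhds, eventually_map]
    filter_upwards [hg, hk] with w hw hw'
    rw [orbifoldMap_proj, hw', hw, mul_smul]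
  · refine isUniformizable_developStructure _ _ _ fun z w hzw => ?_
    obtain ⟨a, ha, haz, -⟩ := hF.exists_mem_developGroup P.isClosed_sing P.discrete_sing
      (one_mem Γ) (g := 1) (by simp) (z := z) (w := w) (by simpa using hzw.symm)
    rw [← haz, proj_smul _ ha]

end

end ProjOrbifold

end

theorem mainTheorem6 (Γ : Subgroup SL(2, ℝ)) (hdisc : DiscreteTopology Γ)
    (hfin : ProjOrbifold.IsFiniteType Γ)
    (P : ProjOrbifold.SingularProjectiveStructure Γ) (hP : P.IsBoundedCovering) :
    ∃ (Γ' : Subgroup SL(2, ℝ)) (P' : ProjOrbifold.SingularProjectiveStructure Γ')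
      (q : ProjOrbifold.Orbifold Γ → ProjOrbifold.Orbifold Γ'),
      DiscreteTopology Γ' ∧ ProjOrbifold.IsFiniteType Γ' ∧
      ProjOrbifold.IsFiniteRamifiedCovering q ∧ P.IsPullback P' q ∧ P'.IsUniformizable :=
  ProjOrbifold.exists_uniformizable hfin P hP
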